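/- Let $a,D,L>0$ and $b,\theta_0,\theta_L,q\in\mathbb R$, and put $$A=\tfrac aD(\theta_0+b),\qquad B=\tfrac aD\,q,\qquad C=\tfrac aD(\theta_L+b).$$ Assume $CL\ge -1$. Consider the initial-boundary value problem (the Hopf–Cole transform of the infiltration problem with initial moisture $\theta_0$, bottom moisture $\theta_L$ and constant surface flux $q$) $$w_t=D\,w_{xx}\ (0<x<L,\ t>0),\quad w(x,0)=e^{-Ax},\quad w(0,t)=e^{Bt},\quad w_x(L,t)+C\,w(L,t)=0 .$$ A solution means a classical solution: $w$ is continuous on $[0,L]\times[0,\infty)$, the derivatives $w_t,w_x,w_{xx}$ exist and the equation holds for $0<x<L$, $t>0$, and for $t>0$ the one-sided derivative $w_x(L,t)$ exists and satisfies the last condition. Put $\Delta(\lambda,y)=\lambda\cos(\lambda y)-C\sin(\lambda y)$ and, if $q\ge 0$, $\gamma=\sqrt{B/D}$. Let $C^+$ be a contour in the open upper half-plane, traversed from left to right, with a continuous, piecewise continuously differentiable parametrisation $z:\mathbb R\to\mathbb C$ (finitely many break points) whose derivative is bounded and such that $z'(s)$ tends, as $s\to+\infty$ and as $s\to-\infty$,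 to nonzero limits; the two ends thereby have asymptotic directions $e^{i\varphi_+}$ (right end) and $e^{i(\pi-\varphi_-)}$ (left end), and it is assumed that $\varphi_\pm\in(0,\pi/4)$. A point is called inside $C^+$ if it lies in the connected component of $\mathbb C\setminus C^+$ that contains $iy$ for all large $y$, and outside $C^+$ if it lies in the component that contains the real axis. Assume that $i|A|$ is inside $C^+$ (so $A\ne0$) and that, if $q>0$, the point $i\gamma$ is not on $C^+$. Then the problem has exactly one solution $w$ on $[0,L]\times[0,\infty)$, and for $0<x\le L$, $t>0$ $$w(x,t)=w_1(x,t)+w_2(x,t),$$ with absolutely convergent integrals $$\begin{aligned}w_1(x,t)=\frac1{2\pi}\int_{C^+}\frac{e^{-D\lambda^2t}}{\Delta(\lambda,-L)}\Big[&\frac{e^{i\lambda x}(A-i\lambda)-e^{-AL}e^{i\lambda(L-x)}(A+i\lambda)}{A^2+\lambda^2}\,\Delta(\lambda,-L)\\&-e^{i\lambda L}(i\lambda+C)\sin(\lambda x)\,\frac{1-e^{-AL}e^{-i\lambda L}}{A+i\lambda}-\Delta(\lambda,x-L)\,\frac{1-e^{-AL}e^{i\lambda L}}{A-i\lambda}\\&+2i\lambda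 D\,\Delta(\lambda,x-L)\,\frac1{D\lambda^2+B}\Big]\,d\lambda,\end{aligned}$$ $$w_2(x,t)=-\frac1{2\pi}\int_{C^+}\frac{1}{\Delta(\lambda,-L)}\Big[2i\lambda D\,\Delta(\lambda,x-L)\,\frac{e^{Bt}}{D\lambda^2+B}\Big]\,d\lambda .$$ Moreover, for $0<x\le L$, $t>0$: if $q>0$ and $i\gamma$ is inside $C^+$, then $$w_2(x,t)=e^{Bt}\,\frac{\sqrt{aq}\,\cosh(\gamma(L-x))+a(\theta_L+b)\sinh(\gamma(L-x))}{\sqrt{aq}\,\cosh(\gamma L)+a(\theta_L+b)\sinh(\gamma L)};$$ if $q>0$ and $i\gamma$ is outside $C^+$, then $w_2(x,t)=0$; and if $q\le0$ (in particular if $q=0$), then $w_2(x,t)=0$. -/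

import Mathlib

open Set Filter Topology MeasureTheory

namespace Infiltration

noncomputable section

/-- `w` is a classical solution of the heat equation `w_t = D w_xx` on `0 < x < L`, `t > 0`, with
initial data `w(x,0) = exp (-A x)`, Dirichlet data `w(0,t) = exp (B t)` and the Robin condition
`w_x(L,t) + C w(L,t) = 0`. It is continuous up to the boundary, including the corners; only the
values of `w` on `[0,L] × [0,∞)` matter. -/
structure IsSolution (D L A B C : ℝ) (w : ℝ → ℝ → ℝ) : Prop where
  continuousOn : ContinuousOn (fun p : ℝ × ℝ => w p.1 p.2) (Icc 0 L ×ˢ Ici 0)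
  differentiableAt_t : ∀ x ∈ Ioo 0 L, ∀ t, 0 < t → DifferentiableAt ℝ (fun s => w x s) t
  differentiableAt_x : ∀ x ∈ Ioo 0 L, ∀ t, 0 < t → DifferentiableAt ℝ (fun y => w y t) x
  differentiableAt_xx : ∀ x ∈ Ioo 0 L, ∀ t, 0 < t →
    DifferentiableAt ℝ (deriv fun y => w y t) x
  heat : ∀ x ∈ Ioo 0 L, ∀ t, 0 < t →
    deriv (fun s => w x s) t = D * deriv (deriv fun y => w y t) x
  initial : ∀ x ∈ Ioo 0 L, w x 0 = Real.exp (-A * x)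
  dirichlet : ∀ t, 0 < t → w 0 t = Real.exp (B * t)
  robin : ∀ t, 0 < t → ∃ d : ℝ,
    HasDerivWithinAt (fun x => w x t) d (Icc 0 L) L ∧ d + C * w L t = 0

/-- `z : ℝ → ℂ` parametrises, from left to right, a piecewise continuously differentiable contour
in the open upper half-plane whose two ends are asymptotically straight, with directions strictly
between the real axis and the rays `arg = π/4` (right end) and `arg = 3π/4` (left end). -/
structure IsContour (z : ℝ → ℂ) : Prop where
  continuous : Continuous z
  piecewise : ∃ S : Set ℝ, S.Finite ∧ (∀ s, s ∉ S → DifferentiableAt ℝ z s) ∧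
    ContinuousOn (deriv z) Sᶜ ∧ ∃ M : ℝ, ∀ s, s ∉ S → ‖deriv z s‖ ≤ M
  upper : ∀ s, 0 < (z s).im
  right : ∃ v : ℂ, 0 < v.im ∧ v.im < v.re ∧ Tendsto (deriv z) atTop (𝓝 v)
  left : ∃ v : ℂ, 0 < v.re ∧ v.im < 0 ∧ -v.im < v.re ∧ Tendsto (deriv z) atBot (𝓝 v)

/-- The points inside the contour: the connected component of its complement lying above it,
i.e. the one that contains `i y` for all large `y`. -/
def inside (z : ℝ → ℂ) : Set ℂ :=
  {p | ∀ᶠ y : ℝ in atTop, JoinedIn (range z)ᶜ p (y * Complex.I)}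

/-- The points outside the contour: the connected component of its complement lying below it,
i.e. the one that contains the real axis. -/
def outside (z : ℝ → ℂ) : Set ℂ :=
  {p | JoinedIn (range z)ᶜ p 0}

/-- `∫_z f(lam) dlam`. -/
def contourIntegral (z : ℝ → ℂ) (f : ℂ → ℂ) : ℂ :=
  ∫ s : ℝ, f (z s) * deriv z s

/-- The integral over the contour converges absolutely. -/
def ContourIntegrable (z : ℝ → ℂ) (f : ℂ → ℂ) : Prop :=
  Integrable (fun s : ℝ => f (z s) * deriv z s)

/-- `Δ(lam, y) = lam cos (lam y) - C sin (lam y)`. -/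
def Delta (C : ℝ) (lam : ℂ) (y : ℝ) : ℂ :=
  lam * Complex.cos (lam * y) - C * Complex.sin (lam * y)

open Complex in
/-- The integrand of `w₁` (without the factor `1 / (2π)`). -/
def V₁ (D L A B C x t : ℝ) (lam : ℂ) : ℂ :=
  exp (-D * lam ^ 2 * t) / Delta C lam (-L) *
    ((exp (I * lam * x) * (A - I * lam) - exp (-A * L) * exp (I * lam * (L - x)) * (A + I * lam))
        / (A ^ 2 + lam ^ 2) * Delta C lam (-L)
      - exp (I * lam * L) * (I * lam + C) * sin (lam * x)
          * ((1 - exp (-A * L) * exp (-I * lam * L)) / (A + I * lam))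
      - Delta C lam (x - L) * ((1 - exp (-A * L) * exp (I * lam * L)) / (A - I * lam))
      + 2 * I * lam * D * Delta C lam (x - L) * (1 / (D * lam ^ 2 + B)))

open Complex in
/-- The integrand of `w₂` (without the factor `-1 / (2π)`). -/
def V₂ (D L B C x t : ℝ) (lam : ℂ) : ℂ :=
  1 / Delta C lam (-L) *
    (2 * I * lam * D * Delta C lam (x - L) * (exp (B * t) / (D * lam ^ 2 + B)))

/-- `w₁(x,t)`. -/
def w₁ (D L A B C : ℝ) (z : ℝ → ℂ) (x t : ℝ) : ℂ :=
  1 / (2 * Real.pi) * contourIntegral z (V₁ D L A B C x t)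

/-- `w₂(x,t)`. -/
def w₂ (D L B C : ℝ) (z : ℝ → ℂ) (x t : ℝ) : ℂ :=
  -(1 / (2 * Real.pi)) * contourIntegral z (V₂ D L B C x t)

end

end Infiltration

/-!
The Hopf-Cole transform of the infiltration problem is a heat equation on `0 < x < L` with a
Dirichlet datum at `x = 0` and a Robin condition at `x = L`. Its solution is a contour integral, and
the proof has three ingredients: uniqueness, residue calculus on the contour, and the verification
that the integral solves the problem.

*Uniqueness* (`IsSolution.unique`) is a maximum principle. Multiplying the difference of two
solutions by `exp (-K x - M t)` with `K > -C` and `M > D K ^ 2` gives both the Robin condition and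
the equation a sign that excludes a positive maximum; only one-sided derivatives are needed.

*Residue calculus.* The winding number of the contour about `p`, closed at infinity below, is
locally constant off the contour, equals `1` inside and `0` outside
(`IsContour.windingNumber_of_mem_inside`, `IsContour.windingNumber_of_mem_outside`). A holomorphic
function on the upper half-plane that is `O((Im lam) ^ (-2))` has the integral over vertical rays as
an antiderivative, so its contour integral vanishes; removing a simple pole gives the residue
theorem `IsContour.contourIntegral_div_sub`. The zeros of `Δ(·, -L)` are real when `C L ≥ -1`
(`Delta_ne_zero`), so the only poles in the upper half-plane are `i |A|` and, for `B > 0`, `i γ`.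
This evaluates `w₂` (`IsContour.w₂_eq`).

*The contour integral.* The integrand of `w₁` is `exp (-D lam ^ 2 t)` times
`2 i lam P / (lam ^ 2 + κ) - 2 i lam Φ / (lam ^ 2 + A ^ 2)`, where `κ = B / D`, and `P`, `Φ` solve
`φ'' = -lam ^ 2 φ` with the boundary data `φ(0) = 1`, `φ'(L) + C φ(L) = 0` and those of
`exp (-A x)`, respectively (`V₁_eq`). For `t > 0` the Gaussian factor permits differentiation
under the integral, which gives the heat equation. At `t = 0` the contour is closed above: the
pole `i γ` cancels against `w₂`, and the pole `i |A|` contributes `Φ(x, i |A|) = exp (-A x)`. At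
`x = 0` and `x = L` everything reduces to `J(t) = ∫ exp (-D lam ^ 2 t) 2 i lam / (lam ^ 2 + κ)`,
which satisfies `J' = D κ J`, since `lam exp (-D lam ^ 2 t)` is exact. Its constant is found by
comparison with a very high pole, for which `J` grows more slowly than `exp (D κ t)` and so
vanishes (`IsContour.gaussianIntegral_kernel`): `J(t) = 2 π (1 - n) exp (D κ t)`, with `n` the
winding number about the pole. For the pole `i |A|`, where `n = 1`, it is zero. Finally, because
the initial and boundary data agree at the corner, the integrand without its Gaussian factor is
`O(lam ^ (-2))` uniformly for `0 ≤ x ≤ L` (`IsContour.exists_norm_solutionTransform_le`), which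
yields continuity up to `x = 0` and `t = 0`.
-/

namespace Infiltration

/-! ### Growth along a contour and integration over it -/

lemma exists_forall_le_of_eventually {g : ℝ → ℝ} (hg : Continuous g) {K : ℝ}
    (h : ∀ᶠ s in cocompact ℝ, g s ≤ K) : ∃ K' : ℝ, 0 < K' ∧ ∀ s, g s ≤ K' := by
  obtain ⟨T, hT, hTK⟩ := mem_cocompact.1 h
  obtain ⟨M, hM⟩ := hT.exists_bound_of_continuousOn hg.continuousOn
  refine ⟨max (max K M) 1, by positivity, fun s => ?_⟩
  by_cases hs : s ∈ T
  · exact (le_abs_self _).trans ((hM s hs).trans ((le_max_right _ _).trans (le_max_left _ _)))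
  · have : g s ≤ K := hTK hs
    exact this.trans ((le_max_left _ _).trans (le_max_left _ _))

lemma exists_pos_forall_le_of_eventually {g : ℝ → ℝ} (hg : Continuous g) (hpos : ∀ s, 0 < g s)
    {c : ℝ} (hc : 0 < c) (h : ∀ᶠ s in cocompact ℝ, c ≤ g s) :
    ∃ c' : ℝ, 0 < c' ∧ ∀ s, c' ≤ g s := by
  obtain ⟨K, hK, hK'⟩ := exists_forall_le_of_eventually (g := fun s => (g s)⁻¹) (K := c⁻¹)
    (hg.inv₀ fun s => (hpos s).ne') (h.mono fun s hs => inv_anti₀ hc hs)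
  exact ⟨K⁻¹, inv_pos.2 hK, fun s => inv_le_of_inv_le₀ (hpos s) (hK' s)⟩

/-- A curve whose velocity tends to `v` has `v` as its asymptotic slope. -/
lemma tendsto_div_atTop_of_tendsto_deriv {z : ℝ → ℂ} {v : ℂ}
    (hd : ∀ᶠ s in atTop, DifferentiableAt ℝ z s) (h : Tendsto (deriv z) atTop (𝓝 v)) :
    Tendsto (fun s : ℝ => z s / s) atTop (𝓝 v) := by
  rw [Metric.tendsto_atTop]
  intro ε hε
  have h1 : ∀ᶠ s in atTop, DifferentiableAt ℝ z s ∧ dist (deriv z s) v < ε / 2 :=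
    hd.and (h (Metric.ball_mem_nhds v (half_pos hε)))
  obtain ⟨R, hR⟩ := eventually_atTop.1 h1
  set M := ‖z R - R * v‖ with hM
  refine ⟨max (max R 1) (4 * (M + ε * |R| + 1) / ε), fun s hs => ?_⟩
  have hsR : R ≤ s := ((le_max_left _ _).trans (le_max_left _ _)).trans hs
  have hs1 : 1 ≤ s := ((le_max_right _ _).trans (le_max_left _ _)).trans hs
  have hsM : 4 * (M + ε * |R| + 1) / ε ≤ s := (le_max_right _ _).trans hs
  have hder : ∀ u ∈ Ici R,
      HasDerivWithinAt (fun u : ℝ => z u - u * v) (deriv z u - v) (Ici R) u := by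
    intro u hu
    have h2 := (hR u hu).1.hasDerivAt
    have h3 : HasDerivAt (fun u : ℝ => (u : ℂ) * v) (1 * v) u :=
      (Complex.ofRealCLM.hasDerivAt).mul_const v
    rw [one_mul] at h3
    exact (h2.sub h3).hasDerivWithinAt
  have hb := (convex_Ici R).norm_image_sub_le_of_norm_hasDerivWithin_le (C := ε / 2) hder
    (fun u hu => by rw [← dist_eq_norm]; exact (hR u hu).2.le) (self_mem_Ici) hsR
  have hs0 : (s : ℂ) ≠ 0 := by
    exact_mod_cast (by linarith : s ≠ 0)
  have e1 : z s / s - v = ((z s - s * v)) / s := by field_simp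
  rw [dist_eq_norm, e1, norm_div, Complex.norm_real, Real.norm_of_nonneg (by linarith : 0 ≤ s),
    div_lt_iff₀ (by linarith)]
  have h4 : ‖z s - s * v‖ ≤ ‖z s - s * v - (z R - R * v)‖ + M := by
    have := norm_add_le (z s - s * v - (z R - R * v)) (z R - R * v)
    simpa using this
  have h5 : ‖s - R‖ ≤ s + |R| := by
    rw [Real.norm_of_nonneg (by linarith)]
    linarith [neg_abs_le R]
  have h6 : 4 * (M + ε * |R| + 1) ≤ s * ε := by rwa [div_le_iff₀ hε] at hsM
  have hM0 : 0 ≤ M := norm_nonneg _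
  have h7 : ε / 2 * ‖s - R‖ ≤ ε / 2 * (s + |R|) := by gcongr
  have h8 : 0 ≤ ε * |R| := by positivity
  nlinarith

namespace IsContour

variable {z : ℝ → ℂ} (hz : IsContour z)
include hz

lemma tendsto_div_atTop : ∃ v : ℂ, 0 < v.im ∧ v.im < v.re ∧
    Tendsto (fun s : ℝ => z s / s) atTop (𝓝 v) := by
  obtain ⟨v, h1, h2, h3⟩ := hz.right
  obtain ⟨S, hS, hd, -⟩ := hz.piecewise
  refine ⟨v, h1, h2, tendsto_div_atTop_of_tendsto_deriv ?_ h3⟩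
  obtain ⟨b, hb⟩ := hS.bddAbove
  filter_upwards [eventually_gt_atTop b] with s hs
  exact hd s fun h => (hb h).not_gt hs

lemma tendsto_div_atBot : ∃ v : ℂ, 0 < v.re ∧ v.im < 0 ∧ -v.im < v.re ∧
    Tendsto (fun s : ℝ => z s / s) atBot (𝓝 v) := by
  obtain ⟨v, h1, h2, h2', h3⟩ := hz.left
  obtain ⟨S, hS, hd, -⟩ := hz.piecewise
  refine ⟨v, h1, h2, h2', ?_⟩
  have key : Tendsto (fun s : ℝ => (fun r => -z (-r)) s / s) atTop (𝓝 v) := by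
    refine tendsto_div_atTop_of_tendsto_deriv ?_ ?_
    · obtain ⟨b, hb⟩ := hS.bddBelow
      filter_upwards [eventually_gt_atTop (-b)] with s hs
      have : DifferentiableAt ℝ z (-s) := hd _ fun h => (hb h).not_gt (by linarith)
      exact (this.comp s differentiableAt_id.neg).neg
    · have : deriv (fun r => -z (-r)) = fun r => deriv z (-r) := by
        ext r
        rw [deriv.fun_neg, deriv_comp_neg, neg_neg]
      rw [this]
      exact h3.comp tendsto_neg_atTop_atBot
  have := key.comp tendsto_neg_atBot_atTop
  refine this.congr fun s => ?_
  simp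

lemma exists_im_ge : ∃ c : ℝ, 0 < c ∧ ∀ s, c * (1 + |s|) ≤ (z s).im := by
  obtain ⟨v, hv, -, hv'⟩ := hz.tendsto_div_atTop
  obtain ⟨u, -, hu, -, hu'⟩ := hz.tendsto_div_atBot
  have h1 : Tendsto (fun s : ℝ => (z s).im / s) atTop (𝓝 v.im) := by
    refine ((Complex.continuous_im.tendsto v).comp hv').congr fun s => ?_
    simp [Complex.div_ofReal_im]
  have h2 : Tendsto (fun s : ℝ => (z s).im / s) atBot (𝓝 u.im) := by
    refine ((Complex.continuous_im.tendsto u).comp hu').congr fun s => ?_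
    simp [Complex.div_ofReal_im]
  obtain ⟨c, hc, h⟩ := exists_pos_forall_le_of_eventually
    (g := fun s => (z s).im / (1 + |s|)) (c := min (v.im / 4) (-u.im / 4))
    ((Complex.continuous_im.comp hz.continuous).div (by fun_prop) fun s => by positivity)
    (fun s => div_pos (hz.upper s) (by positivity)) (by
      apply lt_min <;> linarith) (by
      rw [cocompact_eq_atBot_atTop, eventually_sup]
      constructor
      · filter_upwards [h2.eventually (gt_mem_nhds (show u.im < u.im / 2 by linarith)),
          eventually_le_atBot (-1)] with s hs hs1
        rw [div_lt_iff_of_neg (by linarith)] at hs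
        rw [le_div_iff₀ (by positivity), abs_of_nonpos (by linarith)]
        calc _ ≤ -u.im / 4 * (1 + -s) := by
              apply mul_le_mul_of_nonneg_right (min_le_right _ _); linarith
          _ ≤ _ := by nlinarith
      · filter_upwards [h1.eventually (lt_mem_nhds (show v.im / 2 < v.im by linarith)),
          eventually_ge_atTop 1] with s hs hs1
        rw [lt_div_iff₀ (by linarith)] at hs
        rw [le_div_iff₀ (by positivity), abs_of_nonneg (by linarith)]
        calc _ ≤ v.im / 4 * (1 + s) := by
              apply mul_le_mul_of_nonneg_right (min_le_left _ _); linarith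
          _ ≤ _ := by nlinarith)
  exact ⟨c, hc, fun s => by have := h s; rwa [le_div_iff₀ (by positivity)] at this⟩

lemma exists_norm_le : ∃ K : ℝ, 0 < K ∧ ∀ s, ‖z s‖ ≤ K * (1 + |s|) := by
  obtain ⟨v, -, -, hv'⟩ := hz.tendsto_div_atTop
  obtain ⟨u, -, -, -, hu'⟩ := hz.tendsto_div_atBot
  have aux : ∀ s : ℝ, ∀ M, ‖z s / s‖ < M → 1 ≤ |s| → ‖z s‖ / (1 + |s|) ≤ M := by
    intro s M h hs
    rw [norm_div, Complex.norm_real, Real.norm_eq_abs, div_lt_iff₀ (by linarith)] at h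
    rw [div_le_iff₀ (by linarith)]
    have : 0 ≤ M := by
      by_contra hM
      push Not at hM
      nlinarith [norm_nonneg (z s)]
    nlinarith
  obtain ⟨K, hK, h⟩ := exists_forall_le_of_eventually
    (g := fun s => ‖z s‖ / (1 + |s|)) (K := max (‖v‖ + 1) (‖u‖ + 1))
    (hz.continuous.norm.div (by fun_prop) fun s => by positivity) (by
      rw [cocompact_eq_atBot_atTop, eventually_sup]
      constructor
      · filter_upwards [hu'.norm.eventually (gt_mem_nhds (show ‖u‖ < ‖u‖ + 1 by linarith)),
          eventually_le_atBot (-1)] with s hs hs1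
        exact (aux s _ hs (by rw [abs_of_nonpos] <;> linarith)).trans (le_max_right _ _)
      · filter_upwards [hv'.norm.eventually (gt_mem_nhds (show ‖v‖ < ‖v‖ + 1 by linarith)),
          eventually_ge_atTop 1] with s hs hs1
        exact (aux s _ hs (by rw [abs_of_nonneg] <;> linarith)).trans (le_max_left _ _))
  exact ⟨K, hK, fun s => by have := h s; rwa [div_le_iff₀ (by positivity)] at this⟩

/-- The directions of the ends make an angle less than `π / 4` with the real axis, so that
`exp (-lam ^ 2)` decays along the contour. -/
lemma exists_re_sq_ge : ∃ c m : ℝ, 0 < c ∧ 0 < m ∧ ∀ s, c * s ^ 2 - m ≤ (z s ^ 2).re := by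
  obtain ⟨v, hv1, hv2, hv'⟩ := hz.tendsto_div_atTop
  obtain ⟨u, hu1, hu2, hu3, hu'⟩ := hz.tendsto_div_atBot
  have hv : 0 < (v ^ 2).re := by
    rw [pow_two, Complex.mul_re]; nlinarith
  have hu : 0 < (u ^ 2).re := by
    rw [pow_two, Complex.mul_re]; nlinarith
  have e : ∀ s : ℝ, ((z s / s) ^ 2).re = (z s ^ 2).re / s ^ 2 := fun s => by
    rw [div_pow, ← Complex.ofReal_pow, Complex.div_ofReal_re]
  have h1 : Tendsto (fun s : ℝ => (z s ^ 2).re / s ^ 2) atTop (𝓝 (v ^ 2).re) :=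
    ((Complex.continuous_re.tendsto _).comp (hv'.pow 2)).congr e
  have h2 : Tendsto (fun s : ℝ => (z s ^ 2).re / s ^ 2) atBot (𝓝 (u ^ 2).re) :=
    ((Complex.continuous_re.tendsto _).comp (hu'.pow 2)).congr e
  set c := min ((v ^ 2).re / 2) ((u ^ 2).re / 2) with hc
  have hcpos : 0 < c := lt_min (by linarith) (by linarith)
  obtain ⟨m, hm, h⟩ := exists_forall_le_of_eventually
    (g := fun s => c * s ^ 2 - (z s ^ 2).re) (K := 0)
    (by have := hz.continuous; fun_prop) (by
      rw [cocompact_eq_atBot_atTop, eventually_sup]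
      constructor
      · filter_upwards [h2.eventually (lt_mem_nhds (show (u ^ 2).re / 2 < (u ^ 2).re by linarith)),
          eventually_le_atBot (-1)] with s hs hs1
        have : 0 < s ^ 2 := by nlinarith
        rw [lt_div_iff₀ this] at hs
        have := mul_le_mul_of_nonneg_right (min_le_right ((v ^ 2).re / 2) ((u ^ 2).re / 2)) this.le
        linarith
      · filter_upwards [h1.eventually (lt_mem_nhds (show (v ^ 2).re / 2 < (v ^ 2).re by linarith)),
          eventually_ge_atTop 1] with s hs hs1
        have : 0 < s ^ 2 := by nlinarith
        rw [lt_div_iff₀ this] at hs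
        have := mul_le_mul_of_nonneg_right (min_le_left ((v ^ 2).re / 2) ((u ^ 2).re / 2)) this.le
        linarith)
  exact ⟨c, m, hcpos, hm, fun s => by linarith [h s]⟩

lemma tendsto_im : Tendsto (fun s => (z s).im) (cocompact ℝ) atTop := by
  obtain ⟨c, hc, h⟩ := hz.exists_im_ge
  have h1 : Tendsto (fun s : ℝ => c * (1 + |s|)) (cocompact ℝ) atTop :=
    (tendsto_atTop_add_const_left _ _ tendsto_norm_cocompact_atTop).const_mul_atTop hc
  exact tendsto_atTop_mono h h1

lemma tendsto_cocompact : Tendsto z (cocompact ℝ) (cocompact ℂ) := by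
  rw [← Metric.cobounded_eq_cocompact (α := ℂ), ← comap_norm_atTop, tendsto_comap_iff]
  exact tendsto_atTop_mono (fun s => (le_abs_self _).trans (Complex.abs_im_le_norm _)) hz.tendsto_im

lemma isClosed_range : IsClosed (range z) := by
  have : IsProperMap z :=
    isProperMap_iff_tendsto_cocompact.2 ⟨hz.continuous, hz.tendsto_cocompact⟩
  exact this.isClosed_range

lemma exists_ae_norm_deriv_le : ∃ M : ℝ, 0 < M ∧ ∀ᵐ s : ℝ, ‖deriv z s‖ ≤ M := by
  obtain ⟨S, hS, -, -, M, hM⟩ := hz.piecewise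
  refine ⟨max M 1, by positivity, ?_⟩
  filter_upwards [hS.countable.ae_notMem volume] with s hs
  exact (hM s hs).trans (le_max_left _ _)

lemma integrable_mul_deriv {g : ℝ → ℂ} (hg : Continuous g) {K : ℝ}
    (h : ∀ s, ‖g s‖ ≤ K * (1 + s ^ 2)⁻¹) : Integrable fun s => g s * deriv z s := by
  obtain ⟨M, hM, hb⟩ := hz.exists_ae_norm_deriv_le
  refine Integrable.mono' ((integrable_inv_one_add_sq.const_mul K).mul_const M)
    (hg.aestronglyMeasurable.mul (measurable_deriv z).aestronglyMeasurable) ?_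
  filter_upwards [hb] with s hs
  rw [norm_mul]
  exact mul_le_mul (h s) hs (norm_nonneg _) ((norm_nonneg _).trans (h s))

/-- The fundamental theorem of calculus along the contour. -/
lemma contourIntegral_eq_sub {f Φ : ℂ → ℂ} (hΦ : ∀ s, HasDerivAt Φ (f (z s)) (z s))
    (hf : ContourIntegrable z f) {l₁ l₂ : ℂ} (h₁ : Tendsto (fun s => Φ (z s)) atTop (𝓝 l₁))
    (h₂ : Tendsto (fun s => Φ (z s)) atBot (𝓝 l₂)) : contourIntegral z f = l₁ - l₂ := by
  obtain ⟨S, hS, hd, -⟩ := hz.piecewise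
  have hcont : Continuous fun s => Φ (z s) :=
    continuous_iff_continuousAt.2 fun s =>
      (hΦ s).continuousAt.comp hz.continuous.continuousAt
  have key : ∀ T : ℝ, ∫ s in -T..T, f (z s) * deriv z s = Φ (z T) - Φ (z (-T)) := fun T =>
    integral_eq_of_hasDerivAt_off_countable (fun s => Φ (z s)) _ hS.countable hcont.continuousOn
      (fun s hs => (hΦ s).comp_of_eq s (hd s hs.2).hasDerivAt rfl) hf.intervalIntegrable
  have hl : Tendsto (fun T : ℝ => ∫ s in -T..T, f (z s) * deriv z s) atTop
      (𝓝 (contourIntegral z f)) :=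
    intervalIntegral_tendsto_integral hf tendsto_neg_atTop_atBot tendsto_id
  simp only [key] at hl
  exact tendsto_nhds_unique hl (h₁.sub (h₂.comp tendsto_neg_atTop_atBot))

lemma contourIntegral_eq_zero {f Φ : ℂ → ℂ} (hΦ : ∀ s, HasDerivAt Φ (f (z s)) (z s))
    (hf : ContourIntegrable z f) (h : Tendsto (fun s => Φ (z s)) (cocompact ℝ) (𝓝 0)) :
    contourIntegral z f = 0 := by
  rw [cocompact_eq_atBot_atTop, tendsto_sup] at h
  rw [hz.contourIntegral_eq_sub hΦ hf h.2 h.1, sub_zero]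

end IsContour

/-! ### Winding numbers -/

namespace IsContour

variable {z : ℝ → ℂ} (hz : IsContour z)
include hz

lemma integrable_mul_deriv_of_le {g : ℝ → ℂ} (hg : Continuous g) {K : ℝ}
    (h : ∀ s, ‖g s‖ ≤ K / (1 + |s|) ^ 2) : Integrable fun s => g s * deriv z s := by
  have hK : 0 ≤ K := by
    have := (norm_nonneg _).trans (h 0)
    simpa using this
  refine hz.integrable_mul_deriv hg (K := K) fun s => (h s).trans ?_
  rw [div_eq_mul_inv]
  have : 1 + s ^ 2 ≤ (1 + |s|) ^ 2 := by
    have := abs_nonneg s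
    rw [← sq_abs s]; nlinarith
  gcongr

lemma exists_norm_sub_ge {p : ℂ} (hp : p ∉ range z) :
    ∃ c : ℝ, 0 < c ∧ ∀ s, c * (1 + |s|) ≤ ‖z s - p‖ := by
  obtain ⟨c, hc, h⟩ := hz.exists_im_ge
  have hne : ∀ s, z s - p ≠ 0 := fun s h => hp ⟨s, sub_eq_zero.1 h⟩
  have hlarge : ∀ᶠ s : ℝ in cocompact ℝ, 2 * ‖p‖ / c ≤ |s| :=
    tendsto_norm_cocompact_atTop.eventually_ge_atTop _
  obtain ⟨c', hc', h'⟩ := exists_pos_forall_le_of_eventually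
    (g := fun s => ‖z s - p‖ / (1 + |s|)) (c := c / 2)
    ((hz.continuous.sub continuous_const).norm.div (by fun_prop) fun s => by positivity)
    (fun s => div_pos (norm_pos_iff.2 (hne s)) (by positivity)) (by positivity) (by
      filter_upwards [hlarge] with s hs
      rw [div_le_iff₀ hc] at hs
      rw [le_div_iff₀ (by positivity)]
      have h1 := (h s).trans ((le_abs_self _).trans (Complex.abs_im_le_norm (z s)))
      have h2 := norm_sub_norm_le (z s) p
      nlinarith)
  exact ⟨c', hc', fun s => by have := h' s; rwa [le_div_iff₀ (by positivity)] at this⟩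

lemma notMem_range_of_im_nonpos {p : ℂ} (hp : p.im ≤ 0) : p ∉ range z := by
  rintro ⟨s, rfl⟩
  exact hp.not_gt (hz.upper s)

lemma add_I_ne_zero (s : ℝ) : z s + Complex.I ≠ 0 := by
  intro h
  have := congrArg Complex.im h
  have h2 := hz.upper s
  simp at this
  linarith

lemma exists_norm_add_I_ge : ∃ c : ℝ, 0 < c ∧ ∀ s, c * (1 + |s|) ≤ ‖z s + Complex.I‖ := by
  simpa using hz.exists_norm_sub_ge (p := -Complex.I) (hz.notMem_range_of_im_nonpos (by simp))

end IsContour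

lemma notMem_range_of_mem_inside {z : ℝ → ℂ} {p : ℂ} (hp : p ∈ inside z) : p ∉ range z := by
  obtain ⟨y, hy⟩ := hp.exists
  exact hy.source_mem

/-- The winding number about `p` of the contour `z`, closed at infinity below. The second summand
makes the integral absolutely convergent, and contributes nothing since `-i` lies below `z`. -/
noncomputable def windingNumber (z : ℝ → ℂ) (p : ℂ) : ℂ :=
  (2 * Real.pi * Complex.I)⁻¹ *
    contourIntegral z fun lam => 1 / (lam - p) - 1 / (lam + Complex.I)

namespace IsContour

variable {z : ℝ → ℂ} (hz : IsContour z)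
include hz

lemma contourIntegrable_winding {p : ℂ} (hp : p ∉ range z) :
    ContourIntegrable z fun lam => 1 / (lam - p) - 1 / (lam + Complex.I) := by
  obtain ⟨c, hc, h⟩ := hz.exists_norm_sub_ge hp
  obtain ⟨d, hd, h'⟩ := hz.exists_norm_add_I_ge
  have hne : ∀ s, z s - p ≠ 0 := fun s h => hp ⟨s, sub_eq_zero.1 h⟩
  refine hz.integrable_mul_deriv_of_le (K := ‖p + Complex.I‖ / (c * d)) ?_ fun s => ?_
  · have := hz.continuous
    exact (continuous_const.div (by fun_prop) hne).sub
      (continuous_const.div (by fun_prop) hz.add_I_ne_zero)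
  · have e : 1 / (z s - p) - 1 / (z s + Complex.I)
        = (p + Complex.I) / ((z s - p) * (z s + Complex.I)) := by
      have := hne s
      have := hz.add_I_ne_zero s
      field_simp
      ring
    beta_reduce
    rw [e, norm_div, norm_mul, div_div]
    have h1 : c * d * (1 + |s|) ^ 2 ≤ ‖z s - p‖ * ‖z s + Complex.I‖ := by
      calc _ = (c * (1 + |s|)) * (d * (1 + |s|)) := by ring
        _ ≤ _ := by gcongr <;> [exact h s; exact h' s]
    gcongr

/-- The winding number is locally constant: its derivative is the integral of `1 / (lam - p) ^ 2`,
which has a single-valued antiderivative. -/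
lemma hasDerivAt_windingNumber {p : ℂ} (hp : p ∉ range z) :
    HasDerivAt (windingNumber z) 0 p := by
  obtain ⟨c, hc, h⟩ := hz.exists_norm_sub_ge hp
  obtain ⟨M, hM, hb⟩ := hz.exists_ae_norm_deriv_le
  have hcont := hz.continuous
  have hball : ∀ q ∈ Metric.ball p (c / 2), ∀ s, c / 2 * (1 + |s|) ≤ ‖z s - q‖ := by
    intro q hq s
    have h1 : ‖q - p‖ < c / 2 := by rwa [← dist_eq_norm]
    have h2 : ‖z s - p‖ ≤ ‖z s - q‖ + ‖q - p‖ := norm_sub_le_norm_sub_add_norm_sub ..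
    nlinarith [h s, abs_nonneg s]
  have hpos : ∀ s : ℝ, 0 < c / 2 * (1 + |s|) := fun s => by positivity
  have hne : ∀ q ∈ Metric.ball p (c / 2), ∀ s, z s - q ≠ 0 := fun q hq s =>
    norm_pos_iff.1 ((hpos s).trans_le (hball q hq s))
  have hnr : ∀ q ∈ Metric.ball p (c / 2), q ∉ range z := by
    rintro q hq ⟨s, rfl⟩
    exact hne _ hq s (sub_self _)
  have hpb : p ∈ Metric.ball p (c / 2) := Metric.mem_ball_self (by positivity)
  have hsq : ContourIntegrable z fun lam => 1 / (lam - p) ^ 2 := by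
    refine hz.integrable_mul_deriv_of_le (K := 1 / c ^ 2) ?_ fun s => ?_
    · exact continuous_const.div (by fun_prop) fun s => pow_ne_zero _ (hne p hpb s)
    · rw [norm_div, norm_pow, norm_one, div_div, ← mul_pow]
      gcongr
      exact h s
  have hzero : contourIntegral z (fun lam => 1 / (lam - p) ^ 2) = 0 := by
    refine hz.contourIntegral_eq_zero (Φ := fun lam => -(lam - p)⁻¹) (fun s => ?_) hsq ?_
    · convert! (((hasDerivAt_id (z s)).sub_const p).inv (hne p hpb s)).neg using 1
      simp [neg_div]
    · rw [← neg_zero]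
      refine (tendsto_inv₀_cobounded.comp ?_).neg
      rw [Metric.cobounded_eq_cocompact]
      exact (Homeomorph.subRight p).isClosedEmbedding.tendsto_cocompact.comp hz.tendsto_cocompact
  have key := (hasDerivAt_integral_of_dominated_loc_of_deriv_le (μ := volume) (𝕜 := ℂ)
    (F := fun q s => (1 / (z s - q) - 1 / (z s + Complex.I)) * deriv z s)
    (F' := fun q s => 1 / (z s - q) ^ 2 * deriv z s) (x₀ := p)
    (bound := fun s => (4 / c ^ 2) * (1 + s ^ 2)⁻¹ * M)
    (Metric.ball_mem_nhds p (half_pos hc)) ?_ (hz.contourIntegrable_winding hp) hsq.1 ?_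
    ((integrable_inv_one_add_sq.const_mul _).mul_const _) ?_).2
  · have := key.const_mul (2 * Real.pi * Complex.I)⁻¹
    rw [show (∫ s, 1 / (z s - p) ^ 2 * deriv z s) = 0 from hzero, mul_zero] at this
    exact this
  · filter_upwards [Metric.ball_mem_nhds p (half_pos hc)] with q hq
    exact (hz.contourIntegrable_winding (hnr q hq)).1
  · filter_upwards [hb] with s hs q hq
    rw [norm_mul, norm_div, norm_pow, norm_one]
    refine mul_le_mul ?_ hs (norm_nonneg _) (by positivity)
    have h1 : (c / 2) ^ 2 * (1 + s ^ 2) ≤ ‖z s - q‖ ^ 2 := by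
      calc _ ≤ (c / 2 * (1 + |s|)) ^ 2 := by
            rw [mul_pow]
            gcongr
            rw [← sq_abs s]
            nlinarith [abs_nonneg s]
        _ ≤ _ := by
            gcongr
            exact hball q hq s
    calc _ ≤ 1 / ((c / 2) ^ 2 * (1 + s ^ 2)) := by gcongr
      _ = _ := by
        field_simp
        norm_num
  · refine ae_of_all _ fun s q hq => ?_
    have h1 : HasDerivAt (fun q => 1 / (z s - q)) (1 / (z s - q) ^ 2) q := by
      simp only [one_div]
      convert! ((hasDerivAt_id q).const_sub (z s)).inv (hne q hq s) using 1
      simp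
    simpa using (h1.sub_const (1 / (z s + Complex.I))).mul_const (deriv z s)

lemma windingNumber_eq_of_joinedIn {p q : ℂ} (h : JoinedIn (range z)ᶜ p q) :
    windingNumber z p = windingNumber z q := by
  have hopen : IsOpen (pathComponentIn (range z)ᶜ p) :=
    hz.isClosed_range.isOpen_compl.pathComponentIn p
  have hd : ∀ r ∈ pathComponentIn (range z)ᶜ p, HasDerivAt (windingNumber z) 0 r := fun r hr =>
    hz.hasDerivAt_windingNumber (pathComponentIn_subset hr)
  exact hopen.is_const_of_deriv_eq_zero
    (isPathConnected_pathComponentIn h.source_mem).isConnected.isPreconnected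
    (fun r hr => (hd r hr).differentiableAt.differentiableWithinAt)
    (fun r hr => (hd r hr).deriv) (mem_pathComponentIn_self h.source_mem) h

lemma windingNumber_of_im_nonpos {p : ℂ} (hp : p.im ≤ 0) : windingNumber z p = 0 := by
  have h : JoinedIn (range z)ᶜ p (-Complex.I) := by
    refine JoinedIn.of_segment_subset ?_
    have h1 : segment ℝ p (-Complex.I) ⊆ {w : ℂ | w.im ≤ 0} :=
      (convex_halfSpace_im_le 0).segment_subset hp (by simp)
    exact fun w hw => hz.notMem_range_of_im_nonpos (h1 hw)
  rw [hz.windingNumber_eq_of_joinedIn h]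
  simp [windingNumber, contourIntegral]

lemma windingNumber_of_mem_outside {p : ℂ} (hp : p ∈ outside z) : windingNumber z p = 0 := by
  rw [hz.windingNumber_eq_of_joinedIn hp, hz.windingNumber_of_im_nonpos le_rfl]

lemma exists_forall_re_ne_zero_or_im_sq_lt : ∃ m : ℝ, 0 < m ∧
    ∀ y : ℝ, m < y ^ 2 → ∀ s, (z s).re ≠ 0 ∨ (z s).im ^ 2 < y ^ 2 := by
  obtain ⟨c, m, hc, hm, h⟩ := hz.exists_re_sq_ge
  refine ⟨m, hm, fun y hy s => ?_⟩
  by_contra! hcon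
  have := h s
  rw [pow_two (z s), Complex.mul_re, hcon.1] at this
  nlinarith [mul_nonneg hc.le (sq_nonneg s)]

/-- Far up the imaginary axis the winding number is `1`: there `1 / (lam - i y) - 1 / (lam + i)` has
an antiderivative whose two logarithms are cut along the imaginary axis, off the contour. -/
lemma eventually_windingNumber_eq_one :
    ∀ᶠ y : ℝ in atTop, windingNumber z (y * Complex.I) = 1 ∧ (y * Complex.I : ℂ) ∉ range z := by
  obtain ⟨m, hm, h⟩ := hz.exists_forall_re_ne_zero_or_im_sq_lt
  filter_upwards [eventually_gt_atTop (m + 1)] with y hy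
  have hy0 : 0 < y := by linarith
  have hlow : ∀ s, (z s).re ≠ 0 ∨ (z s).im < y := fun s =>
    (h y (by nlinarith) s).imp_right fun h => lt_of_pow_lt_pow_left₀ 2 hy0.le h
  have hnr : (y * Complex.I : ℂ) ∉ range z := by
    rintro ⟨s, hs⟩
    have := hlow s
    rw [hs] at this
    simp at this
  refine ⟨?_, hnr⟩
  have hs1 : ∀ s, Complex.I * (z s - y * Complex.I) ∈ Complex.slitPlane := fun s => by
    rw [Complex.mem_slitPlane_iff]
    rcases hlow s with h | h
    · right; simpa using h
    · left; simpa using h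
  have hs2 : ∀ s, -Complex.I * (z s + Complex.I) ∈ Complex.slitPlane := fun s => by
    rw [Complex.mem_slitPlane_iff]
    left
    have := hz.upper s
    simp only [Complex.mul_re, Complex.neg_re, Complex.I_re, neg_zero, Complex.add_re, add_zero,
      zero_mul, Complex.neg_im, Complex.I_im, Complex.add_im]
    linarith
  have hderiv : ∀ s, HasDerivAt
      (fun lam => Complex.log (Complex.I * (lam - y * Complex.I))
        - Complex.log (-Complex.I * (lam + Complex.I)))
      (1 / (z s - y * Complex.I) - 1 / (z s + Complex.I)) (z s) := fun s => by
    have e1 := (((hasDerivAt_id (z s)).sub_const (y * Complex.I)).const_mul Complex.I).clog (hs1 s)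
    have e2 := (((hasDerivAt_id (z s)).add_const Complex.I).const_mul (-Complex.I)).clog (hs2 s)
    have hi1 : z s - y * Complex.I ≠ 0 := fun h => hnr ⟨s, sub_eq_zero.1 h⟩
    have hi2 := hz.add_I_ne_zero s
    convert! e1.sub e2 using 1
    simp only [id]
    field_simp
  -- Rescaling by a positive factor `r` cancels in the difference of the logarithms.
  have scale : ∀ (s r : ℝ), 0 < r →
      Complex.log (Complex.I * ((z s - y * Complex.I) / r))
        - Complex.log (-Complex.I * ((z s + Complex.I) / r)) =
      Complex.log (Complex.I * (z s - y * Complex.I))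
        - Complex.log (-Complex.I * (z s + Complex.I)) := fun s r hr => by
    have hr' : (r : ℂ) ≠ 0 := by exact_mod_cast hr.ne'
    have e1 : Complex.I * (z s - y * Complex.I)
        = r * (Complex.I * ((z s - y * Complex.I) / r)) := by field_simp
    have e2 : -Complex.I * (z s + Complex.I)
        = r * (-Complex.I * ((z s + Complex.I) / r)) := by field_simp
    rw [e1, e2, Complex.log_ofReal_mul hr, Complex.log_ofReal_mul hr]
    · ring
    · intro h
      rw [h, mul_zero] at e2
      exact Complex.slitPlane_ne_zero (hs2 s) e2
    · intro h
      rw [h, mul_zero] at e1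
      exact Complex.slitPlane_ne_zero (hs1 s) e1
  have lim : ∀ (w a : ℂ) (l : Filter ℝ) (σ : ℝ),
      Tendsto (fun s : ℝ => (((σ * s : ℝ)) : ℂ)⁻¹) l (𝓝 0) →
      Tendsto (fun s : ℝ => z s / ((σ * s : ℝ) : ℂ)) l (𝓝 w) →
      Tendsto (fun s : ℝ => (z s + a) / ((σ * s : ℝ) : ℂ)) l (𝓝 w) := fun w a l σ h1 h2 => by
    have := h2.add (h1.const_mul a)
    rw [mul_zero, add_zero] at this
    refine this.congr fun s => ?_
    rw [add_div, div_eq_mul_inv a]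
  have hinv : ∀ (l : Filter ℝ) (σ : ℝ), Tendsto (fun s => σ * s) l atTop →
      Tendsto (fun s : ℝ => (((σ * s : ℝ)) : ℂ)⁻¹) l (𝓝 0) := fun l σ h => by
    have := (Complex.continuous_ofReal.tendsto 0).comp (tendsto_inv_atTop_zero.comp h)
    simpa [Function.comp_def] using this
  have main : ∀ (l : Filter ℝ) (σ : ℝ) (w : ℂ), w.re ≠ 0 → Tendsto (fun s => σ * s) l atTop →
      Tendsto (fun s : ℝ => z s / ((σ * s : ℝ) : ℂ)) l (𝓝 w) →
      Tendsto (fun s => Complex.log (Complex.I * (z s - y * Complex.I))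
        - Complex.log (-Complex.I * (z s + Complex.I))) l
        (𝓝 (Complex.log (Complex.I * w) - Complex.log (-(Complex.I * w)))) := by
    intro l σ w hw hσ hlim
    have l1 := lim w (-(y * Complex.I)) l σ (hinv l σ hσ) hlim
    have l2 := lim w Complex.I l σ (hinv l σ hσ) hlim
    have hm1 : Complex.I * w ∈ Complex.slitPlane := by
      rw [Complex.mem_slitPlane_iff]; right; simpa using hw
    have hm2 : -Complex.I * w ∈ Complex.slitPlane := by
      rw [Complex.mem_slitPlane_iff]; right; simpa using hw
    have := ((l1.const_mul Complex.I).clog hm1).sub ((l2.const_mul (-Complex.I)).clog hm2)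
    rw [neg_mul] at this
    refine this.congr' ?_
    filter_upwards [hσ.eventually_gt_atTop 0] with s hs
    rw [← scale s (σ * s) hs, ← sub_eq_add_neg]
  obtain ⟨v, hv1, hv2, hv⟩ := hz.tendsto_div_atTop
  obtain ⟨u, hu1, hu2, hu3, hu⟩ := hz.tendsto_div_atBot
  have t1 := main atTop 1 v (by linarith) (by simp only [one_mul]; exact tendsto_id)
    (by simpa using hv)
  have t2 := main atBot (-1) (-u) (by simpa using hu1.ne')
    (by simpa using tendsto_neg_atBot_atTop) (by simpa [div_neg] using hu.neg)
  rw [windingNumber, hz.contourIntegral_eq_sub hderiv (hz.contourIntegrable_winding hnr) t1 t2]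
  have a1 : Complex.log (-(Complex.I * v)) = Complex.log (Complex.I * v) - Real.pi * Complex.I := by
    rw [Complex.log, Complex.log, norm_neg,
      Complex.arg_neg_eq_arg_sub_pi_of_im_pos (by simpa using hv1.trans hv2)]
    push_cast
    ring
  have a2 : Complex.log (-(Complex.I * -u))
      = Complex.log (Complex.I * -u) + Real.pi * Complex.I := by
    rw [Complex.log, Complex.log, norm_neg,
      Complex.arg_neg_eq_arg_add_pi_of_im_neg (by simpa using hu1)]
    push_cast
    ring
  rw [a1, a2]
  have : (Real.pi : ℂ) ≠ 0 := by exact_mod_cast Real.pi_ne_zero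
  field_simp
  ring

lemma windingNumber_of_mem_inside {p : ℂ} (hp : p ∈ inside z) : windingNumber z p = 1 := by
  obtain ⟨y, hy, hy'⟩ := (hp.and hz.eventually_windingNumber_eq_one).exists
  rw [hz.windingNumber_eq_of_joinedIn hy, hy'.1]

lemma im_pos_of_mem_inside {p : ℂ} (hp : p ∈ inside z) : 0 < p.im := by
  by_contra! h
  have := hz.windingNumber_of_mem_inside hp
  rw [hz.windingNumber_of_im_nonpos h] at this
  exact zero_ne_one this

end IsContour

/-! ### Closing the contour in the upper half-plane -/

lemma norm_add_mul_I_le_of_isCompact {f : ℂ → ℂ} (hf : ContinuousOn f {w | 0 < w.im}) {K R : ℝ}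
    (hK : ∀ w : ℂ, R ≤ w.im → ‖f w‖ ≤ K / w.im ^ 2) {T : Set ℂ} (hT : IsCompact T)
    (hTU : T ⊆ {w | 0 < w.im}) :
    ∃ K' : ℝ, ∀ w ∈ T, ∀ τ : ℝ, 0 ≤ τ → ‖f (w + τ * Complex.I)‖ ≤ K' * (1 + τ ^ 2)⁻¹ := by
  set R' := max R 1 with hR'
  have him : ∀ (w : ℂ) (τ : ℝ), (w + τ * Complex.I).im = w.im + τ := fun w τ => by simp
  have hcomp : IsCompact ((fun p : ℂ × ℝ => p.1 + p.2 * Complex.I) '' (T ×ˢ Icc 0 R')) :=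
    (hT.prod isCompact_Icc).image (by fun_prop)
  obtain ⟨M, hM⟩ := hcomp.exists_bound_of_continuousOn (hf.mono (by
    rintro _ ⟨⟨w, τ⟩, ⟨hw, hτ⟩, rfl⟩
    have h1 : 0 < w.im := hTU hw
    have h2 : 0 ≤ τ := hτ.1
    simp only [mem_ofPred_eq, him]
    linarith))
  refine ⟨max (M * (1 + R' ^ 2)) (2 * K), fun w hw τ hτ => ?_⟩
  have hw0 : 0 < w.im := hTU hw
  rw [← div_eq_mul_inv, le_div_iff₀ (by positivity)]
  rcases le_total τ R' with h | h
  · have h1 := hM _ ⟨(w, τ), ⟨hw, hτ, h⟩, rfl⟩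
    refine le_trans ?_ (le_max_left _ _)
    have : 0 ≤ M := (norm_nonneg _).trans h1
    gcongr
  · have hτ1 : 1 ≤ τ := (le_max_right _ _).trans h
    have h1 := hK (w + τ * Complex.I) (by
      rw [him]; linarith [(le_max_left _ _).trans h])
    refine le_trans ?_ (le_max_right _ _)
    rw [him, le_div_iff₀ (by positivity)] at h1
    have h2 : 1 + τ ^ 2 ≤ 2 * (w.im + τ) ^ 2 := by nlinarith
    nlinarith [norm_nonneg (f (w + τ * Complex.I))]

lemma norm_deriv_le_of_decay {f : ℂ → ℂ} (hf : DifferentiableOn ℂ f {w | 0 < w.im}) {K R : ℝ}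
    (hR : 0 < R) (hK : ∀ w : ℂ, R ≤ w.im → ‖f w‖ ≤ K / w.im ^ 2) :
    ∀ w : ℂ, R + 2 ≤ w.im → ‖deriv f w‖ ≤ 4 * K / w.im ^ 2 := by
  intro w hw
  have hK0 : 0 ≤ K := by
    have := (norm_nonneg _).trans (hK w (by linarith))
    by_contra! h
    exact this.not_gt (div_neg_of_neg_of_pos h (by nlinarith))
  have him : ∀ v ∈ Metric.closedBall w 1, w.im - 1 ≤ v.im := fun v hv => by
    have h1 : ‖v - w‖ ≤ 1 := by rwa [← dist_eq_norm]
    have h2 := (Complex.abs_im_le_norm (v - w)).trans h1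
    rw [Complex.sub_im, abs_le] at h2
    linarith
  have h1 := Complex.norm_deriv_le_of_forall_mem_sphere_norm_le (c := w) (R := 1)
    (C := K / (w.im - 1) ^ 2) (f := f) one_pos
    (hf.mono (by
      intro v hv
      have := him v (closure_minimal Metric.ball_subset_closedBall Metric.isClosed_closedBall hv)
      simp only [mem_ofPred_eq]
      linarith)).diffContOnCl
    (fun v hv => by
      have h2 := him v (Metric.sphere_subset_closedBall hv)
      have h4 : 0 < w.im - 1 := by linarith
      refine (hK v (by linarith)).trans ?_
      gcongr)
  rw [div_one] at h1
  refine h1.trans ?_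
  have h4 : 0 < w.im - 1 := by linarith
  rw [div_le_div_iff₀ (by positivity) (by nlinarith)]
  have : w.im ^ 2 ≤ 4 * (w.im - 1) ^ 2 := by nlinarith
  nlinarith

/-- The integral of a holomorphic function over the vertical ray above `w`, as an antiderivative. -/
noncomputable def rayIntegral (f : ℂ → ℂ) (w : ℂ) : ℂ :=
  -Complex.I * ∫ τ in Ioi (0 : ℝ), f (w + τ * Complex.I)

section
variable {f : ℂ → ℂ} (hf : DifferentiableOn ℂ f {w | 0 < w.im}) {K R : ℝ} (hR : 0 < R)
  (hK : ∀ w : ℂ, R ≤ w.im → ‖f w‖ ≤ K / w.im ^ 2)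
include hf hR hK

lemma hasDerivAt_rayIntegral {w : ℂ} (hw : 0 < w.im) : HasDerivAt (rayIntegral f) (f w) w := by
  have hopen : IsOpen {w : ℂ | 0 < w.im} := isOpen_lt continuous_const Complex.continuous_im
  have hdf : DifferentiableOn ℂ (deriv f) {w | 0 < w.im} := hf.deriv hopen
  have hsub : Metric.closedBall w (w.im / 2) ⊆ {w | 0 < w.im} := by
    intro v hv
    have h1 : ‖v - w‖ ≤ w.im / 2 := by rwa [← dist_eq_norm]
    have h2 := (Complex.abs_im_le_norm (v - w)).trans h1
    rw [Complex.sub_im, abs_le] at h2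
    simp only [mem_ofPred_eq]
    linarith
  obtain ⟨K₁, hK₁⟩ := norm_add_mul_I_le_of_isCompact hf.continuousOn hK
    (isCompact_closedBall w (w.im / 2)) hsub
  obtain ⟨K₂, hK₂⟩ := norm_add_mul_I_le_of_isCompact hdf.continuousOn
    (norm_deriv_le_of_decay hf hR hK) (isCompact_closedBall w (w.im / 2)) hsub
  have hup : ∀ v ∈ Metric.closedBall w (w.im / 2), ∀ τ : ℝ, 0 ≤ τ →
      v + τ * Complex.I ∈ {w : ℂ | 0 < w.im} := fun v hv τ hτ => by
    have h1 : 0 < v.im := hsub hv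
    simp only [mem_ofPred_eq, Complex.add_im, Complex.mul_im, Complex.ofReal_re, Complex.I_im,
      mul_one, Complex.ofReal_im, Complex.I_re, mul_zero, add_zero]
    linarith
  have hmeas : ∀ g : ℂ → ℂ, ContinuousOn g {w | 0 < w.im} → ∀ v ∈ Metric.closedBall w (w.im / 2),
      AEStronglyMeasurable (fun τ : ℝ => g (v + τ * Complex.I)) (volume.restrict (Ioi 0)) :=
    fun g hg v hv => ContinuousOn.aestronglyMeasurable
      (hg.comp (by fun_prop) fun τ hτ => hup v hv τ (le_of_lt hτ)) measurableSet_Ioi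
  have hwb : w ∈ Metric.closedBall w (w.im / 2) := Metric.mem_closedBall_self (by positivity)
  have hint : ∀ K, Integrable (fun τ : ℝ => K * (1 + τ ^ 2)⁻¹) (volume.restrict (Ioi 0)) :=
    fun K => (integrable_inv_one_add_sq.const_mul K).integrableOn
  have hint' : Integrable (fun τ : ℝ => deriv f (w + τ * Complex.I)) (volume.restrict (Ioi 0)) :=
    Integrable.mono' (hint K₂) (hmeas _ hdf.continuousOn w hwb) (by
      filter_upwards [ae_restrict_mem measurableSet_Ioi] with τ hτ
      exact hK₂ w hwb τ (le_of_lt hτ))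
  have key := (hasDerivAt_integral_of_dominated_loc_of_deriv_le
    (μ := volume.restrict (Ioi (0 : ℝ))) (𝕜 := ℂ)
    (F := fun v (τ : ℝ) => f (v + τ * Complex.I))
    (F' := fun v (τ : ℝ) => deriv f (v + τ * Complex.I)) (x₀ := w)
    (bound := fun τ => K₂ * (1 + τ ^ 2)⁻¹)
    (Metric.closedBall_mem_nhds w (half_pos hw)) ?_ ?_ hint'.1 ?_ (hint K₂) ?_).2
  · have hval : ∫ τ in Ioi (0 : ℝ), deriv f (w + τ * Complex.I) * Complex.I = 0 - f w := by
      have hder : ∀ τ : ℝ, 0 ≤ τ → HasDerivAt (fun τ : ℝ => f (w + τ * Complex.I))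
          (deriv f (w + τ * Complex.I) * Complex.I) τ := fun τ hτ => by
        have h1 : HasDerivAt f (deriv f (w + τ * Complex.I)) (w + τ * Complex.I) :=
          (hf.differentiableAt (hopen.mem_nhds (hup w hwb τ hτ))).hasDerivAt
        have h2 : HasDerivAt (fun τ : ℝ => w + (τ : ℂ) * Complex.I) Complex.I τ := by
          simpa using ((Complex.ofRealCLM.hasDerivAt (x := τ)).mul_const Complex.I).const_add w
        exact h1.comp_of_eq τ h2 rfl
      have := integral_Ioi_of_hasDerivAt_of_tendsto (a := 0) (m := 0)
        (f := fun τ : ℝ => f (w + τ * Complex.I)) (hder 0 le_rfl).continuousAt.continuousWithinAt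
        (fun τ hτ => hder τ (le_of_lt hτ)) (hint'.mul_const _) (by
          refine squeeze_zero_norm' (a := fun τ : ℝ => K₁ * (1 + τ ^ 2)⁻¹) ?_ ?_
          · filter_upwards [eventually_ge_atTop 0] with τ hτ using hK₁ w hwb τ hτ
          · rw [← mul_zero K₁]
            refine (tendsto_inv_atTop_zero.comp ?_).const_mul K₁
            exact tendsto_atTop_add_const_left _ _ (tendsto_pow_atTop two_ne_zero))
      simpa using this
    rw [integral_mul_const] at hval
    have := key.const_mul (-Complex.I)
    have e : -Complex.I * ∫ τ in Ioi (0 : ℝ), deriv f (w + τ * Complex.I) = f w := by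
      linear_combination -hval
    rwa [e] at this
  · filter_upwards [Metric.closedBall_mem_nhds w (half_pos hw)] with v hv
    exact hmeas f hf.continuousOn v hv
  · refine Integrable.mono' (hint K₁) (hmeas _ hf.continuousOn w hwb) ?_
    filter_upwards [ae_restrict_mem measurableSet_Ioi] with τ hτ
    exact hK₁ w hwb τ (le_of_lt hτ)
  · filter_upwards [ae_restrict_mem measurableSet_Ioi] with τ hτ v hv
    exact hK₂ v hv τ (le_of_lt hτ)
  · filter_upwards [ae_restrict_mem measurableSet_Ioi] with τ hτ v hv
    have h1 : HasDerivAt f (deriv f (v + τ * Complex.I)) (v + τ * Complex.I) :=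
      (hf.differentiableAt (hopen.mem_nhds (hup v hv τ (le_of_lt hτ)))).hasDerivAt
    exact h1.comp_add_const v (τ * Complex.I)

omit hf hR in
lemma norm_rayIntegral_le {w : ℂ} (hw : R ≤ w.im) (hw0 : 0 < w.im) :
    ‖rayIntegral f w‖ ≤ K / w.im := by
  have hder : ∀ τ : ℝ, 0 ≤ τ →
      HasDerivAt (fun τ : ℝ => -K / (w.im + τ)) (K / (w.im + τ) ^ 2) τ := fun τ hτ => by
    have h1 : HasDerivAt (fun τ : ℝ => w.im + τ) 1 τ := by
      simpa using (hasDerivAt_id τ).const_add w.im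
    have h2 := (h1.inv (by positivity)).const_mul (-K)
    convert! h2 using 1
    ring
  have hlim : Tendsto (fun τ : ℝ => -K / (w.im + τ)) atTop (𝓝 0) :=
    (tendsto_atTop_add_const_left _ _ tendsto_id).const_div_atTop _
  have hK0 : 0 ≤ K := by
    have := (norm_nonneg _).trans (hK w hw)
    by_contra! h
    exact this.not_gt (div_neg_of_neg_of_pos h (by positivity))
  have hval := integral_Ioi_of_hasDerivAt_of_nonneg (a := 0)
    (hder 0 le_rfl).continuousAt.continuousWithinAt
    (fun τ hτ => hder τ (le_of_lt hτ)) (fun τ _ => by positivity) hlim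
  have hint := integrableOn_Ioi_deriv_of_nonneg (a := 0)
    (hder 0 le_rfl).continuousAt.continuousWithinAt
    (fun τ hτ => hder τ (le_of_lt hτ)) (fun τ _ => by positivity) hlim
  rw [rayIntegral, norm_mul, norm_neg, Complex.norm_I, one_mul]
  calc _ ≤ ∫ τ in Ioi (0 : ℝ), K / (w.im + τ) ^ 2 := by
        refine norm_integral_le_of_norm_le hint ?_
        filter_upwards [ae_restrict_mem measurableSet_Ioi] with τ hτ
        have hτ0 : 0 < τ := hτ
        have := hK (w + τ * Complex.I) (by simp; linarith)
        simpa using this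
    _ = _ := by rw [hval]; simp [neg_div]

end

namespace IsContour

variable {z : ℝ → ℂ} (hz : IsContour z)
include hz

lemma contourIntegrable_of_decay {f : ℂ → ℂ} (hf : Continuous fun s => f (z s)) {K R : ℝ}
    (hK : ∀ s, R ≤ (z s).im → ‖f (z s)‖ ≤ K / (z s).im ^ 2) : ContourIntegrable z f := by
  obtain ⟨c, hc, h⟩ := hz.exists_im_ge
  obtain ⟨K', -, hK'⟩ := exists_forall_le_of_eventually
    (g := fun s => ‖f (z s)‖ * (1 + |s|) ^ 2) (K := |K| / c ^ 2) (hf.norm.mul (by fun_prop)) (by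
      filter_upwards [hz.tendsto_im.eventually_ge_atTop R] with s hs
      have h0 := hz.upper s
      have h1 : ‖f (z s)‖ ≤ |K| / (c * (1 + |s|)) ^ 2 := by
        refine (hK s hs).trans ?_
        gcongr
        · exact le_abs_self K
        · exact h s
      rw [mul_pow, ← div_div, le_div_iff₀ (by positivity)] at h1
      exact h1)
  refine hz.integrable_mul_deriv_of_le hf (K := K') fun s => ?_
  rw [le_div_iff₀ (by positivity)]
  exact hK' s

/-- Cauchy's theorem: the contour can be moved up to infinity. -/
lemma contourIntegral_eq_zero_of_decay {f : ℂ → ℂ}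
    (hf : DifferentiableOn ℂ f {w | 0 < w.im}) {K R : ℝ} (hR : 0 < R)
    (hK : ∀ w : ℂ, R ≤ w.im → ‖f w‖ ≤ K / w.im ^ 2) : contourIntegral z f = 0 := by
  refine hz.contourIntegral_eq_zero (Φ := rayIntegral f)
    (fun s => hasDerivAt_rayIntegral hf hR hK (hz.upper s))
    (hz.contourIntegrable_of_decay (hf.continuousOn.comp_continuous hz.continuous hz.upper)
      fun s hs => hK _ hs) ?_
  refine squeeze_zero_norm' ?_ (hz.tendsto_im.const_div_atTop K)
  filter_upwards [hz.tendsto_im.eventually_ge_atTop R] with s hs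
  exact norm_rayIntegral_le hK hs (hz.upper s)

/-- The residue theorem for a simple pole in the upper half-plane: subtracting
`Q p * (1 / (lam - p) - 1 / (lam + i))` removes the pole and keeps the decay. -/
lemma contourIntegral_div_sub {Q : ℂ → ℂ} (hQ : DifferentiableOn ℂ Q {w | 0 < w.im}) {K R : ℝ}
    (hK : ∀ w : ℂ, R ≤ w.im → ‖Q w‖ ≤ K / w.im) {p : ℂ} (hp : 0 < p.im) (hpz : p ∉ range z) :
    contourIntegral z (fun lam => Q lam / (lam - p))
      = 2 * Real.pi * Complex.I * windingNumber z p * Q p := by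
  have hopen : IsOpen {w : ℂ | 0 < w.im} := isOpen_lt continuous_const Complex.continuous_im
  set h : ℂ → ℂ := fun lam => Q lam - Q p * (p + Complex.I) / (lam + Complex.I) with hh
  have hne : ∀ w : ℂ, 0 < w.im → w + Complex.I ≠ 0 := fun w hw h0 => by
    have := congrArg Complex.im h0
    simp at this
    linarith
  have hp0 : h p = 0 := by
    simp only [hh]
    rw [mul_div_assoc, div_self (hne p hp), mul_one, sub_self]
  have hd : DifferentiableOn ℂ h {w | 0 < w.im} := by
    refine hQ.sub (DifferentiableOn.div (by fun_prop) (by fun_prop) hne)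
  have hds : DifferentiableOn ℂ (dslope h p) {w | 0 < w.im} :=
    (Complex.differentiableOn_dslope (hopen.mem_nhds hp)).2 hd
  have hds' : ∀ w, w ≠ p → dslope h p w = h w / (w - p) := fun w hw => by
    rw [dslope_of_ne _ hw, slope_def_field, hp0, sub_zero]
  set R' := max (max R 1) (2 * ‖p‖ + 1) with hR'
  have hR1 : 1 ≤ R' := (le_max_right _ _).trans (le_max_left _ _)
  have hdec : ∀ w : ℂ, R' ≤ w.im →
      ‖dslope h p w‖ ≤ (2 * (K + ‖Q p * (p + Complex.I)‖)) / w.im ^ 2 := fun w hw => by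
    have h1 : R ≤ w.im := ((le_max_left _ _).trans (le_max_left _ _)).trans hw
    have h2 : 2 * ‖p‖ + 1 ≤ w.im := (le_max_right _ _).trans hw
    have hw0 : 0 < w.im := by linarith
    have h3 : w.im ≤ ‖w‖ := (le_abs_self _).trans (Complex.abs_im_le_norm w)
    have h4 : w.im / 2 ≤ ‖w - p‖ := by
      have := norm_sub_norm_le w p
      linarith
    have h5 : w.im ≤ ‖w + Complex.I‖ := by
      have := (le_abs_self _).trans (Complex.abs_im_le_norm (w + Complex.I))
      simp at this
      linarith
    have hwp : w ≠ p := by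
      rintro rfl
      rw [sub_self, norm_zero] at h4
      linarith
    rw [hds' w hwp, norm_div]
    have h6 : ‖h w‖ ≤ (K + ‖Q p * (p + Complex.I)‖) / w.im := by
      rw [add_div]
      refine (norm_sub_le _ _).trans (add_le_add (hK w h1) ?_)
      rw [norm_div]
      gcongr
    calc _ ≤ ((K + ‖Q p * (p + Complex.I)‖) / w.im) / (w.im / 2) := by
          gcongr
          exact (norm_nonneg _).trans h6
      _ = _ := by field_simp
  have hzero := hz.contourIntegral_eq_zero_of_decay hds (by linarith) hdec
  have hint : ContourIntegrable z (dslope h p) :=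
    hz.contourIntegrable_of_decay (hds.continuousOn.comp_continuous hz.continuous hz.upper)
      fun s hs => hdec _ hs
  have hwn : contourIntegral z (fun lam => 1 / (lam - p) - 1 / (lam + Complex.I))
      = 2 * Real.pi * Complex.I * windingNumber z p := by
    rw [windingNumber, ← mul_assoc, mul_inv_cancel₀ Complex.two_pi_I_ne_zero, one_mul]
  calc contourIntegral z (fun lam => Q lam / (lam - p))
      = ∫ s, (dslope h p (z s) * deriv z s
        + Q p * ((1 / (z s - p) - 1 / (z s + Complex.I)) * deriv z s)) := by
        refine integral_congr_ae (ae_of_all _ fun s => ?_)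
        have hzp : z s ≠ p := fun h => hpz ⟨s, h⟩
        have h1 : z s - p ≠ 0 := sub_ne_zero.2 hzp
        have h2 := hz.add_I_ne_zero s
        beta_reduce
        rw [hds' _ hzp]
        simp only [hh]
        field_simp
        ring
    _ = contourIntegral z (dslope h p) + Q p * contourIntegral z
          (fun lam => 1 / (lam - p) - 1 / (lam + Complex.I)) := by
        rw [integral_add hint ((hz.contourIntegrable_winding hpz).const_mul _), integral_const_mul]
        rfl
    _ = _ := by rw [hzero, hwn]; ring

end IsContour

/-! ### The kernel `2 i lam / (lam ^ 2 + κ)` -/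

namespace IsContour

variable {z : ℝ → ℂ} (hz : IsContour z)
include hz

/-- The pole of the kernel in the closed upper half-plane. For `κ ≤ 0` it is real, and `√κ = 0`, so
that the winding number about `i √κ` is `0` in this case as well. -/
lemma exists_kernel_pole {κ : ℝ} (hκ : (√κ : ℂ) * Complex.I ∉ range z) :
    ∃ p : ℂ, p ^ 2 = -κ ∧ 0 ≤ p.im ∧ p ∉ range z ∧ -p ∉ range z ∧
      windingNumber z p = windingNumber z (√κ * Complex.I) ∧ windingNumber z (-p) = 0 := by
  rcases le_or_gt κ 0 with h | h
  · have h1 : ((√(-κ) : ℝ) : ℂ).im = 0 := Complex.ofReal_im _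
    refine ⟨(√(-κ) : ℝ), ?_, h1.ge, hz.notMem_range_of_im_nonpos h1.le,
      hz.notMem_range_of_im_nonpos (by simp), ?_, hz.windingNumber_of_im_nonpos (by simp)⟩
    · rw [← Complex.ofReal_pow, Real.sq_sqrt (by linarith)]
      simp
    · rw [Real.sqrt_eq_zero_of_nonpos h, hz.windingNumber_of_im_nonpos h1.le,
        hz.windingNumber_of_im_nonpos (by simp)]
  · refine ⟨√κ * Complex.I, ?_, by simp, hκ, hz.notMem_range_of_im_nonpos (by simp), rfl,
      hz.windingNumber_of_im_nonpos (by simp)⟩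
    rw [mul_pow, Complex.I_sq, ← Complex.ofReal_pow, Real.sq_sqrt h.le]
    ring

lemma kernel_ne_zero {κ : ℝ} (hκ : (√κ : ℂ) * Complex.I ∉ range z) (s : ℝ) : z s ^ 2 + κ ≠ 0 := by
  obtain ⟨p, hp, -, h1, h2, -⟩ := hz.exists_kernel_pole hκ
  have e : z s ^ 2 + κ = (z s - p) * (z s - -p) := by linear_combination hp
  rw [e]
  exact mul_ne_zero (sub_ne_zero.2 fun h => h1 ⟨s, h⟩) (sub_ne_zero.2 fun h => h2 ⟨s, h⟩)

lemma continuous_kernel {κ : ℝ} (hκ : (√κ : ℂ) * Complex.I ∉ range z) :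
    Continuous fun s => 2 * Complex.I * z s / (z s ^ 2 + κ) := by
  have := hz.continuous
  exact Continuous.div (by fun_prop) (by fun_prop) (hz.kernel_ne_zero hκ)

lemma exists_norm_sq_add_ge {κ : ℝ} (hκ : (√κ : ℂ) * Complex.I ∉ range z) :
    ∃ c : ℝ, 0 < c ∧ ∀ s, c * (1 + |s|) ^ 2 ≤ ‖z s ^ 2 + κ‖ := by
  obtain ⟨p, hp, -, h1, h2, -⟩ := hz.exists_kernel_pole hκ
  obtain ⟨c, hc, h⟩ := hz.exists_norm_sub_ge h1
  obtain ⟨d, hd, h'⟩ := hz.exists_norm_sub_ge h2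
  refine ⟨c * d, by positivity, fun s => ?_⟩
  have e : z s ^ 2 + κ = (z s - p) * (z s - -p) := by linear_combination hp
  rw [e, norm_mul]
  calc _ = (c * (1 + |s|)) * (d * (1 + |s|)) := by ring
    _ ≤ _ := by gcongr <;> [exact h s; exact h' s]

lemma exists_norm_kernel_le {κ : ℝ} (hκ : (√κ : ℂ) * Complex.I ∉ range z) :
    ∃ K : ℝ, 0 < K ∧ ∀ s, ‖2 * Complex.I * z s / (z s ^ 2 + κ)‖ ≤ K / (1 + |s|) := by
  obtain ⟨c, hc, h⟩ := hz.exists_norm_sq_add_ge hκ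
  obtain ⟨K, hK, h'⟩ := hz.exists_norm_le
  refine ⟨2 * K / c, by positivity, fun s => ?_⟩
  rw [norm_div, norm_mul, norm_mul, Complex.norm_I, Complex.norm_ofNat, mul_one]
  calc _ ≤ 2 * (K * (1 + |s|)) / (c * (1 + |s|) ^ 2) := by
        gcongr <;> [exact h' s; exact h s]
    _ = _ := by field_simp

omit hz in
lemma norm_kernel_le (κ : ℝ) {w : ℂ} (hw : √|κ| + 1 ≤ w.im) :
    ‖2 * Complex.I * w / (w ^ 2 + κ)‖ ≤ 2 * (1 + √|κ|) / w.im := by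
  have hr := Real.sqrt_nonneg |κ|
  have hw0 : 0 < w.im := by linarith
  have h1 : w.im ≤ ‖w‖ := (le_abs_self _).trans (Complex.abs_im_le_norm w)
  have h2 : ‖w‖ ^ 2 - √|κ| ^ 2 ≤ ‖w ^ 2 + κ‖ := by
    have := norm_sub_norm_le (w ^ 2) (-(κ : ℂ))
    rw [norm_neg, norm_pow, sub_neg_eq_add, Complex.norm_real, Real.norm_eq_abs] at this
    rwa [Real.sq_sqrt (abs_nonneg κ)]
  have h3 : 0 < ‖w‖ ^ 2 - √|κ| ^ 2 := by nlinarith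
  rw [norm_div, norm_mul, norm_mul, Complex.norm_I, Complex.norm_ofNat, mul_one,
    div_le_div_iff₀ (h3.trans_le h2) hw0]
  have h4 : ‖w‖ * w.im ≤ (1 + √|κ|) * (‖w‖ ^ 2 - √|κ| ^ 2) := by
    have : ‖w‖ ^ 2 ≤ (1 + √|κ|) * (‖w‖ ^ 2 - √|κ| ^ 2) := by
      nlinarith [mul_nonneg hr (show 0 ≤ ‖w‖ - (√|κ| + 1) by linarith),
        mul_nonneg hr (show 0 ≤ ‖w‖ + (√|κ| + 1) by linarith),
        mul_nonneg (mul_nonneg hr (show 0 ≤ ‖w‖ - (√|κ| + 1) by linarith))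
          (show 0 ≤ ‖w‖ + (√|κ| + 1) by linarith), mul_nonneg hr hr]
    nlinarith
  nlinarith [mul_le_mul_of_nonneg_left h2 (show 0 ≤ 1 + √|κ| by linarith)]

/-- The residue theorem for the kernel, when the contour is closed in the upper half-plane. -/
lemma contourIntegral_kernel_mul {κ : ℝ} (hκ : (√κ : ℂ) * Complex.I ∉ range z) {Q : ℂ → ℂ}
    (hQ : DifferentiableOn ℂ Q {w | 0 < w.im}) {K R : ℝ}
    (hK : ∀ w : ℂ, R ≤ w.im → ‖Q w‖ ≤ K / w.im) :
    contourIntegral z (fun lam => 2 * Complex.I * lam / (lam ^ 2 + κ) * Q lam)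
      = -(2 * Real.pi) * windingNumber z (√κ * Complex.I) * Q (√κ * Complex.I) := by
  rcases le_or_gt κ 0 with h | h
  · rw [Real.sqrt_eq_zero_of_nonpos h, hz.windingNumber_of_im_nonpos (by simp), mul_zero, zero_mul]
    have hne : ∀ w : ℂ, 0 < w.im → w ^ 2 + κ ≠ 0 := fun w hw h0 => by
      have hre := congrArg Complex.re h0
      have him := congrArg Complex.im h0
      simp [pow_two] at hre him
      have : w.re = 0 := by
        rcases (mul_eq_zero.1 (show w.im * w.re = 0 by linarith)) with h | h
        · exact absurd h hw.ne'
        · exact h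
      rw [this] at hre
      nlinarith
    refine hz.contourIntegral_eq_zero_of_decay (R := max R (√|κ| + 1))
      (K := 2 * (1 + √|κ|) * K) (DifferentiableOn.mul
      (DifferentiableOn.div (by fun_prop) (by fun_prop) hne) hQ) (by positivity) fun w hw => ?_
    have h1 := norm_kernel_le κ ((le_max_right _ _).trans hw)
    have h2 := hK w ((le_max_left _ _).trans hw)
    rw [norm_mul]
    calc _ ≤ (2 * (1 + √|κ|) / w.im) * (K / w.im) := by
          refine mul_le_mul h1 h2 (norm_nonneg _) ((norm_nonneg _).trans h1)
      _ = _ := by ring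
  · set p : ℂ := √κ * Complex.I with hp
    have hsq : p ^ 2 = -κ := by
      rw [hp, mul_pow, Complex.I_sq, ← Complex.ofReal_pow, Real.sq_sqrt h.le]
      ring
    have hpim : 0 < p.im := by simpa [hp] using h
    have hpre : p.re = 0 := by simp [hp]
    have hne : ∀ w : ℂ, 0 < w.im → w + p ≠ 0 := fun w hw h0 => by
      have := congrArg Complex.im h0
      simp only [Complex.add_im, Complex.zero_im] at this
      linarith
    have hle : ∀ w : ℂ, 0 < w.im → ‖w‖ ≤ ‖w + p‖ := fun w hw => by
      rw [Complex.norm_def, Complex.norm_def]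
      apply Real.sqrt_le_sqrt
      rw [Complex.normSq_apply, Complex.normSq_apply, Complex.add_re, Complex.add_im, hpre]
      nlinarith
    have key := hz.contourIntegral_div_sub (Q := fun w => 2 * Complex.I * w / (w + p) * Q w)
      (K := 2 * K) (R := max R 1)
      (DifferentiableOn.mul (DifferentiableOn.div (by fun_prop) (by fun_prop) hne) hQ)
      (fun w hw => by
        have hw0 : 0 < w.im := by linarith [(le_max_right R 1).trans hw]
        have h1 := hK w ((le_max_left _ _).trans hw)
        have h2 : ‖2 * Complex.I * w / (w + p)‖ ≤ 2 := by
          rw [norm_div, norm_mul, norm_mul, Complex.norm_I, Complex.norm_ofNat, mul_one]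
          exact div_le_of_le_mul₀ (norm_nonneg _) (by norm_num)
            (mul_le_mul_of_nonneg_left (hle w hw0) (by norm_num))
        rw [norm_mul, mul_div_assoc 2 K]
        exact mul_le_mul h2 h1 (norm_nonneg _) (by norm_num)) hpim hκ
    have hp0 : p ≠ 0 := fun h0 => by rw [h0] at hpim; simp at hpim
    have e1 : 2 * Complex.I * p / (p + p) = Complex.I := by field_simp; ring
    rw [e1] at key
    calc _ = contourIntegral z
          (fun lam => 2 * Complex.I * lam / (lam + p) * Q lam / (lam - p)) := by
          refine integral_congr_ae (ae_of_all _ fun s => ?_)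
          beta_reduce
          have h1 : z s + p ≠ 0 := hne _ (hz.upper s)
          have h2 : z s - p ≠ 0 := sub_ne_zero.2 fun h => hκ ⟨s, h⟩
          have e : z s ^ 2 + κ = (z s + p) * (z s - p) := by linear_combination hsq
          rw [e]
          field_simp
      _ = _ := by
          rw [key]
          linear_combination (2 * Real.pi * windingNumber z p * Q p) * Complex.I_sq

lemma contourIntegral_kernel_sub_kernel {κ κ' : ℝ} (hκ : (√κ : ℂ) * Complex.I ∉ range z)
    (hκ' : (√κ' : ℂ) * Complex.I ∉ range z) :
    contourIntegral z (fun lam => 2 * Complex.I * lam / (lam ^ 2 + κ)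
        - 2 * Complex.I * lam / (lam ^ 2 + κ'))
      = -(2 * Real.pi) *
        (windingNumber z (√κ * Complex.I) - windingNumber z (√κ' * Complex.I)) := by
  obtain ⟨p, hp, -, h1, h2, e1, e2⟩ := hz.exists_kernel_pole hκ
  obtain ⟨q, hq, -, h3, h4, e3, e4⟩ := hz.exists_kernel_pole hκ'
  have hwn : ∀ p, contourIntegral z (fun lam => 1 / (lam - p) - 1 / (lam + Complex.I))
      = 2 * Real.pi * Complex.I * windingNumber z p := fun p => by
    rw [windingNumber, ← mul_assoc, mul_inv_cancel₀ Complex.two_pi_I_ne_zero, one_mul]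
  have hint := fun p hp => hz.contourIntegrable_winding (p := p) hp
  calc _ = ∫ s, Complex.I * (((1 / (z s - p) - 1 / (z s + Complex.I)) * deriv z s
        + (1 / (z s - -p) - 1 / (z s + Complex.I)) * deriv z s)
        - ((1 / (z s - q) - 1 / (z s + Complex.I)) * deriv z s
        + (1 / (z s - -q) - 1 / (z s + Complex.I)) * deriv z s)) := by
        refine integral_congr_ae (ae_of_all _ fun s => ?_)
        beta_reduce
        have k1 : z s - p ≠ 0 := sub_ne_zero.2 fun h => h1 ⟨s, h⟩
        have k2 : z s - -p ≠ 0 := sub_ne_zero.2 fun h => h2 ⟨s, h⟩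
        have k3 : z s - q ≠ 0 := sub_ne_zero.2 fun h => h3 ⟨s, h⟩
        have k4 : z s - -q ≠ 0 := sub_ne_zero.2 fun h => h4 ⟨s, h⟩
        have f1 : z s ^ 2 + κ = (z s - p) * (z s - -p) := by linear_combination hp
        have f2 : z s ^ 2 + κ' = (z s - q) * (z s - -q) := by linear_combination hq
        have g1 : 2 * Complex.I * z s / (z s ^ 2 + κ)
            = Complex.I * (1 / (z s - p) + 1 / (z s - -p)) := by
          rw [f1]; field_simp; ring
        have g2 : 2 * Complex.I * z s / (z s ^ 2 + κ')
            = Complex.I * (1 / (z s - q) + 1 / (z s - -q)) := by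
          rw [f2]; field_simp; ring
        rw [g1, g2]
        ring
    _ = Complex.I * ((2 * Real.pi * Complex.I * windingNumber z p
          + 2 * Real.pi * Complex.I * windingNumber z (-p))
          - (2 * Real.pi * Complex.I * windingNumber z q
          + 2 * Real.pi * Complex.I * windingNumber z (-q))) := by
        rw [← hwn, ← hwn, ← hwn, ← hwn, integral_const_mul]
        congr 1
        refine (integral_sub ((hint p h1).add (hint _ h2)) ((hint q h3).add (hint _ h4))).trans ?_
        exact congrArg₂ _ (integral_add (hint p h1) (hint _ h2))
          (integral_add (hint q h3) (hint _ h4))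
    _ = _ := by
        rw [e1, e2, e3, e4]
        linear_combination (2 * Real.pi * (windingNumber z (√κ * Complex.I)
          - windingNumber z (√κ' * Complex.I))) * Complex.I_sq

end IsContour

/-! ### The characteristic function `Δ` -/

lemma Delta_neg_I_mul (C : ℝ) (μ : ℂ) (y : ℝ) :
    Delta C (-Complex.I * μ) y
      = -Complex.I * (μ * Complex.cosh (μ * y) - C * Complex.sinh (μ * y)) := by
  have e : -Complex.I * μ * y = -(μ * y) * Complex.I := by ring
  rw [Delta, e, Complex.cos_mul_I, Complex.sin_mul_I, Complex.cosh_neg, Complex.sinh_neg]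
  ring

/-- The zeros of `Δ(·, -L)` are real, since a nonreal one would be an eigenvalue of a self-adjoint
Sturm-Liouville problem which is nonnegative for `C L ≥ -1`. Concretely, with `lam L = u + i v`, a
zero satisfies `v sin (2 u) = u sinh (2 v)`, which forces `u = 0`; then
`v cosh v = -C L sinh v ≤ sinh v`, which is impossible for `v > 0`. -/
lemma Delta_ne_zero {C L : ℝ} (hL : 0 < L) (hCL : -1 ≤ C * L) {lam : ℂ} (h : 0 < lam.im) :
    Delta C lam (-L) ≠ 0 := by
  intro h0
  set u := lam.re * L with hu
  set v := lam.im * L with hv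
  have hv0 : 0 < v := mul_pos h hL
  have hlam : lam * L = u + v * Complex.I := by
    apply Complex.ext <;> simp [hu, hv]
  have h1 : (u + v * Complex.I) * Complex.cos (u + v * Complex.I)
      + (C * L : ℝ) * Complex.sin (u + v * Complex.I) = 0 := by
    rw [← hlam]
    have : Delta C lam (-L) = lam * Complex.cos (lam * L) + C * Complex.sin (lam * L) := by
      rw [Delta]; push_cast; rw [mul_neg, Complex.cos_neg, Complex.sin_neg]; ring
    rw [this] at h0
    push_cast
    linear_combination (L : ℂ) * h0
  rw [Complex.cos_add_mul_I, Complex.sin_add_mul_I, ← Complex.ofReal_cos, ← Complex.ofReal_sin,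
    ← Complex.ofReal_cosh, ← Complex.ofReal_sinh] at h1
  have hre := congrArg Complex.re h1
  have him := congrArg Complex.im h1
  simp only [Complex.add_re, Complex.add_im, Complex.mul_re, Complex.mul_im, Complex.ofReal_re,
    Complex.ofReal_im, Complex.I_re, Complex.I_im, Complex.sub_re, Complex.sub_im, Complex.zero_re,
    Complex.zero_im] at hre him
  ring_nf at hre him
  have hsinh : v < Real.sinh v := Real.self_lt_sinh_iff.2 hv0
  have hcosh : 0 < Real.cosh v := Real.cosh_pos v
  have hcs := Real.cos_sq_add_sin_sq u
  have hcsh := Real.cosh_sq v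
  have key : v * (Real.sin u * Real.cos u) = u * (Real.sinh v * Real.cosh v) := by
    linear_combination (-(Real.cos u * Real.sinh v)) * hre + (Real.sin u * Real.cosh v) * him
      - (v * Real.sin u * Real.cos u) * hcsh + (u * Real.sinh v * Real.cosh v) * hcs
  have hvsc : v < Real.sinh v * Real.cosh v := by
    nlinarith [Real.one_le_cosh v]
  rcases eq_or_ne u 0 with hu0 | hu0
  · rw [hu0, Real.cos_zero, Real.sin_zero] at him
    have hlt : Real.sinh v < v * Real.cosh v := by
      have hmono : StrictMonoOn (fun v => v * Real.cosh v - Real.sinh v) (Ici 0) := by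
        refine strictMonoOn_of_deriv_pos (convex_Ici 0) (by fun_prop) fun y hy => ?_
        rw [interior_Ici] at hy
        have hd : HasDerivAt (fun v => v * Real.cosh v - Real.sinh v)
            (1 * Real.cosh y + y * Real.sinh y - Real.cosh y) y :=
          ((hasDerivAt_id y).mul (Real.hasDerivAt_cosh y)).sub (Real.hasDerivAt_sinh y)
        rw [hd.deriv]
        have := mul_pos hy (Real.sinh_pos_iff.2 hy)
        linarith
      have := hmono self_mem_Ici (mem_Ici.2 hv0.le) hv0
      simp only [Real.sinh_zero, zero_mul, sub_zero] at this
      linarith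
    nlinarith
  · have h2 : |Real.sin u * Real.cos u| ≤ |u| := by
      rw [abs_mul]
      calc _ ≤ |u| * 1 := mul_le_mul Real.abs_sin_le_abs (Real.abs_cos_le_one u)
            (abs_nonneg _) (abs_nonneg _)
        _ = _ := mul_one _
    have h3 : v * |Real.sin u * Real.cos u| = |u| * (Real.sinh v * Real.cosh v) := by
      have := congrArg abs key
      rwa [abs_mul, abs_mul u, abs_of_pos hv0, abs_of_pos (hv0.trans hvsc)] at this
    have h4 : 0 < |u| := abs_pos.2 hu0
    nlinarith

lemma Delta_eq_exp (C : ℝ) (lam : ℂ) (y : ℝ) :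
    Delta C lam y = ((lam + Complex.I * C) * Complex.exp (Complex.I * lam * y)
      + (lam - Complex.I * C) * Complex.exp (-(Complex.I * lam * y))) / 2 := by
  have e1 : Complex.I * lam * y = lam * y * Complex.I := by ring
  have e2 : -(Complex.I * lam * y) = -(lam * y) * Complex.I := by ring
  rw [Delta, Complex.cos, Complex.sin, e2, e1]
  ring

lemma norm_exp_I_mul (lam : ℂ) (y : ℝ) :
    ‖Complex.exp (Complex.I * lam * y)‖ = Real.exp (-(lam.im * y)) := by
  rw [Complex.norm_exp]
  simp

lemma norm_exp_neg_I_mul (lam : ℂ) (y : ℝ) :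
    ‖Complex.exp (-(Complex.I * lam * y))‖ = Real.exp (lam.im * y) := by
  rw [Complex.norm_exp]
  simp

lemma norm_Delta_le (C : ℝ) {lam : ℂ} (h : 0 ≤ lam.im) {y r : ℝ} (hy : |y| ≤ r) :
    ‖Delta C lam y‖ ≤ (‖lam‖ + |C|) * Real.exp (lam.im * r) := by
  have hC : ‖Complex.I * C‖ = |C| := by simp
  have h1 : ‖Complex.exp (Complex.I * lam * y)‖ ≤ Real.exp (lam.im * r) := by
    rw [norm_exp_I_mul]
    gcongr
    nlinarith [neg_abs_le y]
  have h2 : ‖Complex.exp (-(Complex.I * lam * y))‖ ≤ Real.exp (lam.im * r) := by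
    rw [norm_exp_neg_I_mul]
    gcongr
    exact (le_abs_self y).trans hy
  have h3 : ‖lam + Complex.I * C‖ ≤ ‖lam‖ + |C| := by
    rw [← hC]; exact norm_add_le _ _
  have h4 : ‖lam - Complex.I * C‖ ≤ ‖lam‖ + |C| := by
    rw [← hC]; exact norm_sub_le _ _
  rw [Delta_eq_exp, norm_div, Complex.norm_ofNat, div_le_iff₀ two_pos]
  refine (norm_add_le _ _).trans ?_
  rw [norm_mul, norm_mul]
  have h5 := mul_le_mul h3 h1 (norm_nonneg _) (by positivity)
  have h6 := mul_le_mul h4 h2 (norm_nonneg _) (by positivity)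
  linarith

lemma norm_sin_le {lam : ℂ} (h : 0 ≤ lam.im) {y r : ℝ} (hy : |y| ≤ r) :
    ‖Complex.sin (lam * y)‖ ≤ Real.exp (lam.im * r) := by
  have e1 : Complex.I * lam * y = lam * y * Complex.I := by ring
  have e2 : -(Complex.I * lam * y) = -(lam * y) * Complex.I := by ring
  have h1 : ‖Complex.exp (Complex.I * lam * y)‖ ≤ Real.exp (lam.im * r) := by
    rw [norm_exp_I_mul]
    gcongr
    nlinarith [neg_abs_le y]
  have h2 : ‖Complex.exp (-(Complex.I * lam * y))‖ ≤ Real.exp (lam.im * r) := by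
    rw [norm_exp_neg_I_mul]
    gcongr
    exact (le_abs_self y).trans hy
  rw [Complex.sin, ← e1, ← e2, norm_div, norm_mul, Complex.norm_I, Complex.norm_ofNat, mul_one,
    div_le_iff₀ two_pos]
  refine (norm_sub_le _ _).trans ?_
  linarith

/-- Lower bound for `Δ(lam, -L)`: far up, the growing exponential dominates. -/
lemma exists_norm_Delta_ge (C : ℝ) {L : ℝ} (hL : 0 < L) :
    ∃ R : ℝ, 0 < R ∧ ∀ lam : ℂ, R ≤ lam.im →
      ‖lam‖ / 8 * Real.exp (lam.im * L) ≤ ‖Delta C lam (-L)‖ := by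
  refine ⟨2 * |C| + 4 / L, by positivity, fun lam h => ?_⟩
  have hCn : ‖Complex.I * C‖ = |C| := by simp
  have hC : 2 * |C| ≤ lam.im := by linarith [show 0 < 4 / L by positivity]
  have h4 : 4 ≤ lam.im * L := by
    rw [← div_le_iff₀ hL]
    linarith [abs_nonneg C]
  have hn : lam.im ≤ ‖lam‖ := (le_abs_self _).trans (Complex.abs_im_le_norm lam)
  have h1 : ‖lam‖ / 2 ≤ ‖lam + Complex.I * C‖ := by
    have := norm_sub_le_norm_add lam (Complex.I * C)
    rw [hCn] at this
    linarith
  have h2 : ‖lam - Complex.I * C‖ ≤ 3 / 2 * ‖lam‖ := by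
    have := norm_sub_le lam (Complex.I * C)
    rw [hCn] at this
    linarith
  have hE : 5 ≤ Real.exp (lam.im * L) := by linarith [Real.add_one_le_exp (lam.im * L)]
  have hE' : Real.exp (-(lam.im * L)) ≤ 1 / 5 := by
    rw [Real.exp_neg, one_div]
    exact inv_anti₀ (by norm_num) hE
  rw [Delta_eq_exp, norm_div, Complex.norm_ofNat, le_div_iff₀ two_pos]
  have h5 : ‖(lam + Complex.I * C) * Complex.exp (Complex.I * lam * (-L : ℝ))‖
      = ‖lam + Complex.I * C‖ * Real.exp (lam.im * L) := by
    rw [norm_mul, norm_exp_I_mul]; congr 2; ring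
  have h6 : ‖(lam - Complex.I * C) * Complex.exp (-(Complex.I * lam * (-L : ℝ)))‖
      = ‖lam - Complex.I * C‖ * Real.exp (-(lam.im * L)) := by
    rw [norm_mul, norm_exp_neg_I_mul]; congr 2; ring
  have h7 := norm_sub_le_norm_add ((lam + Complex.I * C) * Complex.exp (Complex.I * lam * (-L : ℝ)))
    ((lam - Complex.I * C) * Complex.exp (-(Complex.I * lam * (-L : ℝ))))
  rw [h5, h6] at h7
  have h8 : ‖lam‖ / 2 * Real.exp (lam.im * L) ≤ ‖lam + Complex.I * C‖ * Real.exp (lam.im * L) := by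
    gcongr
  have h9 : ‖lam - Complex.I * C‖ * Real.exp (-(lam.im * L)) ≤ 3 / 2 * ‖lam‖ * (1 / 5) := by
    gcongr
  have h10 := mul_le_mul_of_nonneg_left hE (norm_nonneg lam)
  have h11 := norm_nonneg lam
  linarith

/-! ### The stationary modes and the transform of the solution -/

/-- The solution of `φ'' = -lam ^ 2 φ` with `φ(0) = 1` and `φ'(L) + C φ(L) = 0`. -/
noncomputable def dirichletMode (C L x : ℝ) (lam : ℂ) : ℂ := Delta C lam (x - L) / Delta C lam (-L)

/-- The solution of `φ'' = -lam ^ 2 φ` with `φ(0) = 0` and `φ'(L) + C φ(L) = 1`. -/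
noncomputable def robinMode (C L x : ℝ) (lam : ℂ) : ℂ :=
  Complex.sin (lam * x) / Delta C lam (-L)

/-- The solution of `φ'' = -lam ^ 2 φ` with the boundary data of `exp (-A x)`, namely `φ(0) = 1` and
`φ'(L) + C φ(L) = (C - A) exp (-A L)`. -/
noncomputable def dataMode (A C L x : ℝ) (lam : ℂ) : ℂ :=
  dirichletMode C L x lam + (C - A) * Complex.exp (-A * L) * robinMode C L x lam

/-- The part of the integrand of the solution that multiplies `exp (-D lam ^ 2 t)`; `κ = B / D`. -/
noncomputable def solutionTransform (κ A C L x : ℝ) (lam : ℂ) : ℂ :=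
  2 * Complex.I * lam / (lam ^ 2 + κ) * dirichletMode C L x lam
    - 2 * Complex.I * lam / (lam ^ 2 + (A ^ 2 : ℝ)) * dataMode A C L x lam

lemma V₁_eq {D L A B C : ℝ} (hD : 0 < D) (x t : ℝ) {lam : ℂ} (hΔ : Delta C lam (-L) ≠ 0)
    (hA : lam ^ 2 + (A ^ 2 : ℝ) ≠ 0) :
    V₁ D L A B C x t lam
      = Complex.exp (-D * lam ^ 2 * t) * solutionTransform (B / D) A C L x lam := by
  have hD' : (D : ℂ) ≠ 0 := by exact_mod_cast hD.ne'
  have hk : (1 : ℂ) / (D * lam ^ 2 + B) = 1 / D * (1 / (lam ^ 2 + (B / D : ℝ))) := by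
    rw [one_div_mul_one_div]
    congr 1
    push_cast
    field_simp
  rw [V₁, hk, solutionTransform, dataMode, dirichletMode, robinMode]
  set k : ℂ := 1 / (lam ^ 2 + (B / D : ℝ)) with hkdef
  have hk2 : 2 * Complex.I * lam / (lam ^ 2 + (B / D : ℝ)) = 2 * Complex.I * lam * k := by
    rw [hkdef]; ring
  rw [hk2]
  obtain ⟨μ, rfl⟩ : ∃ μ, lam = -Complex.I * μ :=
    ⟨Complex.I * lam, by linear_combination lam * Complex.I_sq⟩
  have e0 : Complex.I * (-Complex.I * μ) = μ := by linear_combination (-μ) * Complex.I_sq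
  have e0' : -Complex.I * (-Complex.I * μ) = -μ := by linear_combination μ * Complex.I_sq
  have esq : (-Complex.I * μ) ^ 2 = -μ ^ 2 := by linear_combination (μ ^ 2) * Complex.I_sq
  have esin : Complex.sin (-Complex.I * μ * x) = -Complex.I * Complex.sinh (μ * x) := by
    have e : -Complex.I * μ * x = -(μ * x) * Complex.I := by ring
    rw [e, Complex.sin_mul_I, Complex.sinh_neg]; ring
  simp only [Delta_neg_I_mul] at hΔ ⊢
  rw [esin]
  simp only [mul_assoc 2 Complex.I (-Complex.I * μ), e0, e0', esq] at hA ⊢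
  have hA' : (A ^ 2 : ℂ) - μ ^ 2 ≠ 0 := by
    intro h; apply hA; push_cast; linear_combination h
  have hp : (A : ℂ) + μ ≠ 0 := by
    intro h; apply hA'; linear_combination (A - μ) * h
  have hm : (A : ℂ) - μ ≠ 0 := by
    intro h; apply hA'; linear_combination (A + μ) * h
  have eA1 : (A : ℂ) ^ 2 + -μ ^ 2 = (A + μ) * (A - μ) := by ring
  have eA2 : -μ ^ 2 + ((A ^ 2 : ℝ) : ℂ) = (A + μ) * (A - μ) := by push_cast; ring
  rw [eA1, eA2]
  have hδ : μ * Complex.cosh (μ * (-L : ℝ)) - C * Complex.sinh (μ * (-L : ℝ)) ≠ 0 :=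
    right_ne_zero_of_mul hΔ
  have x1 : Complex.exp (μ * (L - x)) = Complex.exp (μ * L) * (Complex.exp (μ * x))⁻¹ := by
    rw [← Complex.exp_neg, ← Complex.exp_add]; congr 1; ring
  have x2 : Complex.exp (-μ * L) = (Complex.exp (μ * L))⁻¹ := by
    rw [← Complex.exp_neg]; congr 1; ring
  have y1 : Complex.exp (μ * (x - L : ℝ)) = Complex.exp (μ * x) * (Complex.exp (μ * L))⁻¹ := by
    rw [← Complex.exp_neg, ← Complex.exp_add]; congr 1; push_cast; ring
  have y2 : Complex.exp (-(μ * (x - L : ℝ))) = Complex.exp (μ * L) * (Complex.exp (μ * x))⁻¹ := by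
    rw [← Complex.exp_neg, ← Complex.exp_add]; congr 1; push_cast; ring
  have y3 : Complex.exp (μ * (-L : ℝ)) = (Complex.exp (μ * L))⁻¹ := by
    rw [← Complex.exp_neg]; congr 1; push_cast; ring
  have y4 : Complex.exp (-(μ * (-L : ℝ))) = Complex.exp (μ * L) := by
    congr 1; push_cast; ring
  have y5 : Complex.exp (-(μ * x)) = (Complex.exp (μ * x))⁻¹ := Complex.exp_neg _
  rw [x1, x2]
  simp only [Complex.cosh, Complex.sinh, y1, y2, y3, y4, y5] at hδ ⊢
  have hX := Complex.exp_ne_zero (μ * x)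
  have hY := Complex.exp_ne_zero (μ * L)
  set X := Complex.exp (μ * x)
  set Y := Complex.exp (μ * L)
  set a := Complex.exp (-A * L)
  set T := Complex.exp (-D * -μ ^ 2 * t)
  have hδ' : μ * (1 + Y ^ 2) - C * (1 - Y ^ 2) ≠ 0 := by
    intro h
    apply hδ
    field_simp
    linear_combination h
  have hI := Complex.I_ne_zero
  have eδ : -Complex.I * (μ * ((Y⁻¹ + Y) / 2) - C * ((Y⁻¹ - Y) / 2))
      = -Complex.I * ((μ * (1 + Y ^ 2) - C * (1 - Y ^ 2)) / (2 * Y)) := by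
    field_simp
  rw [eδ]
  set δ := μ * (1 + Y ^ 2) - C * (1 - Y ^ 2) with hδdef
  field_simp
  rw [hδdef]
  ring

lemma V₂_eq {D L B C : ℝ} (hD : 0 < D) (x t : ℝ) (lam : ℂ) :
    V₂ D L B C x t lam = Complex.exp (B * t) *
      (2 * Complex.I * lam / (lam ^ 2 + (B / D : ℝ)) * dirichletMode C L x lam) := by
  have hD' : (D : ℂ) ≠ 0 := by exact_mod_cast hD.ne'
  have hk : (D : ℂ) * lam ^ 2 + B = D * (lam ^ 2 + (B / D : ℝ)) := by
    push_cast
    field_simp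
  rw [V₂, hk, dirichletMode]
  field_simp

@[fun_prop]
lemma differentiable_Delta (C y : ℝ) : Differentiable ℂ fun lam => Delta C lam y := by
  unfold Delta
  fun_prop

@[fun_prop]
lemma continuous_Delta (C : ℝ) (lam : ℂ) : Continuous fun y => Delta C lam y := by
  unfold Delta
  fun_prop

section
variable {C L : ℝ} (hL : 0 < L) (hCL : -1 ≤ C * L)
include hL hCL

lemma differentiableOn_dirichletMode (x : ℝ) :
    DifferentiableOn ℂ (dirichletMode C L x) {w | 0 < w.im} :=
  DifferentiableOn.div (differentiable_Delta _ _).differentiableOn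
    (differentiable_Delta _ _).differentiableOn fun _ hw => Delta_ne_zero hL hCL hw

lemma differentiableOn_robinMode (x : ℝ) :
    DifferentiableOn ℂ (robinMode C L x) {w | 0 < w.im} :=
  DifferentiableOn.div (by fun_prop)
    (differentiable_Delta _ _).differentiableOn fun _ hw => Delta_ne_zero hL hCL hw

lemma differentiableOn_dataMode (A x : ℝ) :
    DifferentiableOn ℂ (dataMode A C L x) {w | 0 < w.im} :=
  (differentiableOn_dirichletMode hL hCL x).add
    ((differentiableOn_robinMode hL hCL x).const_mul _)

omit hCL in
lemma exists_norm_dirichletMode_le {x : ℝ} (hx : x ∈ Ioc 0 L) :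
    ∃ K R : ℝ, ∀ lam : ℂ, R ≤ lam.im → ‖dirichletMode C L x lam‖ ≤ K / lam.im := by
  obtain ⟨R, hR, h⟩ := exists_norm_Delta_ge C hL
  refine ⟨16 / x, max R |C|, fun lam hlam => ?_⟩
  have h1 := h lam ((le_max_left _ _).trans hlam)
  have hC : |C| ≤ lam.im := (le_max_right _ _).trans hlam
  have h0 : 0 < lam.im := hR.trans_le ((le_max_left _ _).trans hlam)
  have hn : lam.im ≤ ‖lam‖ := (le_abs_self _).trans (Complex.abs_im_le_norm lam)
  have hn0 : 0 < ‖lam‖ := h0.trans_le hn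
  have h2 := norm_Delta_le C h0.le (y := x - L) (r := L - x) (by
    rw [abs_of_nonpos (by linarith [hx.2])]; linarith)
  have hx0 : 0 < x := hx.1
  rw [dirichletMode, norm_div]
  calc _ ≤ ((‖lam‖ + |C|) * Real.exp (lam.im * (L - x))) / (‖lam‖ / 8 * Real.exp (lam.im * L)) := by
        gcongr
    _ ≤ ((‖lam‖ + ‖lam‖) * Real.exp (lam.im * (L - x))) / (‖lam‖ / 8 * Real.exp (lam.im * L)) := by
        gcongr
        exact hC.trans hn
    _ = 16 * Real.exp (-(lam.im * x)) := by
        rw [show lam.im * (L - x) = lam.im * L + -(lam.im * x) by ring, Real.exp_add]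
        field_simp
        norm_num
    _ ≤ 16 * (lam.im * x)⁻¹ := by
        rw [Real.exp_neg]
        gcongr
        linarith [Real.add_one_le_exp (lam.im * x)]
    _ = _ := by field_simp

omit hCL in
lemma exists_norm_robinMode_le {x : ℝ} (hx : x ∈ Icc 0 L) :
    ∃ K R : ℝ, ∀ lam : ℂ, R ≤ lam.im → ‖robinMode C L x lam‖ ≤ K / lam.im := by
  obtain ⟨R, hR, h⟩ := exists_norm_Delta_ge C hL
  refine ⟨8, R, fun lam hlam => ?_⟩
  have h1 := h lam hlam
  have h0 : 0 < lam.im := hR.trans_le hlam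
  have hn : lam.im ≤ ‖lam‖ := (le_abs_self _).trans (Complex.abs_im_le_norm lam)
  have hn0 : 0 < ‖lam‖ := h0.trans_le hn
  have h2 := norm_sin_le h0.le (y := x) (r := L) (by rw [abs_of_nonneg hx.1]; exact hx.2)
  rw [robinMode, norm_div]
  calc _ ≤ Real.exp (lam.im * L) / (‖lam‖ / 8 * Real.exp (lam.im * L)) := by gcongr
    _ = 8 / ‖lam‖ := by field_simp
    _ ≤ _ := by gcongr

omit hCL in
lemma exists_norm_dataMode_le (A : ℝ) {x : ℝ} (hx : x ∈ Ioc 0 L) :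
    ∃ K R : ℝ, ∀ lam : ℂ, R ≤ lam.im → ‖dataMode A C L x lam‖ ≤ K / lam.im := by
  obtain ⟨K, R, h⟩ := exists_norm_dirichletMode_le (C := C) hL hx
  obtain ⟨K', R', h'⟩ := exists_norm_robinMode_le (C := C) hL (Ioc_subset_Icc_self hx)
  refine ⟨K + ‖(C - A : ℂ) * Complex.exp (-A * L)‖ * K', max R R', fun lam hlam => ?_⟩
  rw [dataMode]
  refine (norm_add_le _ _).trans ?_
  rw [norm_mul, add_div, mul_div_assoc]
  have h1 := h lam ((le_max_left _ _).trans hlam)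
  have h2 := h' lam ((le_max_right _ _).trans hlam)
  gcongr

end

namespace IsContour

variable {z : ℝ → ℂ} (hz : IsContour z) {C L : ℝ} (hL : 0 < L) (hCL : -1 ≤ C * L)
include hz hL hCL

lemma exists_norm_Delta_ge_range : ∃ c : ℝ, 0 < c ∧ ∀ s,
    c * (1 + |s|) * Real.exp ((z s).im * L) ≤ ‖Delta C (z s) (-L)‖ := by
  obtain ⟨R, hR, h⟩ := exists_norm_Delta_ge C hL
  obtain ⟨c, hc, h'⟩ := hz.exists_im_ge
  obtain ⟨c', hc', H⟩ := exists_pos_forall_le_of_eventually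
    (g := fun s => ‖Delta C (z s) (-L)‖ / ((1 + |s|) * Real.exp ((z s).im * L))) (c := c / 8)
    (((differentiable_Delta C (-L)).continuous.comp hz.continuous).norm.div
      (by have := hz.continuous; fun_prop) fun s => by positivity)
    (fun s => div_pos (norm_pos_iff.2 (Delta_ne_zero hL hCL (hz.upper s))) (by positivity))
    (by positivity) (by
      filter_upwards [hz.tendsto_im.eventually_ge_atTop R] with s hs
      rw [le_div_iff₀ (by positivity)]
      refine le_trans ?_ (h _ hs)
      have h1 := (h' s).trans ((le_abs_self _).trans (Complex.abs_im_le_norm (z s)))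
      rw [← mul_assoc]
      gcongr
      linarith)
  refine ⟨c', hc', fun s => ?_⟩
  have := H s
  rw [le_div_iff₀ (by positivity)] at this
  rwa [mul_assoc]

lemma exists_norm_dirichletMode_le_range :
    ∃ K : ℝ, 0 < K ∧ ∀ x ∈ Icc 0 L, ∀ s, ‖dirichletMode C L x (z s)‖ ≤ K := by
  obtain ⟨c, hc, h⟩ := hz.exists_norm_Delta_ge_range hL hCL
  obtain ⟨K, hK, h'⟩ := hz.exists_norm_le
  refine ⟨(K + |C|) / c, by positivity, fun x hx s => ?_⟩
  have h2 := norm_Delta_le C (hz.upper s).le (y := x - L) (r := L) (by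
    rw [abs_of_nonpos (by linarith [hx.2])]; linarith [hx.1])
  rw [dirichletMode, norm_div]
  calc _ ≤ ((‖z s‖ + |C|) * Real.exp ((z s).im * L))
        / (c * (1 + |s|) * Real.exp ((z s).im * L)) := by
        gcongr
        exact h s
    _ ≤ ((K * (1 + |s|) + |C| * (1 + |s|)) * Real.exp ((z s).im * L))
        / (c * (1 + |s|) * Real.exp ((z s).im * L)) := by
        gcongr
        · exact h' s
        · nlinarith [abs_nonneg C, abs_nonneg s, mul_nonneg (abs_nonneg C) (abs_nonneg s)]
    _ = _ := by field_simp

lemma exists_norm_robinMode_le_range :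
    ∃ K : ℝ, 0 < K ∧ ∀ x ∈ Icc 0 L, ∀ s, ‖robinMode C L x (z s)‖ ≤ K / (1 + |s|) := by
  obtain ⟨c, hc, h⟩ := hz.exists_norm_Delta_ge_range hL hCL
  refine ⟨1 / c, by positivity, fun x hx s => ?_⟩
  have h2 := norm_sin_le (hz.upper s).le (y := x) (r := L) (by
    rw [abs_of_nonneg hx.1]; exact hx.2)
  rw [robinMode, norm_div]
  calc _ ≤ Real.exp ((z s).im * L) / (c * (1 + |s|) * Real.exp ((z s).im * L)) := by
        gcongr
        exact h s
    _ = _ := by field_simp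

lemma continuous_dirichletMode (x : ℝ) : Continuous fun s => dirichletMode C L x (z s) :=
  (differentiableOn_dirichletMode hL hCL x).continuousOn.comp_continuous hz.continuous hz.upper

lemma continuous_dataMode (A x : ℝ) : Continuous fun s => dataMode A C L x (z s) :=
  (differentiableOn_dataMode hL hCL A x).continuousOn.comp_continuous hz.continuous hz.upper

lemma contourIntegrable_kernel_dirichletMode {κ : ℝ} (hκ : (√κ : ℂ) * Complex.I ∉ range z)
    {x : ℝ} (hx : x ∈ Ioc 0 L) :
    ContourIntegrable z fun lam =>
      2 * Complex.I * lam / (lam ^ 2 + κ) * dirichletMode C L x lam := by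
  obtain ⟨K, R, h⟩ := exists_norm_dirichletMode_le (C := C) hL hx
  refine hz.contourIntegrable_of_decay (K := 2 * (1 + √|κ|) * K) (R := max R (√|κ| + 1))
    ((hz.continuous_kernel hκ).mul (hz.continuous_dirichletMode hL hCL x)) fun s hs => ?_
  have h1 := norm_kernel_le κ ((le_max_right _ _).trans hs)
  have h2 := h _ ((le_max_left _ _).trans hs)
  rw [norm_mul]
  calc _ ≤ _ := mul_le_mul h1 h2 (norm_nonneg _) ((norm_nonneg _).trans h1)
    _ = _ := by ring

lemma contourIntegrable_kernel_dataMode {κ : ℝ} (hκ : (√κ : ℂ) * Complex.I ∉ range z) (A : ℝ)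
    {x : ℝ} (hx : x ∈ Ioc 0 L) :
    ContourIntegrable z fun lam =>
      2 * Complex.I * lam / (lam ^ 2 + κ) * dataMode A C L x lam := by
  obtain ⟨K, R, h⟩ := exists_norm_dataMode_le (C := C) hL A hx
  refine hz.contourIntegrable_of_decay (K := 2 * (1 + √|κ|) * K) (R := max R (√|κ| + 1))
    ((hz.continuous_kernel hκ).mul (hz.continuous_dataMode hL hCL A x)) fun s hs => ?_
  have h1 := norm_kernel_le κ ((le_max_right _ _).trans hs)
  have h2 := h _ ((le_max_left _ _).trans hs)
  rw [norm_mul]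
  calc _ ≤ _ := mul_le_mul h1 h2 (norm_nonneg _) ((norm_nonneg _).trans h1)
    _ = _ := by ring

/-- The residue evaluation of `w₂`. -/
lemma w₂_eq {D B : ℝ} (hD : 0 < D) (hκ : (√(B / D) : ℂ) * Complex.I ∉ range z) {x : ℝ}
    (hx : x ∈ Ioc 0 L) (t : ℝ) :
    w₂ D L B C z x t = Complex.exp (B * t) * (windingNumber z (√(B / D) * Complex.I)
      * dirichletMode C L x (√(B / D) * Complex.I)) := by
  obtain ⟨K, R, h⟩ := exists_norm_dirichletMode_le (C := C) hL hx
  have h1 := hz.contourIntegral_kernel_mul hκ (differentiableOn_dirichletMode hL hCL x) h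
  have h2 : contourIntegral z (V₂ D L B C x t) = Complex.exp (B * t) * contourIntegral z
      fun lam => 2 * Complex.I * lam / (lam ^ 2 + (B / D : ℝ)) * dirichletMode C L x lam := by
    simp only [contourIntegral, V₂_eq hD, mul_assoc (Complex.exp (B * t))]
    rw [integral_const_mul]
  have hpi : (Real.pi : ℂ) ≠ 0 := by exact_mod_cast Real.pi_ne_zero
  rw [w₂, h2, h1]
  field_simp

lemma contourIntegrable_V₂ {D B : ℝ} (hD : 0 < D) (hκ : (√(B / D) : ℂ) * Complex.I ∉ range z)
    {x : ℝ} (hx : x ∈ Ioc 0 L) (t : ℝ) : ContourIntegrable z (V₂ D L B C x t) := by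
  refine (((hz.contourIntegrable_kernel_dirichletMode hL hCL hκ hx)).const_mul
    (Complex.exp (B * t))).congr (ae_of_all _ fun s => ?_)
  beta_reduce
  rw [V₂_eq hD, mul_assoc (Complex.exp (B * t))]

/-- The transform decays quadratically along the contour, uniformly up to `x = 0`; this expresses
the compatibility `w(0, 0) = 1` of the initial and boundary data. -/
lemma exists_norm_solutionTransform_le {κ A : ℝ} (hκ : (√κ : ℂ) * Complex.I ∉ range z)
    (hA : (√(A ^ 2) : ℂ) * Complex.I ∉ range z) :
    ∃ K : ℝ, ∀ x ∈ Icc 0 L, ∀ s,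
      ‖solutionTransform κ A C L x (z s)‖ ≤ K / (1 + |s|) ^ 2 := by
  obtain ⟨K₁, hK₁, h₁⟩ := hz.exists_norm_kernel_le hκ
  obtain ⟨K₂, hK₂, h₂⟩ := hz.exists_norm_kernel_le hA
  obtain ⟨c, hc, h₃⟩ := hz.exists_norm_sq_add_ge hA
  obtain ⟨K₄, hK₄, h₄⟩ := hz.exists_norm_dirichletMode_le_range hL hCL
  obtain ⟨K₅, hK₅, h₅⟩ := hz.exists_norm_robinMode_le_range hL hCL
  set b := ‖(C - A : ℂ) * Complex.exp (-A * L)‖ with hb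
  refine ⟨K₁ * (‖((A ^ 2 : ℝ) - κ : ℂ)‖ / c) * K₄ + K₂ * b * K₅, fun x hx s => ?_⟩
  have k1 := hz.kernel_ne_zero hκ s
  have k2 := hz.kernel_ne_zero hA s
  have e : solutionTransform κ A C L x (z s)
      = 2 * Complex.I * z s / (z s ^ 2 + κ) * (((A ^ 2 : ℝ) - κ) / (z s ^ 2 + (A ^ 2 : ℝ)))
        * dirichletMode C L x (z s)
        - 2 * Complex.I * z s / (z s ^ 2 + (A ^ 2 : ℝ)) * ((C - A : ℂ) * Complex.exp (-A * L))
          * robinMode C L x (z s) := by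
    rw [solutionTransform, dataMode]
    field_simp
    ring
  rw [e]
  refine (norm_sub_le _ _).trans ?_
  rw [norm_mul, norm_mul, norm_mul (_ * _), norm_mul (_ / _) (_ * _), add_div]
  have hs1 : 1 ≤ 1 + |s| := by linarith [abs_nonneg s]
  refine add_le_add ?_ ?_
  · have h6 : ‖((A ^ 2 : ℝ) - κ : ℂ) / (z s ^ 2 + (A ^ 2 : ℝ))‖
        ≤ ‖((A ^ 2 : ℝ) - κ : ℂ)‖ / c / (1 + |s|) := by
      rw [norm_div, div_div]
      gcongr
      refine le_trans ?_ (h₃ s)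
      have : 1 + |s| ≤ (1 + |s|) ^ 2 := by nlinarith
      gcongr
    calc _ ≤ (K₁ / (1 + |s|)) * (‖((A ^ 2 : ℝ) - κ : ℂ)‖ / c / (1 + |s|)) * K₄ := by
          gcongr
          · exact h₁ s
          · exact h₄ x hx s
      _ = _ := by field_simp
  · calc _ ≤ (K₂ / (1 + |s|)) * b * (K₅ / (1 + |s|)) := by
          gcongr
          · exact h₂ s
          · exact h₅ x hx s
      _ = _ := by field_simp

lemma continuous_solutionTransform {κ A : ℝ} (hκ : (√κ : ℂ) * Complex.I ∉ range z)
    (hA : (√(A ^ 2) : ℂ) * Complex.I ∉ range z) (x : ℝ) :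
    Continuous fun s => solutionTransform κ A C L x (z s) :=
  ((hz.continuous_kernel hκ).mul (hz.continuous_dirichletMode hL hCL x)).sub
    ((hz.continuous_kernel hA).mul (hz.continuous_dataMode hL hCL A x))

omit hz hL hCL in
lemma continuous_solutionTransform_left (κ A : ℝ) (lam : ℂ) :
    Continuous fun x => solutionTransform κ A C L x lam := by
  unfold solutionTransform dataMode dirichletMode robinMode
  fun_prop

lemma contourIntegral_solutionTransform {κ A : ℝ} (hκ : (√κ : ℂ) * Complex.I ∉ range z)
    (hA : (√(A ^ 2) : ℂ) * Complex.I ∉ range z) {x : ℝ} (hx : x ∈ Ioc 0 L) :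
    contourIntegral z (solutionTransform κ A C L x) = 2 * Real.pi *
      (windingNumber z (√(A ^ 2) * Complex.I) * dataMode A C L x (√(A ^ 2) * Complex.I)
        - windingNumber z (√κ * Complex.I) * dirichletMode C L x (√κ * Complex.I)) := by
  obtain ⟨K, R, h⟩ := exists_norm_dirichletMode_le (C := C) hL hx
  obtain ⟨K', R', h'⟩ := exists_norm_dataMode_le (C := C) hL A hx
  have h1 := hz.contourIntegral_kernel_mul hκ (differentiableOn_dirichletMode hL hCL x) h
  have h2 := hz.contourIntegral_kernel_mul hA (differentiableOn_dataMode hL hCL A x) h'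
  have h3 : contourIntegral z (solutionTransform κ A C L x)
      = contourIntegral z (fun lam =>
          2 * Complex.I * lam / (lam ^ 2 + κ) * dirichletMode C L x lam)
        - contourIntegral z (fun lam =>
          2 * Complex.I * lam / (lam ^ 2 + (A ^ 2 : ℝ)) * dataMode A C L x lam) := by
    refine Eq.trans ?_ (integral_sub (hz.contourIntegrable_kernel_dirichletMode hL hCL hκ hx)
      (hz.contourIntegrable_kernel_dataMode hL hCL hA A hx))
    exact integral_congr_ae (ae_of_all _ fun s => sub_mul _ _ _)
  rw [h3, h1, h2]
  ring

end IsContour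

/-- At its pole the mode with the boundary data of `exp (-A x)` is `exp (-A x)` itself. -/
lemma dataMode_pole {A C L : ℝ} (hL : 0 < L) (hCL : -1 ≤ C * L) (hA : A ≠ 0) (x : ℝ) :
    dataMode A C L x (√(A ^ 2) * Complex.I) = Complex.exp (-A * x) := by
  have h0 : Delta C (√(A ^ 2) * Complex.I) (-L) ≠ 0 := Delta_ne_zero hL hCL (by
    rw [Real.sqrt_sq_eq_abs]; simpa using hA)
  obtain ⟨σ, hσ, hσ'⟩ : ∃ σ : ℂ, (σ = 1 ∨ σ = -1) ∧ (√(A ^ 2) : ℂ) * Complex.I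
      = -Complex.I * (σ * A) := by
    rw [Real.sqrt_sq_eq_abs]
    rcases abs_choice A with h | h
    · exact ⟨-1, .inr rfl, by rw [h]; ring⟩
    · exact ⟨1, .inl rfl, by rw [h]; push_cast; ring⟩
  have hodd : ∀ y : ℝ, Delta C (-Complex.I * (σ * A)) y
      = σ * (-Complex.I * (A * Complex.cosh (A * y) - C * Complex.sinh (A * y))) := fun y => by
    rw [Delta_neg_I_mul]
    rcases hσ with rfl | rfl
    · simp only [one_mul]
    · have : (-1 : ℂ) * A * y = -(A * y) := by ring
      rw [this, Complex.cosh_neg, Complex.sinh_neg]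
      ring
  have hsin : Complex.sin (-Complex.I * (σ * A) * x) = σ * (-Complex.I * Complex.sinh (A * x)) := by
    have e : -Complex.I * (σ * A) * x = -(σ * (A * x)) * Complex.I := by ring
    rw [e, Complex.sin_mul_I, Complex.sinh_neg]
    rcases hσ with rfl | rfl
    · simp only [one_mul]; ring
    · rw [neg_one_mul, Complex.sinh_neg]; ring
  rw [hσ', hodd] at h0
  have hne := right_ne_zero_of_mul (right_ne_zero_of_mul h0)
  rw [dataMode, dirichletMode, robinMode, hσ', hodd, hodd, hsin]
  have hσ0 : σ ≠ 0 := left_ne_zero_of_mul h0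
  have hI := Complex.I_ne_zero
  rw [mul_div_mul_left _ _ hσ0, mul_div_mul_left _ _ (neg_ne_zero.2 hI),
    mul_div_mul_left _ _ hσ0, mul_div_mul_left _ _ (neg_ne_zero.2 hI),
    ← mul_div_assoc, ← add_div, div_eq_iff hne]
  have y1 : Complex.exp (A * (x - L : ℝ)) = Complex.exp (A * x) * (Complex.exp (A * L))⁻¹ := by
    rw [← Complex.exp_neg, ← Complex.exp_add]; congr 1; push_cast; ring
  have y2 : Complex.exp (-(A * (x - L : ℝ))) = Complex.exp (A * L) * (Complex.exp (A * x))⁻¹ := by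
    rw [← Complex.exp_neg, ← Complex.exp_add]; congr 1; push_cast; ring
  have y3 : Complex.exp (A * (-L : ℝ)) = (Complex.exp (A * L))⁻¹ := by
    rw [← Complex.exp_neg]; congr 1; push_cast; ring
  have y4 : Complex.exp (-(A * (-L : ℝ))) = Complex.exp (A * L) := by
    congr 1; push_cast; ring
  have y5 : Complex.exp (-(A * x)) = (Complex.exp (A * x))⁻¹ := Complex.exp_neg _
  have y6 : Complex.exp (-A * L) = (Complex.exp (A * L))⁻¹ := by
    rw [← Complex.exp_neg]; congr 1; ring
  have y7 : Complex.exp (-A * x) = (Complex.exp (A * x))⁻¹ := by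
    rw [← Complex.exp_neg]; congr 1; ring
  simp only [Complex.cosh, Complex.sinh, y1, y2, y3, y4, y5, y6, y7]
  have hX := Complex.exp_ne_zero (A * x)
  have hY := Complex.exp_ne_zero (A * L)
  set X := Complex.exp (A * x)
  set Y := Complex.exp (A * L)
  field_simp
  ring

/-! ### Integrals with a Gaussian factor -/

/-- The function `c` is continuous along `z` and grows at most exponentially. -/
def ExpBounded (z : ℝ → ℂ) (c : ℂ → ℂ) : Prop :=
  (Continuous fun s => c (z s)) ∧ ∃ K k : ℝ, 0 ≤ K ∧ 0 ≤ k ∧ ∀ s, ‖c (z s)‖ ≤ K * Real.exp (k * |s|)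

namespace ExpBounded

variable {z : ℝ → ℂ} {c d : ℂ → ℂ}

lemma mul (hc : ExpBounded z c) (hd : ExpBounded z d) : ExpBounded z fun lam => c lam * d lam := by
  obtain ⟨h1, K, k, hK, hk, h⟩ := hc
  obtain ⟨h2, K', k', hK', hk', h'⟩ := hd
  refine ⟨h1.mul h2, K * K', k + k', by positivity, by positivity, fun s => ?_⟩
  rw [norm_mul, add_mul, Real.exp_add]
  calc _ ≤ (K * Real.exp (k * |s|)) * (K' * Real.exp (k' * |s|)) :=
        mul_le_mul (h s) (h' s) (norm_nonneg _) (by positivity)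
    _ = _ := by ring

lemma add (hc : ExpBounded z c) (hd : ExpBounded z d) : ExpBounded z fun lam => c lam + d lam := by
  obtain ⟨h1, K, k, hK, hk, h⟩ := hc
  obtain ⟨h2, K', k', hK', hk', h'⟩ := hd
  refine ⟨h1.add h2, K + K', k + k', by positivity, by positivity, fun s => ?_⟩
  have e1 : Real.exp (k * |s|) ≤ Real.exp ((k + k') * |s|) := by gcongr; linarith
  have e2 : Real.exp (k' * |s|) ≤ Real.exp ((k + k') * |s|) := by gcongr; linarith
  calc _ ≤ _ := norm_add_le _ _
    _ ≤ K * Real.exp (k * |s|) + K' * Real.exp (k' * |s|) := add_le_add (h s) (h' s)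
    _ ≤ K * Real.exp ((k + k') * |s|) + K' * Real.exp ((k + k') * |s|) := by gcongr
    _ = _ := by ring

lemma of_norm_le (hc : Continuous fun s => c (z s)) {K : ℝ} (h : ∀ s, ‖c (z s)‖ ≤ K) :
    ExpBounded z c :=
  ⟨hc, K, 0, (norm_nonneg _).trans (h 0), le_rfl, fun s => by simpa using h s⟩

lemma const (a : ℂ) : ExpBounded z fun _ => a :=
  of_norm_le continuous_const fun _ => le_rfl

end ExpBounded

/-- The integral of `c(lam) exp (σ i lam x - D lam ^ 2 t)`. For `σ ^ 2 = 1` this is a solution of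
the heat equation. -/
noncomputable def gaussianIntegral (z : ℝ → ℂ) (D : ℝ) (c : ℂ → ℂ) (σ x t : ℝ) : ℂ :=
  contourIntegral z fun lam => c lam * Complex.exp (σ * (Complex.I * lam * x) - D * lam ^ 2 * t)

namespace IsContour

variable {z : ℝ → ℂ} (hz : IsContour z)
include hz

lemma expBounded_id : ExpBounded z fun lam => lam := by
  obtain ⟨K, hK, h⟩ := hz.exists_norm_le
  refine ⟨hz.continuous, K, 1, hK.le, zero_le_one, fun s => (h s).trans ?_⟩
  gcongr
  rw [one_mul, add_comm]
  exact Real.add_one_le_exp _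

lemma expBounded_exp (a : ℂ) : ExpBounded z fun lam => Complex.exp (a * lam) := by
  obtain ⟨K, hK, h⟩ := hz.exists_norm_le
  refine ⟨by have := hz.continuous; fun_prop, Real.exp (‖a‖ * K), ‖a‖ * K, by positivity,
    by positivity, fun s => ?_⟩
  rw [Complex.norm_exp, ← Real.exp_add]
  gcongr
  calc _ ≤ ‖a * z s‖ := Complex.re_le_norm _
    _ ≤ ‖a‖ * (K * (1 + |s|)) := by rw [norm_mul]; gcongr; exact h s
    _ = _ := by ring

lemma expBounded_kernel {κ : ℝ} (hκ : (√κ : ℂ) * Complex.I ∉ range z) :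
    ExpBounded z fun lam => 2 * Complex.I * lam / (lam ^ 2 + κ) := by
  obtain ⟨K, hK, h⟩ := hz.exists_norm_kernel_le hκ
  exact .of_norm_le (hz.continuous_kernel hκ) fun s =>
    (h s).trans (div_le_self hK.le (by linarith [abs_nonneg s]))

lemma exists_norm_gaussian_le {D : ℝ} (hD : 0 < D) {c : ℂ → ℂ} (hc : ExpBounded z c) (σ X : ℝ)
    {t₀ : ℝ} (ht₀ : 0 < t₀) (T : ℝ) :
    ∃ K : ℝ, ∀ x, |x| ≤ X → ∀ t ∈ Icc t₀ T, ∀ s,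
      ‖c (z s) * Complex.exp (σ * (Complex.I * z s * x) - D * z s ^ 2 * t)‖
        ≤ K * (1 + s ^ 2)⁻¹ := by
  obtain ⟨-, K₁, k, hK₁, hk, h₁⟩ := hc
  obtain ⟨K₂, hK₂, h₂⟩ := hz.exists_norm_le
  obtain ⟨a, m, ha, hm, h₃⟩ := hz.exists_re_sq_ge
  set τ := D * t₀ * a with hτ
  have hτ0 : 0 < τ := by positivity
  set b := k + |σ| * |X| * K₂ with hb
  set M := |σ| * |X| * K₂ + D * T * m + b ^ 2 / (2 * τ) with hM
  refine ⟨K₁ * Real.exp M * (1 + 2 / τ), fun x hx t ht s => ?_⟩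
  have hre : (σ * (Complex.I * z s * x) - D * z s ^ 2 * t : ℂ).re
      = -(σ * x * (z s).im) - D * t * (z s ^ 2).re := by
    have : (σ * (Complex.I * z s * x) - D * z s ^ 2 * t : ℂ)
        = ((σ * x : ℝ) : ℂ) * (Complex.I * z s) - ((D * t : ℝ) : ℂ) * z s ^ 2 := by
      push_cast; ring
    rw [this, Complex.sub_re, Complex.re_ofReal_mul, Complex.re_ofReal_mul, Complex.I_mul_re]
    ring
  have e1 : -(σ * x * (z s).im) ≤ |σ| * |X| * K₂ * (1 + |s|) := by
    calc _ ≤ |σ * x * (z s).im| := neg_le_abs _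
      _ = |σ| * |x| * |(z s).im| := by rw [abs_mul, abs_mul]
      _ ≤ |σ| * |X| * (K₂ * (1 + |s|)) := by
        exact mul_le_mul (mul_le_mul_of_nonneg_left (hx.trans (le_abs_self X)) (abs_nonneg _))
          ((Complex.abs_im_le_norm _).trans (h₂ s)) (abs_nonneg _) (by positivity)
      _ = _ := by ring
  have e2 : -(D * t * (z s ^ 2).re) ≤ D * T * m - τ * s ^ 2 := by
    have i1 := mul_le_mul_of_nonneg_left (h₃ s) (show 0 ≤ D * t by nlinarith [ht.1])
    have i2 : D * t * m ≤ D * T * m := by gcongr; exact ht.2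
    have i3 : D * t₀ * (a * s ^ 2) ≤ D * t * (a * s ^ 2) := by gcongr; exact ht.1
    have i4 : τ * s ^ 2 = D * t₀ * (a * s ^ 2) := by rw [hτ]; ring
    linarith
  have e3 : b * |s| ≤ τ / 2 * s ^ 2 + b ^ 2 / (2 * τ) := by
    have : 0 ≤ (τ * |s| - b) ^ 2 / (2 * τ) := by positivity
    have e : (τ * |s| - b) ^ 2 / (2 * τ) = τ / 2 * s ^ 2 + b ^ 2 / (2 * τ) - b * |s| := by
      rw [← sq_abs s]; field_simp; ring
    linarith
  have e4 : Real.exp (-(τ / 2 * s ^ 2)) ≤ (1 + 2 / τ) * (1 + s ^ 2)⁻¹ := by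
    rw [Real.exp_neg, ← div_eq_mul_inv, le_div_iff₀ (by positivity),
      inv_mul_le_iff₀ (Real.exp_pos _)]
    have := Real.add_one_le_exp (τ / 2 * s ^ 2)
    calc 1 + s ^ 2 ≤ (τ / 2 * s ^ 2 + 1) * (1 + 2 / τ) := by
          have : (τ / 2 * s ^ 2 + 1) * (1 + 2 / τ) = 1 + s ^ 2 + (τ / 2 * s ^ 2 + 2 / τ) := by
            field_simp; ring
          rw [this]
          have : 0 ≤ τ / 2 * s ^ 2 + 2 / τ := by positivity
          linarith
      _ ≤ _ := by gcongr
  rw [norm_mul, Complex.norm_exp, hre]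
  calc _ ≤ (K₁ * Real.exp (k * |s|)) * Real.exp (-(σ * x * (z s).im) - D * t * (z s ^ 2).re) := by
        gcongr; exact h₁ s
    _ = K₁ * Real.exp (k * |s| + (-(σ * x * (z s).im) - D * t * (z s ^ 2).re)) := by
        rw [Real.exp_add]; ring
    _ ≤ K₁ * Real.exp (M + -(τ / 2 * s ^ 2)) := by
        refine mul_le_mul_of_nonneg_left (Real.exp_le_exp.2 ?_) hK₁
        rw [hM]
        have : b * |s| = k * |s| + |σ| * |X| * K₂ * |s| := by rw [hb]; ring
        nlinarith
    _ = K₁ * Real.exp M * Real.exp (-(τ / 2 * s ^ 2)) := by rw [Real.exp_add]; ring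
    _ ≤ K₁ * Real.exp M * ((1 + 2 / τ) * (1 + s ^ 2)⁻¹) := by gcongr
    _ = _ := by ring

lemma continuous_gaussian (D : ℝ) {c : ℂ → ℂ} (hc : ExpBounded z c) (σ x t : ℝ) :
    Continuous fun s => c (z s) * Complex.exp (σ * (Complex.I * z s * x) - D * z s ^ 2 * t) := by
  have h1 := hz.continuous
  exact hc.1.mul (by fun_prop)

lemma contourIntegrable_gaussian {D : ℝ} (hD : 0 < D) {c : ℂ → ℂ} (hc : ExpBounded z c) (σ x : ℝ)
    {t : ℝ} (ht : 0 < t) : ContourIntegrable z fun lam =>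
      c lam * Complex.exp (σ * (Complex.I * lam * x) - D * lam ^ 2 * t) := by
  obtain ⟨K, hK⟩ := hz.exists_norm_gaussian_le hD hc σ |x| ht t
  exact hz.integrable_mul_deriv (hz.continuous_gaussian D hc σ x t)
    (hK x le_rfl t ⟨le_rfl, le_rfl⟩)

lemma hasDerivAt_gaussianIntegral_t {D : ℝ} (hD : 0 < D) {c : ℂ → ℂ} (hc : ExpBounded z c)
    (σ x : ℝ) {t : ℝ} (ht : 0 < t) :
    HasDerivAt (fun t => gaussianIntegral z D c σ x t)
      (gaussianIntegral z D (fun lam => -D * lam ^ 2 * c lam) σ x t) t := by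
  have hc' : ExpBounded z fun lam => -D * lam ^ 2 * c lam := by
    simp only [pow_two]
    exact ((ExpBounded.const (-D : ℂ)).mul (hz.expBounded_id.mul hz.expBounded_id)).mul hc
  obtain ⟨K, hK⟩ := hz.exists_norm_gaussian_le hD hc' σ |x| (half_pos ht) (2 * t)
  obtain ⟨M, hM, hb⟩ := hz.exists_ae_norm_deriv_le
  refine (hasDerivAt_integral_of_dominated_loc_of_deriv_le (μ := volume) (𝕜 := ℝ)
    (F := fun (t : ℝ) s =>
      c (z s) * Complex.exp (σ * (Complex.I * z s * x) - D * z s ^ 2 * t) * deriv z s)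
    (F' := fun (t : ℝ) s => -D * z s ^ 2 * c (z s)
      * Complex.exp (σ * (Complex.I * z s * x) - D * z s ^ 2 * t) * deriv z s)
    (bound := fun s => K * (1 + s ^ 2)⁻¹ * M)
    (Icc_mem_nhds (half_lt_self ht) (show t < 2 * t by linarith))
    ?_ (hz.contourIntegrable_gaussian hD hc σ x ht)
    (hz.contourIntegrable_gaussian hD hc' σ x ht).1 ?_
    ((integrable_inv_one_add_sq.const_mul _).mul_const _) ?_).2
  · exact .of_forall fun t => ((hz.continuous_gaussian D hc σ x t).aestronglyMeasurable).mul
      (measurable_deriv z).aestronglyMeasurable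
  · filter_upwards [hb] with s hs u hu
    rw [norm_mul]
    exact mul_le_mul (hK x le_rfl u hu s) hs (norm_nonneg _)
      ((norm_nonneg _).trans (hK x le_rfl u hu s))
  · refine ae_of_all _ fun s u _ => ?_
    have h1 : HasDerivAt (fun u : ℝ => σ * (Complex.I * z s * x) - D * z s ^ 2 * (u : ℂ))
        (-(D * z s ^ 2 * 1)) u :=
      ((Complex.ofRealCLM.hasDerivAt (x := u)).const_mul _).const_sub _
    convert! (h1.cexp.const_mul (c (z s))).mul_const (deriv z s) using 1
    ring

lemma hasDerivAt_gaussianIntegral_x {D : ℝ} (hD : 0 < D) {c : ℂ → ℂ} (hc : ExpBounded z c)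
    (σ x : ℝ) {t : ℝ} (ht : 0 < t) :
    HasDerivAt (fun x => gaussianIntegral z D c σ x t)
      (gaussianIntegral z D (fun lam => σ * Complex.I * lam * c lam) σ x t) x := by
  have hc' : ExpBounded z fun lam => σ * Complex.I * lam * c lam :=
    ((ExpBounded.const (σ * Complex.I)).mul hz.expBounded_id).mul hc
  obtain ⟨K, hK⟩ := hz.exists_norm_gaussian_le hD hc' σ (|x| + 1) ht t
  obtain ⟨M, hM, hb⟩ := hz.exists_ae_norm_deriv_le
  have hball : ∀ u ∈ Metric.ball x 1, |u| ≤ |x| + 1 := fun u hu => by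
    have h1 : |u - x| < 1 := by rwa [← Real.dist_eq]
    have := abs_sub_abs_le_abs_sub u x
    linarith
  have ht' : t ∈ Icc t t := ⟨le_rfl, le_rfl⟩
  refine (hasDerivAt_integral_of_dominated_loc_of_deriv_le (μ := volume) (𝕜 := ℝ)
    (F := fun (x : ℝ) s =>
      c (z s) * Complex.exp (σ * (Complex.I * z s * x) - D * z s ^ 2 * t) * deriv z s)
    (F' := fun (x : ℝ) s => σ * Complex.I * z s * c (z s)
      * Complex.exp (σ * (Complex.I * z s * x) - D * z s ^ 2 * t) * deriv z s)
    (bound := fun s => K * (1 + s ^ 2)⁻¹ * M) (Metric.ball_mem_nhds x one_pos)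
    ?_ (hz.contourIntegrable_gaussian hD hc σ x ht)
    (hz.contourIntegrable_gaussian hD hc' σ x ht).1 ?_
    ((integrable_inv_one_add_sq.const_mul _).mul_const _) ?_).2
  · exact .of_forall fun x => ((hz.continuous_gaussian D hc σ x t).aestronglyMeasurable).mul
      (measurable_deriv z).aestronglyMeasurable
  · filter_upwards [hb] with s hs u hu
    rw [norm_mul]
    exact mul_le_mul (hK u (hball u hu) t ht' s) hs (norm_nonneg _)
      ((norm_nonneg _).trans (hK u (hball u hu) t ht' s))
  · refine ae_of_all _ fun s u _ => ?_
    have h1 : HasDerivAt (fun u : ℝ => σ * (Complex.I * z s * (u : ℂ)) - D * z s ^ 2 * t)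
        (σ * (Complex.I * z s * 1)) u :=
      (((Complex.ofRealCLM.hasDerivAt (x := u)).const_mul _).const_mul _).sub_const _
    convert! (h1.cexp.const_mul (c (z s))).mul_const (deriv z s) using 1
    ring

lemma gaussianIntegral_add {D : ℝ} (hD : 0 < D) {c d : ℂ → ℂ} (hc : ExpBounded z c)
    (hd : ExpBounded z d) (σ x : ℝ) {t : ℝ} (ht : 0 < t) :
    gaussianIntegral z D (fun lam => c lam + d lam) σ x t
      = gaussianIntegral z D c σ x t + gaussianIntegral z D d σ x t := by
  refine Eq.trans ?_ (integral_add (hz.contourIntegrable_gaussian hD hc σ x ht)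
    (hz.contourIntegrable_gaussian hD hd σ x ht))
  refine integral_congr_ae (ae_of_all _ fun s => ?_)
  beta_reduce
  ring

omit hz in
lemma gaussianIntegral_const_mul (D : ℝ) (c : ℂ → ℂ) (a : ℂ) (σ x t : ℝ) :
    gaussianIntegral z D (fun lam => a * c lam) σ x t = a * gaussianIntegral z D c σ x t := by
  simp only [gaussianIntegral, contourIntegral, mul_assoc a]
  rw [integral_const_mul]

lemma gaussianIntegral_id {D : ℝ} (hD : 0 < D) {t : ℝ} (ht : 0 < t) :
    gaussianIntegral z D (fun lam => lam) 0 0 t = 0 := by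
  have hD' : (D : ℂ) ≠ 0 := by exact_mod_cast hD.ne'
  have ht' : (t : ℂ) ≠ 0 := by exact_mod_cast ht.ne'
  refine hz.contourIntegral_eq_zero
    (Φ := fun lam => -1 / (2 * D * t) * Complex.exp ((0 : ℝ) * (Complex.I * lam * (0 : ℝ))
      - D * lam ^ 2 * t)) (fun s => ?_)
    (hz.contourIntegrable_gaussian hD hz.expBounded_id 0 0 ht) ?_
  · have h1 : HasDerivAt (fun lam : ℂ => ((0 : ℝ) : ℂ) * (Complex.I * lam * (0 : ℝ))
        - D * lam ^ 2 * t) (-(2 * D * t * z s)) (z s) := by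
      have := (((hasDerivAt_pow 2 (z s)).const_mul (D : ℂ)).mul_const (t : ℂ)).const_sub
        (((0 : ℝ) : ℂ))
      convert! this using 1
      · ext lam; simp
      · simp; ring
    convert! h1.cexp.const_mul (-1 / (2 * D * t : ℂ)) using 1
    field_simp
  · obtain ⟨K, hK⟩ := hz.exists_norm_gaussian_le hD (.const (-1 / (2 * D * t))) 0 0 ht t
    refine squeeze_zero_norm (hK 0 (by simp) t ⟨le_rfl, le_rfl⟩) ?_
    rw [← mul_zero K]
    refine (tendsto_inv_atTop_zero.comp ?_).const_mul K
    refine tendsto_atTop_add_const_left _ _ ?_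
    have : (fun s : ℝ => s ^ 2) = fun s => ‖s‖ ^ 2 := by ext s; simp
    rw [this]
    exact (tendsto_pow_atTop two_ne_zero).comp tendsto_norm_cocompact_atTop

lemma norm_exp_le : ∃ m : ℝ, 0 < m ∧ ∀ D t : ℝ, 0 ≤ D → 0 ≤ t → ∀ s,
    ‖Complex.exp (-D * z s ^ 2 * t)‖ ≤ Real.exp (D * m * t) := by
  obtain ⟨a, m, ha, hm, h⟩ := hz.exists_re_sq_ge
  refine ⟨m, hm, fun D t hD ht s => ?_⟩
  rw [Complex.norm_exp]
  gcongr
  have e : (-D * z s ^ 2 * t : ℂ) = ((-(D * t) : ℝ) : ℂ) * z s ^ 2 := by push_cast; ring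
  rw [e, Complex.re_ofReal_mul]
  have h1 : -m ≤ (z s ^ 2).re := by
    have := h s
    nlinarith [mul_nonneg ha.le (sq_nonneg s)]
  nlinarith [mul_nonneg hD ht]

lemma contourIntegrable_exp_mul {D t : ℝ} (hD : 0 < D) (ht : 0 ≤ t) {g : ℂ → ℂ}
    (hg : Continuous fun s => g (z s)) {K : ℝ} (h : ∀ s, ‖g (z s)‖ ≤ K / (1 + |s|) ^ 2) :
    ContourIntegrable z fun lam => Complex.exp (-D * lam ^ 2 * t) * g lam := by
  obtain ⟨m, -, hm⟩ := hz.norm_exp_le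
  refine hz.integrable_mul_deriv_of_le (K := Real.exp (D * m * t) * K)
    ((by have := hz.continuous; fun_prop : Continuous fun s => Complex.exp (-D * z s ^ 2 * t)).mul
      hg) fun s => ?_
  rw [norm_mul, mul_div_assoc]
  exact mul_le_mul (hm D t hD.le ht s) (h s) (norm_nonneg _) (by positivity)

/-- Integrals against `exp (-D lam ^ 2 t)` are continuous up to `t = 0` when the other factor decays
quadratically. -/
lemma continuousOn_contourIntegral_exp_mul {D : ℝ} (hD : 0 < D) {E : Set ℝ} {g : ℝ → ℂ → ℂ}
    (hg₁ : ∀ s, Continuous fun x => g x (z s)) (hg₂ : ∀ x, Continuous fun s => g x (z s)) {K : ℝ}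
    (h : ∀ x ∈ E, ∀ s, ‖g x (z s)‖ ≤ K / (1 + |s|) ^ 2) :
    ContinuousOn (fun p : ℝ × ℝ =>
      contourIntegral z fun lam => Complex.exp (-D * lam ^ 2 * p.2) * g p.1 lam)
      (E ×ˢ Ici 0) := by
  obtain ⟨m, hm0, hm⟩ := hz.norm_exp_le
  obtain ⟨M, hM, hb⟩ := hz.exists_ae_norm_deriv_le
  have hcz := hz.continuous
  rintro ⟨x₀, t₀⟩ ⟨hx₀, ht₀⟩
  have ht₀' : 0 ≤ t₀ := ht₀
  refine continuousWithinAt_of_dominated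
    (bound := fun s => Real.exp (D * m * (t₀ + 1)) * (|K| * (1 + s ^ 2)⁻¹) * M) ?_ ?_
    (((integrable_inv_one_add_sq.const_mul _).const_mul _).mul_const _) ?_
  · refine .of_forall fun p => ?_
    refine (Continuous.aestronglyMeasurable ?_).mul (measurable_deriv z).aestronglyMeasurable
    exact (by fun_prop : Continuous fun s => Complex.exp (-D * z s ^ 2 * p.2)).mul (hg₂ p.1)
  · have h1 : ∀ᶠ p : ℝ × ℝ in 𝓝[E ×ˢ Ici 0] (x₀, t₀), p.2 < t₀ + 1 :=
      nhdsWithin_le_nhds (continuous_snd.continuousAt.eventually (gt_mem_nhds (by simp)))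
    filter_upwards [h1, self_mem_nhdsWithin] with p hp hpE
    filter_upwards [hb] with s hs
    have hp2 : 0 ≤ p.2 := hpE.2
    rw [norm_mul, norm_mul]
    have h2 : ‖g p.1 (z s)‖ ≤ |K| * (1 + s ^ 2)⁻¹ := by
      refine (h p.1 hpE.1 s).trans ?_
      rw [div_eq_mul_inv]
      have : 1 + s ^ 2 ≤ (1 + |s|) ^ 2 := by
        rw [← sq_abs s]; nlinarith [abs_nonneg s]
      gcongr
      exact le_abs_self K
    have h3 : ‖Complex.exp (-D * z s ^ 2 * p.2)‖ ≤ Real.exp (D * m * (t₀ + 1)) := by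
      refine (hm D p.2 hD.le hp2 s).trans ?_
      gcongr
    gcongr
  · refine ae_of_all _ fun s => Continuous.continuousWithinAt ?_
    have : Continuous fun p : ℝ × ℝ => g p.1 (z s) := (hg₁ s).comp continuous_fst
    fun_prop

lemma tendsto_contourIntegral_exp_mul {D : ℝ} (hD : 0 < D) {g : ℂ → ℂ}
    (hg : Continuous fun s => g (z s)) {K : ℝ} (h : ∀ s, ‖g (z s)‖ ≤ K / (1 + |s|) ^ 2) :
    Tendsto (fun t : ℝ => contourIntegral z fun lam => Complex.exp (-D * lam ^ 2 * t) * g lam)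
      (𝓝[>] 0) (𝓝 (contourIntegral z g)) := by
  have h1 := hz.continuousOn_contourIntegral_exp_mul hD (E := univ) (g := fun _ => g)
    (fun _ => continuous_const) (fun _ => hg) (fun _ _ => h)
  have h2 : ContinuousOn (fun t : ℝ => contourIntegral z fun lam =>
      Complex.exp (-D * lam ^ 2 * t) * g lam) (Ici 0) :=
    h1.comp (f := fun t : ℝ => ((0 : ℝ), t)) (by fun_prop) fun t ht => ⟨mem_univ _, ht⟩
  have h3 := ((h2 0 self_mem_Ici).mono Ioi_subset_Ici_self).tendsto
  simpa only [Complex.ofReal_zero, mul_zero, Complex.exp_zero, one_mul] using h3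

/-- The Gaussian integral of the kernel solves `J' = D κ J`, because the contribution of
`lam exp (-D lam ^ 2 t)` is exact. -/
lemma exists_gaussianIntegral_kernel_eq {D : ℝ} (hD : 0 < D) {κ : ℝ}
    (hκ : (√κ : ℂ) * Complex.I ∉ range z) :
    ∃ a : ℂ, ∀ t : ℝ, 0 < t →
      gaussianIntegral z D (fun lam => 2 * Complex.I * lam / (lam ^ 2 + κ)) 0 0 t
        = a * Complex.exp (D * κ * t) := by
  set J := fun t => gaussianIntegral z D (fun lam => 2 * Complex.I * lam / (lam ^ 2 + κ)) 0 0 t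
    with hJ
  have hk := hz.expBounded_kernel hκ
  have hderiv : ∀ t : ℝ, 0 < t → HasDerivAt J (D * κ * J t) t := fun t ht => by
    have h1 := hz.hasDerivAt_gaussianIntegral_t hD hk 0 0 ht
    have h2 : gaussianIntegral z D
        (fun lam => -D * lam ^ 2 * (2 * Complex.I * lam / (lam ^ 2 + κ))) 0 0 t
        = gaussianIntegral z D (fun lam => D * κ * (2 * Complex.I * lam / (lam ^ 2 + κ))
          + -(2 * Complex.I * D) * lam) 0 0 t := by
      refine integral_congr_ae (ae_of_all _ fun s => ?_)
      beta_reduce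
      congr 2
      have := hz.kernel_ne_zero hκ s
      field_simp
      ring
    rw [h2, hz.gaussianIntegral_add hD ((ExpBounded.const _).mul hk)
      ((ExpBounded.const _).mul hz.expBounded_id) 0 0 ht, gaussianIntegral_const_mul,
      gaussianIntegral_const_mul, hz.gaussianIntegral_id hD ht, mul_zero, add_zero] at h1
    exact h1
  have hderiv' : ∀ t ∈ Ioi (0 : ℝ),
      HasDerivAt (fun t => J t * Complex.exp (-(D * κ * t))) 0 t := fun t ht => by
    have h1 : HasDerivAt (fun t : ℝ => -(D * κ * (t : ℂ))) (-(D * κ * 1)) t :=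
      ((Complex.ofRealCLM.hasDerivAt (x := t)).const_mul _).neg
    convert! (hderiv t ht).mul h1.cexp using 1
    ring
  obtain ⟨a, ha⟩ := isOpen_Ioi.exists_is_const_of_deriv_eq_zero isPreconnected_Ioi
    (fun t ht => (hderiv' t ht).differentiableAt.differentiableWithinAt)
    (fun t ht => (hderiv' t ht).deriv)
  refine ⟨a, fun t ht => ?_⟩
  rw [← ha t ht, mul_assoc, ← Complex.exp_add, neg_add_cancel, Complex.exp_zero, mul_one]

/-- For large `κ` the exponential `exp (D κ t)` outgrows the Gaussian integral, which is therefore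
zero. -/
lemma exists_gaussianIntegral_kernel_eq_zero {D : ℝ} (hD : 0 < D) : ∃ m : ℝ, ∀ κ : ℝ, m < κ →
    (√κ : ℂ) * Complex.I ∉ range z → ∀ t : ℝ, 0 < t →
      gaussianIntegral z D (fun lam => 2 * Complex.I * lam / (lam ^ 2 + κ)) 0 0 t = 0 := by
  obtain ⟨m, hm0, hm⟩ := hz.norm_exp_le
  refine ⟨m, fun κ hκm hκ => ?_⟩
  obtain ⟨a, ha⟩ := hz.exists_gaussianIntegral_kernel_eq hD hκ
  suffices a = 0 by
    intro t ht
    rw [ha t ht, this, zero_mul]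
  set f : ℝ → ℂ → ℂ := fun t lam => 2 * Complex.I * lam / (lam ^ 2 + κ)
    * Complex.exp ((0 : ℝ) * (Complex.I * lam * (0 : ℝ)) - D * lam ^ 2 * t) with hf
  set N := ∫ s, ‖f 1 (z s) * deriv z s‖ with hN
  have hint := hz.contourIntegrable_gaussian hD (hz.expBounded_kernel hκ) 0 0 one_pos
  have hle : ∀ t : ℝ, 0 < t → ‖a‖ ≤ N * Real.exp (-(D * (κ - m)) * t) * Real.exp (-(D * κ)) := by
    intro t ht
    have h1 : ‖a * Complex.exp (D * κ * (t + 1 : ℝ))‖ ≤ Real.exp (D * m * t) * N := by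
      rw [← ha (t + 1) (by linarith), hN, ← integral_const_mul]
      refine norm_integral_le_of_norm_le (hint.norm.const_mul _) (ae_of_all _ fun s => ?_)
      have e : f (t + 1) (z s) = Complex.exp (-D * z s ^ 2 * t) * f 1 (z s) := by
        simp only [hf, mul_left_comm (Complex.exp (-D * z s ^ 2 * t))]
        rw [← Complex.exp_add]
        congr 2
        push_cast
        ring
      change ‖f (t + 1) (z s) * deriv z s‖ ≤ _
      rw [e, mul_assoc, norm_mul]
      gcongr
      exact hm D t hD.le ht.le s
    have h2 : ‖Complex.exp (D * κ * (t + 1 : ℝ))‖ = Real.exp (D * κ * (t + 1)) := by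
      rw [Complex.norm_exp]
      congr 1
      have : (D * κ * (t + 1 : ℝ) : ℂ) = ((D * κ * (t + 1) : ℝ) : ℂ) := by push_cast; ring
      rw [this, Complex.ofReal_re]
    rw [norm_mul, h2] at h1
    have hN0 : 0 ≤ N := integral_nonneg fun _ => norm_nonneg _
    have h3 : ‖a‖ ≤ Real.exp (D * m * t) * N * Real.exp (-(D * κ * (t + 1))) := by
      rw [Real.exp_neg, ← div_eq_mul_inv, le_div_iff₀ (Real.exp_pos _)]
      exact h1
    refine h3.trans (le_of_eq ?_)
    rw [mul_comm _ N, mul_assoc N, mul_assoc N, ← Real.exp_add, ← Real.exp_add]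
    congr 2
    ring
  have hlim : Tendsto (fun t : ℝ => N * Real.exp (-(D * (κ - m)) * t) * Real.exp (-(D * κ))) atTop
      (𝓝 (N * 0 * Real.exp (-(D * κ)))) := by
    refine ((Real.tendsto_exp_atBot.comp ?_).const_mul N).mul_const _
    exact tendsto_id.const_mul_atTop_of_neg (by nlinarith)
  rw [mul_zero, zero_mul] at hlim
  have := ge_of_tendsto hlim (eventually_gt_atTop 0 |>.mono hle)
  exact norm_le_zero_iff.1 this

/-- The Gaussian integral of the kernel: the boundary datum produced at `x = 0`. The constant comes
from comparing, as `t → 0`, with a kernel whose pole lies so high that its integral vanishes. -/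
lemma gaussianIntegral_kernel {D : ℝ} (hD : 0 < D) {κ : ℝ}
    (hκ : (√κ : ℂ) * Complex.I ∉ range z) {t : ℝ} (ht : 0 < t) :
    gaussianIntegral z D (fun lam => 2 * Complex.I * lam / (lam ^ 2 + κ)) 0 0 t
      = 2 * Real.pi * (1 - windingNumber z (√κ * Complex.I)) * Complex.exp (D * κ * t) := by
  obtain ⟨m, hm⟩ := hz.exists_gaussianIntegral_kernel_eq_zero hD
  obtain ⟨y, ⟨hy1, hy2⟩, hym⟩ :=
    (hz.eventually_windingNumber_eq_one.and (eventually_ge_atTop (|m| + 1))).exists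
  have hy0 : 0 ≤ y := by linarith [abs_nonneg m]
  have hsy : √(y ^ 2) = y := Real.sqrt_sq hy0
  have hκ' : (√(y ^ 2) : ℂ) * Complex.I ∉ range z := by rwa [hsy]
  have hzero := hm (y ^ 2) (by nlinarith [le_abs_self m, abs_nonneg m]) hκ'
  obtain ⟨a, ha⟩ := hz.exists_gaussianIntegral_kernel_eq hD hκ
  have hdiff := hz.contourIntegral_kernel_sub_kernel hκ hκ'
  rw [hsy, hy1] at hdiff
  obtain ⟨K₁, hK₁, h₁⟩ := hz.exists_norm_kernel_le hκ
  obtain ⟨c, hc, h₃⟩ := hz.exists_norm_sq_add_ge hκ'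
  set g : ℂ → ℂ := fun lam => 2 * Complex.I * lam / (lam ^ 2 + κ)
        - 2 * Complex.I * lam / (lam ^ 2 + (y ^ 2 : ℝ)) with hg
  have hgc : Continuous fun s => g (z s) := (hz.continuous_kernel hκ).sub (hz.continuous_kernel hκ')
  have hgK : ∀ s, ‖g (z s)‖ ≤ K₁ * (‖((y ^ 2 : ℝ) - κ : ℂ)‖ / c) / (1 + |s|) ^ 2 := fun s => by
    have k1 := hz.kernel_ne_zero hκ s
    have k2 := hz.kernel_ne_zero hκ' s
    have e : g (z s) = 2 * Complex.I * z s / (z s ^ 2 + κ)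
        * (((y ^ 2 : ℝ) - κ) / (z s ^ 2 + (y ^ 2 : ℝ))) := by
      simp only [hg]
      field_simp
      ring
    have hs1 : 1 ≤ 1 + |s| := by linarith [abs_nonneg s]
    rw [e, norm_mul]
    have h6 : ‖((y ^ 2 : ℝ) - κ : ℂ) / (z s ^ 2 + (y ^ 2 : ℝ))‖
        ≤ ‖((y ^ 2 : ℝ) - κ : ℂ)‖ / c / (1 + |s|) := by
      rw [norm_div, div_div]
      gcongr
      refine le_trans ?_ (h₃ s)
      have : 1 + |s| ≤ (1 + |s|) ^ 2 := by nlinarith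
      gcongr
    calc _ ≤ (K₁ / (1 + |s|)) * (‖((y ^ 2 : ℝ) - κ : ℂ)‖ / c / (1 + |s|)) := by
          gcongr
          exact h₁ s
      _ = _ := by field_simp
  have hlim1 := hz.tendsto_contourIntegral_exp_mul hD hgc hgK
  have hlim2 : Tendsto (fun t : ℝ => a * Complex.exp (D * κ * t)) (𝓝[>] 0)
      (𝓝 (a * Complex.exp (D * κ * (0 : ℝ)))) :=
    (Continuous.tendsto (by fun_prop) 0).mono_left nhdsWithin_le_nhds
  have heq : ∀ t : ℝ, 0 < t → contourIntegral z (fun lam =>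
      Complex.exp (-D * lam ^ 2 * t) * g lam) = a * Complex.exp (D * κ * t) := fun t ht => by
    rw [← ha t ht, ← sub_zero (gaussianIntegral _ _ _ _ _ _), ← hzero t ht]
    refine Eq.trans ?_ (integral_sub
      (hz.contourIntegrable_gaussian hD (hz.expBounded_kernel hκ) 0 0 ht)
      (hz.contourIntegrable_gaussian hD (hz.expBounded_kernel hκ') 0 0 ht))
    refine integral_congr_ae (ae_of_all _ fun s => ?_)
    beta_reduce
    have e : (0 : ℝ) * (Complex.I * z s * (0 : ℝ)) - D * z s ^ 2 * t = -D * z s ^ 2 * t := by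
      push_cast; ring
    rw [e]
    simp only [hg]
    ring
  have := tendsto_nhds_unique (hlim1.congr' (by
    filter_upwards [self_mem_nhdsWithin] with t ht using heq t ht)) hlim2
  rw [Complex.ofReal_zero, mul_zero, Complex.exp_zero, mul_one] at this
  rw [ha t ht, ← this, hdiff]
  ring

end IsContour

/-! ### Uniqueness -/

/-- At a critical local maximum the second derivative is not positive. -/
lemma deriv_deriv_nonpos_of_isLocalMax {f : ℝ → ℝ} {x : ℝ} (h : IsLocalMax f x)
    (hc : ContinuousAt f x) : deriv (deriv f) x ≤ 0 := by
  by_contra! hpos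
  have hmin := isLocalMin_of_deriv_deriv_pos hpos h.deriv_eq_zero hc
  have hconst : f =ᶠ[𝓝 x] fun _ => f x := by
    filter_upwards [h, hmin] with y h1 h2 using le_antisymm h1 h2
  have h2 : deriv f =ᶠ[𝓝 x] fun _ => 0 := by
    filter_upwards [hconst.eventuallyEq_nhds] with y hy
    rw [hy.deriv_eq, deriv_const]
  rw [h2.deriv_eq, deriv_const] at hpos
  exact lt_irrefl _ hpos

/-- The maximum principle, for the difference `v` of two solutions. It is applied to
`v exp (-K x - M t)`, where `K > -C` gives the Robin condition the good sign and `M > D K ^ 2` makes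
the equation for the product strictly dissipative. -/
lemma nonpos_of_heat {D L C : ℝ} (hD : 0 < D) (hL : 0 < L) {v : ℝ → ℝ → ℝ}
    (hcont : ContinuousOn (fun p : ℝ × ℝ => v p.1 p.2) (Icc 0 L ×ˢ Ici 0))
    (hdt : ∀ x ∈ Ioo 0 L, ∀ t, 0 < t → DifferentiableAt ℝ (fun s => v x s) t)
    (hdx : ∀ x ∈ Ioo 0 L, ∀ t, 0 < t → DifferentiableAt ℝ (fun y => v y t) x)
    (hdxx : ∀ x ∈ Ioo 0 L, ∀ t, 0 < t → DifferentiableAt ℝ (deriv fun y => v y t) x)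
    (heat : ∀ x ∈ Ioo 0 L, ∀ t, 0 < t →
      deriv (fun s => v x s) t = D * deriv (deriv fun y => v y t) x)
    (hinit : ∀ x ∈ Icc 0 L, v x 0 = 0) (hdir : ∀ t, 0 < t → v 0 t = 0)
    (hrob : ∀ t, 0 < t → ∃ d : ℝ,
      HasDerivWithinAt (fun x => v x t) d (Icc 0 L) L ∧ d + C * v L t = 0)
    {x t : ℝ} (hx : x ∈ Icc 0 L) (ht : 0 ≤ t) : v x t ≤ 0 := by
  by_contra! hpos
  set K := |C| + 1 with hK
  set M := D * K ^ 2 + 1 with hM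
  have hKC : 0 < K + C := by linarith [neg_abs_le C]
  set u : ℝ × ℝ → ℝ := fun p => v p.1 p.2 * Real.exp (-K * p.1 - M * p.2) with hu
  have hcompact : IsCompact (Icc 0 L ×ˢ Icc 0 t) := isCompact_Icc.prod isCompact_Icc
  have hucont : ContinuousOn u (Icc 0 L ×ˢ Icc 0 t) :=
    (hcont.mono (prod_mono_right Icc_subset_Ici_self)).mul (by fun_prop)
  obtain ⟨⟨x₀, t₀⟩, ⟨hx₀, ht₀⟩, hmax⟩ :=
    hcompact.exists_isMaxOn ⟨(x, t), hx, ⟨ht, le_rfl⟩⟩ hucont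
  have hmax' : ∀ y ∈ Icc 0 L, ∀ s ∈ Icc 0 t, u (y, s) ≤ u (x₀, t₀) := fun y hy s hs =>
    hmax (show (y, s) ∈ Icc 0 L ×ˢ Icc 0 t from ⟨hy, hs⟩)
  have hu0 : 0 < u (x₀, t₀) :=
    (mul_pos hpos (Real.exp_pos _)).trans_le (hmax' x hx t ⟨ht, le_rfl⟩)
  have hv0 : 0 < v x₀ t₀ := pos_of_mul_pos_left hu0 (Real.exp_pos _).le
  simp only at hx₀ ht₀
  have ht0 : 0 < t₀ := by
    rcases ht₀.1.eq_or_lt with h | h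
    · rw [← h, hinit x₀ hx₀] at hv0
      exact absurd hv0 (lt_irrefl _)
    · exact h
  have hx0 : 0 < x₀ := by
    rcases hx₀.1.eq_or_lt with h | h
    · rw [← h, hdir t₀ ht0] at hv0
      exact absurd hv0 (lt_irrefl _)
    · exact h
  -- The space profile of the product at time `t₀`, and its first derivative.
  set E := Real.exp (-M * t₀) with hE
  have hEpos : 0 < E := Real.exp_pos _
  have hprof : ∀ y ∈ Icc 0 L, v y t₀ * Real.exp (-K * y) ≤ v x₀ t₀ * Real.exp (-K * x₀) := by
    intro y hy
    have h := hmax' y hy t₀ ht₀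
    simp only [hu] at h
    have e : ∀ y, Real.exp (-K * y - M * t₀) = Real.exp (-K * y) * E := fun y => by
      rw [hE, ← Real.exp_add]; congr 1; ring
    rw [e, e, ← mul_assoc, ← mul_assoc] at h
    exact le_of_mul_le_mul_right h hEpos
  have hexp : ∀ y : ℝ, HasDerivAt (fun y => Real.exp (-K * y)) (Real.exp (-K * y) * -K) y :=
    fun y => by
      have := ((hasDerivAt_id y).const_mul (-K)).exp
      simpa using this
  rcases hx₀.2.eq_or_lt with hxL | hxL
  · subst hxL
    obtain ⟨d, hd, hdC⟩ := hrob t₀ ht0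
    have h1 := hd.mul (hexp x₀).hasDerivWithinAt
    -- A maximum at the right end point has a nonnegative one-sided derivative.
    have h2 : 0 ≤ d * Real.exp (-K * x₀) + v x₀ t₀ * (Real.exp (-K * x₀) * -K) := by
      have hs : Tendsto (slope (fun y => v y t₀ * Real.exp (-K * y)) x₀) (𝓝[Ico 0 x₀] x₀)
          (𝓝 (d * Real.exp (-K * x₀) + v x₀ t₀ * (Real.exp (-K * x₀) * -K))) := by
        have := hasDerivWithinAt_iff_tendsto_slope.1 h1
        rwa [Icc_sdiff_right] at this
      have hne : (𝓝[Ico 0 x₀] x₀).NeBot := by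
        rw [nhdsWithin_Ico_eq_nhdsLT hx0]; infer_instance
      refine ge_of_tendsto hs ?_
      filter_upwards [self_mem_nhdsWithin] with y hy
      rw [slope_def_field]
      exact div_nonneg_of_nonpos (sub_nonpos.2 (hprof y ⟨hy.1, hy.2.le⟩))
        (sub_nonpos.2 hy.2.le)
    have h3 : d = -C * v x₀ t₀ := by linarith
    rw [h3] at h2
    have h4 : 0 < (K + C) * v x₀ t₀ * Real.exp (-K * x₀) := by positivity
    linarith
  · have hxo : x₀ ∈ Ioo 0 L := ⟨hx0, hxL⟩
    set p := deriv (fun y => v y t₀) x₀ with hp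
    set r := deriv (deriv fun y => v y t₀) x₀ with hr
    have hnear : ∀ᶠ y in 𝓝 x₀, y ∈ Ioo 0 L := Ioo_mem_nhds hx0 hxL
    set f : ℝ → ℝ := fun y => v y t₀ * Real.exp (-K * y) with hf
    have hf1 : ∀ y ∈ Ioo 0 L, HasDerivAt f
        (deriv (fun y => v y t₀) y * Real.exp (-K * y) + v y t₀ * (Real.exp (-K * y) * -K)) y :=
      fun y hy => (hdx y hy t₀ ht0).hasDerivAt.mul (hexp y)
    have hlmax : IsLocalMax f x₀ := by
      filter_upwards [hnear] with y hy using hprof y (Ioo_subset_Icc_self hy)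
    have hf1' : p * Real.exp (-K * x₀) + v x₀ t₀ * (Real.exp (-K * x₀) * -K) = 0 := by
      rw [← (hf1 x₀ hxo).deriv]; exact hlmax.deriv_eq_zero
    have hpv : p = K * v x₀ t₀ := by
      have := Real.exp_pos (-K * x₀)
      have h : (p - K * v x₀ t₀) * Real.exp (-K * x₀) = 0 := by linarith
      rcases mul_eq_zero.1 h with h | h
      · linarith
      · exact absurd h this.ne'
    have hf2 : HasDerivAt (deriv f)
        ((r * Real.exp (-K * x₀) + p * (Real.exp (-K * x₀) * -K))
          + (p * (Real.exp (-K * x₀) * -K) + v x₀ t₀ * (Real.exp (-K * x₀) * -K * -K))) x₀ := by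
      have h1 := ((hdxx x₀ hxo t₀ ht0).hasDerivAt.mul (hexp x₀)).add
        ((hdx x₀ hxo t₀ ht0).hasDerivAt.mul ((hexp x₀).mul_const (-K)))
      refine h1.congr_of_eventuallyEq ?_
      filter_upwards [hnear] with y hy using (hf1 y hy).deriv
    have hf2' := deriv_deriv_nonpos_of_isLocalMax hlmax (hf1 x₀ hxo).continuousAt
    rw [hf2.deriv] at hf2'
    have hrv : r ≤ K ^ 2 * v x₀ t₀ := by
      rw [hpv] at hf2'
      have h : (r - K ^ 2 * v x₀ t₀) * Real.exp (-K * x₀) ≤ 0 := by linarith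
      have := nonpos_of_mul_nonpos_left h (Real.exp_pos _)
      linarith
    -- The time derivative of the product at `t₀`, a left-sided maximum.
    have hexpt : HasDerivAt (fun s => Real.exp (-M * s)) (Real.exp (-M * t₀) * -M) t₀ := by
      have := ((hasDerivAt_id t₀).const_mul (-M)).exp
      simpa using this
    have ht1 := (hdt x₀ hxo t₀ ht0).hasDerivAt.mul hexpt
    have h2 : 0 ≤ deriv (fun s => v x₀ s) t₀ * Real.exp (-M * t₀)
        + v x₀ t₀ * (Real.exp (-M * t₀) * -M) := by
      have hs := (hasDerivWithinAt_iff_tendsto_slope.1 (ht1.hasDerivWithinAt (s := Icc 0 t₀)))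
      rw [Icc_sdiff_right] at hs
      have hne : (𝓝[Ico 0 t₀] t₀).NeBot := by
        rw [nhdsWithin_Ico_eq_nhdsLT ht0]; infer_instance
      refine ge_of_tendsto hs ?_
      filter_upwards [self_mem_nhdsWithin] with s hs
      rw [slope_def_field]
      refine div_nonneg_of_nonpos (sub_nonpos.2 ?_) (sub_nonpos.2 hs.2.le)
      have h := hmax' x₀ hx₀ s ⟨hs.1, hs.2.le.trans ht₀.2⟩
      simp only [hu] at h
      have e : ∀ s, Real.exp (-K * x₀ - M * s) = Real.exp (-M * s) * Real.exp (-K * x₀) :=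
        fun s => by rw [← Real.exp_add]; congr 1; ring
      rw [e, e, ← mul_assoc, ← mul_assoc] at h
      exact le_of_mul_le_mul_right h (Real.exp_pos _)
    rw [heat x₀ hxo t₀ ht0] at h2
    have h3 : 0 ≤ (D * r - M * v x₀ t₀) * Real.exp (-M * t₀) := by
      have e : (D * r - M * v x₀ t₀) * Real.exp (-M * t₀)
        = D * r * Real.exp (-M * t₀) + v x₀ t₀ * (Real.exp (-M * t₀) * -M) := by ring
      rw [e]; exact h2
    have h4 : 0 ≤ D * r - M * v x₀ t₀ := nonneg_of_mul_nonneg_left h3 (Real.exp_pos _)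
    have h5 : D * r ≤ D * (K ^ 2 * v x₀ t₀) := by gcongr
    rw [hM] at h4
    nlinarith

namespace IsSolution

variable {D L A B C : ℝ} {w w' : ℝ → ℝ → ℝ}

lemma initial' (h : IsSolution D L A B C w) (hL : 0 < L) :
    ∀ x ∈ Icc 0 L, w x 0 = Real.exp (-A * x) := by
  have hc : ContinuousOn (fun x => w x 0) (Icc 0 L) :=
    h.continuousOn.comp (f := fun x : ℝ => (x, (0 : ℝ))) (by fun_prop)
      fun x hx => ⟨hx, self_mem_Ici⟩
  have hcl : closure (Ioo 0 L) = Icc 0 L := closure_Ioo hL.ne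
  have : EqOn (fun x => w x 0) (fun x => Real.exp (-A * x)) (Icc 0 L) :=
    EqOn.of_subset_closure (s := Ioo 0 L) (fun x hx => h.initial x hx) hc (by fun_prop)
      Ioo_subset_Icc_self hcl.ge
  exact this

lemma le_of_isSolution (h : IsSolution D L A B C w) (h' : IsSolution D L A B C w')
    (hD : 0 < D) (hL : 0 < L) {x t : ℝ} (hx : x ∈ Icc 0 L) (ht : 0 ≤ t) : w x t ≤ w' x t := by
  have hder : ∀ y ∈ Ioo 0 L, ∀ s, 0 < s → deriv (fun y => w y s - w' y s) =ᶠ[𝓝 y]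
      fun y => deriv (fun y => w y s) y - deriv (fun y => w' y s) y := fun y hy s hs => by
    filter_upwards [Ioo_mem_nhds hy.1 hy.2] with r hr
    exact deriv_sub (h.differentiableAt_x r hr s hs) (h'.differentiableAt_x r hr s hs)
  have := nonpos_of_heat (C := C) hD hL (v := fun x t => w x t - w' x t)
    (h.continuousOn.sub h'.continuousOn)
    (fun y hy s hs => (h.differentiableAt_t y hy s hs).sub (h'.differentiableAt_t y hy s hs))
    (fun y hy s hs => (h.differentiableAt_x y hy s hs).sub (h'.differentiableAt_x y hy s hs))
    (fun y hy s hs => (hder y hy s hs).differentiableAt_iff.2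
      ((h.differentiableAt_xx y hy s hs).sub (h'.differentiableAt_xx y hy s hs)))
    (fun y hy s hs => by
      rw [deriv_fun_sub (h.differentiableAt_t y hy s hs) (h'.differentiableAt_t y hy s hs),
        (hder y hy s hs).deriv_eq, deriv_fun_sub (h.differentiableAt_xx y hy s hs)
          (h'.differentiableAt_xx y hy s hs), h.heat y hy s hs, h'.heat y hy s hs]
      ring)
    (fun y hy => by rw [h.initial' hL y hy, h'.initial' hL y hy, sub_self])
    (fun s hs => by rw [h.dirichlet s hs, h'.dirichlet s hs, sub_self])
    (fun s hs => by
      obtain ⟨d, hd, e⟩ := h.robin s hs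
      obtain ⟨d', hd', e'⟩ := h'.robin s hs
      exact ⟨d - d', hd.sub hd', by linarith⟩) hx ht
  linarith

lemma unique (h : IsSolution D L A B C w) (h' : IsSolution D L A B C w')
    (hD : 0 < D) (hL : 0 < L) {x t : ℝ} (hx : x ∈ Icc 0 L) (ht : 0 ≤ t) : w x t = w' x t :=
  le_antisymm (h.le_of_isSolution h' hD hL hx ht) (h'.le_of_isSolution h hD hL hx ht)

end IsSolution

/-! ### The contour integral solves the problem -/

/-- The coefficient of `exp (σ i lam x)`, for `σ = ±1`, in `dirichletMode`. -/
noncomputable def dirichletCoeff (C L σ : ℝ) (lam : ℂ) : ℂ :=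
  (lam + σ * Complex.I * C) * Complex.exp (-(σ * Complex.I * L) * lam) * (2 * Delta C lam (-L))⁻¹

/-- The coefficient of `exp (σ i lam x)`, for `σ = ±1`, in `robinMode`. -/
noncomputable def robinCoeff (C L σ : ℝ) (lam : ℂ) : ℂ :=
  σ * (-Complex.I) * (2 * Delta C lam (-L))⁻¹

/-- The coefficient of `exp (σ i lam x)`, for `σ = ±1`, in `solutionTransform`. -/
noncomputable def solutionCoeff (κ A C L σ : ℝ) (lam : ℂ) : ℂ :=
  2 * Complex.I * lam / (lam ^ 2 + κ) * dirichletCoeff C L σ lam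
    + 2 * Complex.I * lam / (lam ^ 2 + (A ^ 2 : ℝ)) * (-1 * (dirichletCoeff C L σ lam
      + (C - A) * Complex.exp (-A * L) * robinCoeff C L σ lam))

lemma dirichletMode_eq_add (C L x : ℝ) (lam : ℂ) :
    dirichletMode C L x lam = dirichletCoeff C L 1 lam * Complex.exp (Complex.I * lam * x)
      + dirichletCoeff C L (-1) lam * Complex.exp (-(Complex.I * lam * x)) := by
  have e1 : Complex.exp (Complex.I * lam * (x - L : ℝ))
      = Complex.exp (-(((1 : ℝ) : ℂ) * Complex.I * L) * lam)
        * Complex.exp (Complex.I * lam * x) := by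
    rw [← Complex.exp_add]; congr 1; push_cast; ring
  have e2 : Complex.exp (-(Complex.I * lam * (x - L : ℝ)))
      = Complex.exp (-(((-1 : ℝ) : ℂ) * Complex.I * L) * lam)
        * Complex.exp (-(Complex.I * lam * x)) := by
    rw [← Complex.exp_add]; congr 1; push_cast; ring
  rw [dirichletMode, Delta_eq_exp C lam (x - L), e1, e2, dirichletCoeff, dirichletCoeff, mul_inv]
  push_cast
  ring

lemma robinMode_eq_add (C L x : ℝ) (lam : ℂ) :
    robinMode C L x lam = robinCoeff C L 1 lam * Complex.exp (Complex.I * lam * x)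
      + robinCoeff C L (-1) lam * Complex.exp (-(Complex.I * lam * x)) := by
  have e1 : lam * x * Complex.I = Complex.I * lam * x := by ring
  have e2 : -(lam * x) * Complex.I = -(Complex.I * lam * x) := by ring
  rw [robinMode, Complex.sin, e1, e2, robinCoeff, robinCoeff, mul_inv]
  push_cast
  ring

lemma solutionTransform_eq_add (κ A C L x : ℝ) (lam : ℂ) :
    solutionTransform κ A C L x lam
      = solutionCoeff κ A C L 1 lam * Complex.exp (Complex.I * lam * x)
      + solutionCoeff κ A C L (-1) lam * Complex.exp (-(Complex.I * lam * x)) := by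
  rw [solutionTransform, dataMode, dirichletMode_eq_add, robinMode_eq_add, solutionCoeff,
    solutionCoeff]
  ring

/-- The Robin condition, in terms of the exponential coefficients. -/
lemma solutionCoeff_robin {κ A C L : ℝ} {lam : ℂ} (hΔ : Delta C lam (-L) ≠ 0) :
    (Complex.I * lam + C) * solutionCoeff κ A C L 1 lam * Complex.exp (Complex.I * lam * L)
      + (-(Complex.I * lam) + C) * solutionCoeff κ A C L (-1) lam
        * Complex.exp (-(Complex.I * lam * L))
      = -((C - A) * Complex.exp (-A * L)) * (2 * Complex.I * lam / (lam ^ 2 + (A ^ 2 : ℝ))) := by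
  have e1 : -(((1 : ℝ) : ℂ) * Complex.I * L) * lam = -(Complex.I * lam * L) := by push_cast; ring
  have e2 : -(((-1 : ℝ) : ℂ) * Complex.I * L) * lam = Complex.I * lam * L := by push_cast; ring
  have hδ : 2 * Delta C lam (-L) = (lam + Complex.I * C) * Complex.exp (-(Complex.I * lam * L))
      + (lam - Complex.I * C) * Complex.exp (Complex.I * lam * L) := by
    have f1 : Complex.I * lam * (-L : ℝ) = -(Complex.I * lam * L) := by push_cast; ring
    rw [Delta_eq_exp, f1, neg_neg]
    ring
  set G := (2 * Delta C lam (-L))⁻¹ with hG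
  have hinv : ((lam + Complex.I * C) * Complex.exp (-(Complex.I * lam * L))
      + (lam - Complex.I * C) * Complex.exp (Complex.I * lam * L)) * G = 1 := by
    rw [← hδ]
    exact mul_inv_cancel₀ (mul_ne_zero two_ne_zero hΔ)
  have h1 : (Complex.I * lam + C) * dirichletCoeff C L 1 lam * Complex.exp (Complex.I * lam * L)
      + (-(Complex.I * lam) + C) * dirichletCoeff C L (-1) lam
        * Complex.exp (-(Complex.I * lam * L)) = 0 := by
    rw [dirichletCoeff, dirichletCoeff, e1, e2, ← hG]
    push_cast
    linear_combination (2 * C * lam * Complex.exp (Complex.I * lam * L)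
      * Complex.exp (-(Complex.I * lam * L)) * G) * Complex.I_sq
  have h2 : (Complex.I * lam + C) * robinCoeff C L 1 lam * Complex.exp (Complex.I * lam * L)
      + (-(Complex.I * lam) + C) * robinCoeff C L (-1) lam
        * Complex.exp (-(Complex.I * lam * L)) = 1 := by
    rw [robinCoeff, robinCoeff, ← hG]
    push_cast
    linear_combination hinv - (lam * (Complex.exp (Complex.I * lam * L)
      + Complex.exp (-(Complex.I * lam * L))) * G) * Complex.I_sq
  rw [solutionCoeff, solutionCoeff]
  linear_combination (2 * Complex.I * lam / (lam ^ 2 + κ)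
    - 2 * Complex.I * lam / (lam ^ 2 + (A ^ 2 : ℝ))) * h1
    - 2 * Complex.I * lam / (lam ^ 2 + (A ^ 2 : ℝ)) * (C - A) * Complex.exp (-A * L) * h2

/-- The derivative of `dirichletMode` in `x`. -/
noncomputable def dirichletModeDeriv (C L x : ℝ) (lam : ℂ) : ℂ :=
  (-lam ^ 2 * Complex.sin (lam * (x - L : ℝ)) - C * lam * Complex.cos (lam * (x - L : ℝ)))
    / Delta C lam (-L)

lemma hasDerivAt_mul_sub (L x : ℝ) (lam : ℂ) :
    HasDerivAt (fun x : ℝ => lam * ((x - L : ℝ) : ℂ)) lam x := by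
  have := ((Complex.ofRealCLM.hasDerivAt (x := x)).sub_const (L : ℂ)).const_mul lam
  simpa using this

lemma hasDerivAt_dirichletMode (C L x : ℝ) (lam : ℂ) :
    HasDerivAt (fun x => dirichletMode C L x lam) (dirichletModeDeriv C L x lam) x := by
  have h := hasDerivAt_mul_sub L x lam
  have hcos := (Complex.hasDerivAt_cos _).comp x h
  have hsin := (Complex.hasDerivAt_sin _).comp x h
  convert! ((hcos.const_mul lam).sub (hsin.const_mul (C : ℂ))).div_const (Delta C lam (-L)) using 1
  rw [dirichletModeDeriv]
  ring

lemma hasDerivAt_dirichletModeDeriv (C L x : ℝ) (lam : ℂ) :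
    HasDerivAt (fun x => dirichletModeDeriv C L x lam) (-lam ^ 2 * dirichletMode C L x lam) x := by
  have h := hasDerivAt_mul_sub L x lam
  have hcos := (Complex.hasDerivAt_cos _).comp x h
  have hsin := (Complex.hasDerivAt_sin _).comp x h
  convert! ((hsin.const_mul (-lam ^ 2)).sub (hcos.const_mul (C * lam : ℂ))).div_const
    (Delta C lam (-L)) using 1
  rw [dirichletMode, Delta]
  ring

lemma dirichletMode_robin (C L : ℝ) (lam : ℂ) :
    dirichletModeDeriv C L L lam + C * dirichletMode C L L lam = 0 := by
  have h : Delta C lam (L - L) = lam := by simp [Delta]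
  rw [dirichletModeDeriv, dirichletMode, h, sub_self, Complex.ofReal_zero, mul_zero,
    Complex.sin_zero, Complex.cos_zero]
  ring

lemma gaussianIntegral_heat (z : ℝ → ℂ) (D : ℝ) {c : ℂ → ℂ} {σ : ℝ} (hσ : σ ^ 2 = 1) (x t : ℝ) :
    gaussianIntegral z D (fun lam => -D * lam ^ 2 * c lam) σ x t
      = D * gaussianIntegral z D
        (fun lam => σ * Complex.I * lam * (σ * Complex.I * lam * c lam)) σ x t := by
  have hσ' : (σ : ℂ) ^ 2 = 1 := by exact_mod_cast hσ
  rw [← IsContour.gaussianIntegral_const_mul]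
  congr 1
  ext lam
  linear_combination (-D * lam ^ 2 * c lam * Complex.I ^ 2) * hσ'
    - (D * lam ^ 2 * c lam) * Complex.I_sq

/-- The solution as a contour integral: `w₁ + w₂`, with `w₂` replaced by its residue so that the
expression makes sense at `x = 0` as well. -/
noncomputable def complexSolution (D L A B C : ℝ) (z : ℝ → ℂ) (x t : ℝ) : ℂ :=
  (2 * Real.pi : ℂ)⁻¹ * (contourIntegral z fun lam =>
      Complex.exp (-D * lam ^ 2 * t) * solutionTransform (B / D) A C L x lam)
    + Complex.exp (B * t) * (windingNumber z (√(B / D) * Complex.I)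
      * dirichletMode C L x (√(B / D) * Complex.I))

namespace IsContour

variable {z : ℝ → ℂ} (hz : IsContour z) {D L A B C : ℝ}
include hz

lemma windingNumber_sqrt_mul_sq (κ : ℝ) :
    windingNumber z (√κ * Complex.I) * (-(√κ * Complex.I) ^ 2)
      = windingNumber z (√κ * Complex.I) * κ := by
  rcases le_or_gt κ 0 with h | h
  · rw [Real.sqrt_eq_zero_of_nonpos h, hz.windingNumber_of_im_nonpos (by simp), zero_mul, zero_mul]
  · rw [mul_pow, Complex.I_sq, ← Complex.ofReal_pow, Real.sq_sqrt h.le]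
    ring

lemma contourIntegrable_V₁ (hD : 0 < D) (hL : 0 < L) (hCL : -1 ≤ C * L)
    (hκ : (√(B / D) : ℂ) * Complex.I ∉ range z) (hA : (√(A ^ 2) : ℂ) * Complex.I ∉ range z)
    {x : ℝ} (hx : x ∈ Icc 0 L) {t : ℝ} (ht : 0 ≤ t) :
    ContourIntegrable z (V₁ D L A B C x t) := by
  obtain ⟨K, hK⟩ := hz.exists_norm_solutionTransform_le hL hCL hκ hA
  refine (hz.contourIntegrable_exp_mul hD ht
    (hz.continuous_solutionTransform hL hCL hκ hA x) (hK x hx)).congr (ae_of_all _ fun s => ?_)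
  beta_reduce
  rw [V₁_eq hD x t (Delta_ne_zero hL hCL (hz.upper s)) (hz.kernel_ne_zero hA s)]

lemma complexSolution_eq (hD : 0 < D) (hL : 0 < L) (hCL : -1 ≤ C * L)
    (hκ : (√(B / D) : ℂ) * Complex.I ∉ range z) (hA : (√(A ^ 2) : ℂ) * Complex.I ∉ range z)
    {x : ℝ} (hx : x ∈ Ioc 0 L) (t : ℝ) :
    complexSolution D L A B C z x t = w₁ D L A B C z x t + w₂ D L B C z x t := by
  rw [hz.w₂_eq hL hCL hD hκ hx, complexSolution, w₁, one_div]
  congr 2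
  refine integral_congr_ae (ae_of_all _ fun s => ?_)
  beta_reduce
  rw [V₁_eq hD x t (Delta_ne_zero hL hCL (hz.upper s)) (hz.kernel_ne_zero hA s)]

lemma expBounded_inv_Delta (hL : 0 < L) (hCL : -1 ≤ C * L) :
    ExpBounded z fun lam => (2 * Delta C lam (-L))⁻¹ := by
  obtain ⟨c, hc, h⟩ := hz.exists_norm_Delta_ge_range hL hCL
  refine .of_norm_le (K := c⁻¹) ?_ fun s => ?_
  · refine Continuous.inv₀ (continuous_const.mul
      ((differentiable_Delta C (-L)).continuous.comp hz.continuous)) fun s =>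
      mul_ne_zero two_ne_zero (Delta_ne_zero hL hCL (hz.upper s))
  · rw [norm_inv, norm_mul, Complex.norm_ofNat]
    refine inv_anti₀ hc ?_
    have h1 : 1 ≤ Real.exp ((z s).im * L) := Real.one_le_exp (mul_pos (hz.upper s) hL).le
    have h2 : c ≤ c * (1 + |s|) * Real.exp ((z s).im * L) := by
      have : c * 1 * 1 ≤ c * (1 + |s|) * Real.exp ((z s).im * L) := by
        gcongr
        linarith [abs_nonneg s]
      linarith
    linarith [h s]

lemma expBounded_solutionCoeff (hL : 0 < L) (hCL : -1 ≤ C * L) {κ : ℝ}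
    (hκ : (√κ : ℂ) * Complex.I ∉ range z) (hA : (√(A ^ 2) : ℂ) * Complex.I ∉ range z) (σ : ℝ) :
    ExpBounded z (solutionCoeff κ A C L σ) := by
  have hΔ := hz.expBounded_inv_Delta hL hCL
  have hd : ExpBounded z (dirichletCoeff C L σ) :=
    ((hz.expBounded_id.add (.const _)).mul (hz.expBounded_exp _)).mul hΔ
  have hr : ExpBounded z (robinCoeff C L σ) := (ExpBounded.const _).mul hΔ
  exact ((hz.expBounded_kernel hκ).mul hd).add ((hz.expBounded_kernel hA).mul
    ((ExpBounded.const _).mul (hd.add ((ExpBounded.const _).mul hr))))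

lemma contourIntegral_exp_mul_solutionTransform (hD : 0 < D) (hL : 0 < L) (hCL : -1 ≤ C * L) {κ : ℝ}
    (hκ : (√κ : ℂ) * Complex.I ∉ range z) (hA : (√(A ^ 2) : ℂ) * Complex.I ∉ range z)
    (x : ℝ) {t : ℝ} (ht : 0 < t) :
    contourIntegral z (fun lam => Complex.exp (-D * lam ^ 2 * t) * solutionTransform κ A C L x lam)
      = gaussianIntegral z D (solutionCoeff κ A C L 1) 1 x t
        + gaussianIntegral z D (solutionCoeff κ A C L (-1)) (-1) x t := by
  have hc := hz.expBounded_solutionCoeff hL hCL hκ hA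
  refine Eq.trans ?_ (integral_add (hz.contourIntegrable_gaussian hD (hc 1) 1 x ht)
    (hz.contourIntegrable_gaussian hD (hc (-1)) (-1) x ht))
  refine integral_congr_ae (ae_of_all _ fun s => ?_)
  beta_reduce
  have e1 : Complex.exp (((1 : ℝ) : ℂ) * (Complex.I * z s * x) - D * z s ^ 2 * t)
      = Complex.exp (Complex.I * z s * x) * Complex.exp (-D * z s ^ 2 * t) := by
    rw [← Complex.exp_add]; congr 1; push_cast; ring
  have e2 : Complex.exp (((-1 : ℝ) : ℂ) * (Complex.I * z s * x) - D * z s ^ 2 * t)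
      = Complex.exp (-(Complex.I * z s * x)) * Complex.exp (-D * z s ^ 2 * t) := by
    rw [← Complex.exp_add]; congr 1; push_cast; ring
  rw [solutionTransform_eq_add, e1, e2]
  ring

/-- The contour integral satisfies the heat equation; its first derivative in `x` is recorded for
the Robin condition. -/
lemma exists_deriv_complexSolution (hD : 0 < D) (hL : 0 < L) (hCL : -1 ≤ C * L)
    (hκ : (√(B / D) : ℂ) * Complex.I ∉ range z) (hA : (√(A ^ 2) : ℂ) * Complex.I ∉ range z)
    (hA1 : windingNumber z (√(A ^ 2) * Complex.I) = 1) {t : ℝ} (ht : 0 < t) :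
    ∃ F₁ F₂ : ℝ → ℂ,
      (∀ x, HasDerivAt (fun x => complexSolution D L A B C z x t) (F₁ x) x) ∧
      (∀ x, HasDerivAt F₁ (F₂ x) x) ∧
      (∀ x, HasDerivAt (fun t => complexSolution D L A B C z x t) (D * F₂ x) t) ∧
      F₁ L + C * complexSolution D L A B C z L t = 0 := by
  have hD' : (D : ℂ) ≠ 0 := by exact_mod_cast hD.ne'
  set c := solutionCoeff (B / D) A C L with hcdef
  have hc : ∀ σ, ExpBounded z (c σ) := hz.expBounded_solutionCoeff hL hCL hκ hA
  have hc1 : ∀ σ : ℝ, ExpBounded z fun lam => σ * Complex.I * lam * c σ lam := fun σ =>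
    ((ExpBounded.const (σ * Complex.I)).mul hz.expBounded_id).mul (hc σ)
  set p : ℂ := √(B / D) * Complex.I with hp
  set n := windingNumber z p with hn
  have hn2 : n * (-p ^ 2) = n * (B / D : ℝ) := hz.windingNumber_sqrt_mul_sq (B / D)
  have hF : ∀ x t : ℝ, 0 < t → complexSolution D L A B C z x t
      = (2 * Real.pi : ℂ)⁻¹ * (gaussianIntegral z D (c 1) 1 x t
        + gaussianIntegral z D (c (-1)) (-1) x t)
        + Complex.exp (B * t) * (n * dirichletMode C L x p) := fun x t ht => by
    rw [complexSolution, hz.contourIntegral_exp_mul_solutionTransform hD hL hCL hκ hA x ht]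
  refine ⟨fun x => (2 * Real.pi : ℂ)⁻¹ *
      (gaussianIntegral z D (fun lam => (1 : ℝ) * Complex.I * lam * c 1 lam) 1 x t
        + gaussianIntegral z D (fun lam => (-1 : ℝ) * Complex.I * lam * c (-1) lam) (-1) x t)
        + Complex.exp (B * t) * (n * dirichletModeDeriv C L x p),
    fun x => (2 * Real.pi : ℂ)⁻¹ *
      (gaussianIntegral z D
          (fun lam => (1 : ℝ) * Complex.I * lam * ((1 : ℝ) * Complex.I * lam * c 1 lam)) 1 x t
        + gaussianIntegral z D
          (fun lam => (-1 : ℝ) * Complex.I * lam * ((-1 : ℝ) * Complex.I * lam * c (-1) lam))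
          (-1) x t)
        + Complex.exp (B * t) * (n * (-p ^ 2 * dirichletMode C L x p)), ?_, ?_, ?_, ?_⟩
  · intro x
    simp only [hF _ t ht]
    exact (((hz.hasDerivAt_gaussianIntegral_x hD (hc 1) 1 x ht).add
      (hz.hasDerivAt_gaussianIntegral_x hD (hc (-1)) (-1) x ht)).const_mul _).add
      (((hasDerivAt_dirichletMode C L x p).const_mul n).const_mul _)
  · intro x
    exact (((hz.hasDerivAt_gaussianIntegral_x hD (hc1 1) 1 x ht).add
      (hz.hasDerivAt_gaussianIntegral_x hD (hc1 (-1)) (-1) x ht)).const_mul _).add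
      (((hasDerivAt_dirichletModeDeriv C L x p).const_mul n).const_mul _)
  · intro x
    have h1 : HasDerivAt (fun t : ℝ => Complex.exp (B * (t : ℂ)))
        (Complex.exp (B * t) * (B * 1)) t :=
      ((Complex.ofRealCLM.hasDerivAt (x := t)).const_mul (B : ℂ)).cexp
    have h2 := (((hz.hasDerivAt_gaussianIntegral_t hD (hc 1) 1 x ht).add
      (hz.hasDerivAt_gaussianIntegral_t hD (hc (-1)) (-1) x ht)).const_mul
        (2 * Real.pi : ℂ)⁻¹).add (h1.mul_const (n * dirichletMode C L x p))
    rw [gaussianIntegral_heat z D (by norm_num), gaussianIntegral_heat z D (by norm_num)] at h2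
    have h3 := h2.congr_of_eventuallyEq (f₁ := fun t => complexSolution D L A B C z x t) (by
      filter_upwards [lt_mem_nhds ht] with t ht using hF x t ht)
    convert! h3 using 1
    have hB : n * (-p ^ 2) * D = n * B := by
      rw [hn2]; push_cast; field_simp
    linear_combination (Complex.exp (B * t) * dirichletMode C L x p) * hB
  · have h1 : gaussianIntegral z D (fun lam => (1 : ℝ) * Complex.I * lam * c 1 lam
          + C * c 1 lam) 1 L t
        + gaussianIntegral z D (fun lam => (-1 : ℝ) * Complex.I * lam * c (-1) lam
          + C * c (-1) lam) (-1) L t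
        = gaussianIntegral z D (fun lam => -((C - A) * Complex.exp (-A * L))
          * (2 * Complex.I * lam / (lam ^ 2 + (A ^ 2 : ℝ)))) 0 0 t := by
      refine (integral_add
        (hz.contourIntegrable_gaussian hD ((hc1 1).add ((ExpBounded.const _).mul (hc 1))) 1 L ht)
        (hz.contourIntegrable_gaussian hD ((hc1 (-1)).add ((ExpBounded.const _).mul (hc (-1))))
          (-1) L ht)).symm.trans ?_
      refine integral_congr_ae (ae_of_all _ fun s => ?_)
      beta_reduce
      have e1 : Complex.exp (((1 : ℝ) : ℂ) * (Complex.I * z s * L) - D * z s ^ 2 * t)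
          = Complex.exp (Complex.I * z s * L) * Complex.exp (-D * z s ^ 2 * t) := by
        rw [← Complex.exp_add]; congr 1; push_cast; ring
      have e2 : Complex.exp (((-1 : ℝ) : ℂ) * (Complex.I * z s * L) - D * z s ^ 2 * t)
          = Complex.exp (-(Complex.I * z s * L)) * Complex.exp (-D * z s ^ 2 * t) := by
        rw [← Complex.exp_add]; congr 1; push_cast; ring
      have e3 : Complex.exp (((0 : ℝ) : ℂ) * (Complex.I * z s * (0 : ℝ)) - D * z s ^ 2 * t)
          = Complex.exp (-D * z s ^ 2 * t) := by
        congr 1; push_cast; ring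
      have key := solutionCoeff_robin (κ := B / D) (A := A) (Delta_ne_zero hL hCL (hz.upper s))
      rw [e1, e2, e3, hcdef]
      push_cast
      push_cast at key
      linear_combination (Complex.exp (-D * z s ^ 2 * t) * deriv z s) * key
    rw [gaussianIntegral_const_mul, hz.gaussianIntegral_kernel hD hA ht, hA1,
      hz.gaussianIntegral_add hD (hc1 1) ((ExpBounded.const _).mul (hc 1)) _ _ ht,
      hz.gaussianIntegral_add hD (hc1 (-1)) ((ExpBounded.const _).mul (hc (-1))) _ _ ht,
      gaussianIntegral_const_mul, gaussianIntegral_const_mul] at h1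
    rw [hF L t ht]
    linear_combination (2 * Real.pi : ℂ)⁻¹ * h1
      + Complex.exp (B * t) * n * dirichletMode_robin C L p

lemma continuousOn_complexSolution (hD : 0 < D) (hL : 0 < L) (hCL : -1 ≤ C * L)
    (hκ : (√(B / D) : ℂ) * Complex.I ∉ range z) (hA : (√(A ^ 2) : ℂ) * Complex.I ∉ range z) :
    ContinuousOn (fun p : ℝ × ℝ => complexSolution D L A B C z p.1 p.2) (Icc 0 L ×ˢ Ici 0) := by
  obtain ⟨K, hK⟩ := hz.exists_norm_solutionTransform_le hL hCL hκ hA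
  have h1 := hz.continuousOn_contourIntegral_exp_mul hD (E := Icc 0 L)
    (g := fun x => solutionTransform (B / D) A C L x)
    (fun s => continuous_solutionTransform_left _ _ _)
    (fun x => hz.continuous_solutionTransform hL hCL hκ hA x) hK
  have h2 : Continuous fun x => dirichletMode C L x (√(B / D) * Complex.I) := by
    unfold dirichletMode
    fun_prop
  exact (h1.const_smul (2 * Real.pi : ℂ)⁻¹).add (Continuous.continuousOn (by fun_prop))

lemma complexSolution_initial (hL : 0 < L) (hCL : -1 ≤ C * L)
    (hκ : (√(B / D) : ℂ) * Complex.I ∉ range z) (hA : (√(A ^ 2) : ℂ) * Complex.I ∉ range z)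
    (hA1 : windingNumber z (√(A ^ 2) * Complex.I) = 1) (hA0 : A ≠ 0) {x : ℝ} (hx : x ∈ Ioc 0 L) :
    complexSolution D L A B C z x 0 = Complex.exp (-A * x) := by
  have hpi : (Real.pi : ℂ) ≠ 0 := by exact_mod_cast Real.pi_ne_zero
  simp only [complexSolution, Complex.ofReal_zero, mul_zero, Complex.exp_zero, one_mul]
  rw [hz.contourIntegral_solutionTransform hL hCL hκ hA hx, hA1, dataMode_pole hL hCL hA0]
  field_simp
  ring

lemma complexSolution_dirichlet (hD : 0 < D) (hL : 0 < L) (hCL : -1 ≤ C * L)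
    (hκ : (√(B / D) : ℂ) * Complex.I ∉ range z) (hA : (√(A ^ 2) : ℂ) * Complex.I ∉ range z)
    (hA1 : windingNumber z (√(A ^ 2) * Complex.I) = 1) {t : ℝ} (ht : 0 < t) :
    complexSolution D L A B C z 0 t = Complex.exp (B * t) := by
  have hpi : (Real.pi : ℂ) ≠ 0 := by exact_mod_cast Real.pi_ne_zero
  have hD' : (D : ℂ) ≠ 0 := by exact_mod_cast hD.ne'
  have hmode : ∀ lam : ℂ, 0 < lam.im → dirichletMode C L 0 lam = 1 := fun lam h => by
    rw [dirichletMode, zero_sub, div_self (Delta_ne_zero hL hCL h)]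
  have h1 : contourIntegral z (fun lam =>
      Complex.exp (-D * lam ^ 2 * t) * solutionTransform (B / D) A C L 0 lam)
      = gaussianIntegral z D (fun lam => 2 * Complex.I * lam / (lam ^ 2 + (B / D : ℝ))) 0 0 t
        - gaussianIntegral z D
          (fun lam => 2 * Complex.I * lam / (lam ^ 2 + (A ^ 2 : ℝ))) 0 0 t := by
    refine Eq.trans ?_ (integral_sub
      (hz.contourIntegrable_gaussian hD (hz.expBounded_kernel hκ) 0 0 ht)
      (hz.contourIntegrable_gaussian hD (hz.expBounded_kernel hA) 0 0 ht))
    refine integral_congr_ae (ae_of_all _ fun s => ?_)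
    beta_reduce
    have e : ((0 : ℝ) : ℂ) * (Complex.I * z s * (0 : ℝ)) - D * z s ^ 2 * t = -D * z s ^ 2 * t := by
      push_cast; ring
    have hr : robinMode C L 0 (z s) = 0 := by simp [robinMode]
    rw [e, solutionTransform, dataMode, hmode _ (hz.upper s), hr]
    ring
  have h2 : windingNumber z (√(B / D) * Complex.I) * dirichletMode C L 0 (√(B / D) * Complex.I)
      = windingNumber z (√(B / D) * Complex.I) := by
    rcases le_or_gt (B / D) 0 with h | h
    · rw [Real.sqrt_eq_zero_of_nonpos h, hz.windingNumber_of_im_nonpos (by simp), zero_mul]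
    · rw [hmode _ (by simpa using h), mul_one]
  have hB : (D : ℂ) * (B / D : ℝ) = B := by push_cast; field_simp
  rw [complexSolution, h1, h2, hz.gaussianIntegral_kernel hD hκ ht,
    hz.gaussianIntegral_kernel hD hA ht, hA1, hB]
  field_simp
  ring

/-- Every real part of the contour integral, with respect to any real-linear functional fixing the
real numbers, is a solution. By uniqueness the contour integral is then real. -/
lemma isSolution_apply_complexSolution (hD : 0 < D) (hL : 0 < L) (hCL : -1 ≤ C * L)
    (hκ : (√(B / D) : ℂ) * Complex.I ∉ range z) (hA : (√(A ^ 2) : ℂ) * Complex.I ∉ range z)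
    (hA1 : windingNumber z (√(A ^ 2) * Complex.I) = 1) (hA0 : A ≠ 0) (ℓ : ℂ →L[ℝ] ℝ)
    (hℓ : ℓ 1 = 1) : IsSolution D L A B C fun x t => ℓ (complexSolution D L A B C z x t) := by
  have hd : ∀ {f : ℝ → ℂ} {f' : ℂ} {x : ℝ}, HasDerivAt f f' x →
      HasDerivAt (fun x => ℓ (f x)) (ℓ f') x := fun h => ℓ.hasFDerivAt.comp_hasDerivAt _ h
  have hmul : ∀ (r : ℝ) (u : ℂ), ℓ (r * u) = r * ℓ u := fun r u => by
    rw [← Complex.real_smul, ℓ.map_smul, smul_eq_mul]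
  have hreal : ∀ r : ℝ, ℓ r = r := fun r => by
    rw [← mul_one (r : ℂ), hmul, hℓ, mul_one]
  have hder := fun {t : ℝ} (ht : 0 < t) =>
    hz.exists_deriv_complexSolution hD hL hCL hκ hA hA1 ht
  constructor
  · exact ℓ.continuous.comp_continuousOn (hz.continuousOn_complexSolution hD hL hCL hκ hA)
  · intro x _ t ht
    obtain ⟨F₁, F₂, -, -, h3, -⟩ := hder ht
    exact (hd (h3 x)).differentiableAt
  · intro x _ t ht
    obtain ⟨F₁, F₂, h1, -, -, -⟩ := hder ht
    exact (hd (h1 x)).differentiableAt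
  · intro x _ t ht
    obtain ⟨F₁, F₂, h1, h2, -, -⟩ := hder ht
    rw [show (deriv fun y => ℓ (complexSolution D L A B C z y t)) = fun y => ℓ (F₁ y) from
      funext fun y => (hd (h1 y)).deriv]
    exact (hd (h2 x)).differentiableAt
  · intro x _ t ht
    obtain ⟨F₁, F₂, h1, h2, h3, -⟩ := hder ht
    rw [show (deriv fun y => ℓ (complexSolution D L A B C z y t)) = fun y => ℓ (F₁ y) from
      funext fun y => (hd (h1 y)).deriv, (hd (h2 x)).deriv, (hd (h3 x)).deriv, hmul]
  · intro x hx
    rw [hz.complexSolution_initial hL hCL hκ hA hA1 hA0 (Ioo_subset_Ioc_self hx)]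
    exact_mod_cast hreal (Real.exp (-A * x))
  · intro t ht
    rw [hz.complexSolution_dirichlet hD hL hCL hκ hA hA1 ht]
    exact_mod_cast hreal (Real.exp (B * t))
  · intro t ht
    obtain ⟨F₁, F₂, h1, -, -, h4⟩ := hder ht
    refine ⟨ℓ (F₁ L), (hd (h1 L)).hasDerivWithinAt, ?_⟩
    have := congrArg ℓ h4
    rwa [map_add, hmul, map_zero] at this

lemma ofReal_eq_complexSolution (hD : 0 < D) (hL : 0 < L) (hCL : -1 ≤ C * L)
    (hκ : (√(B / D) : ℂ) * Complex.I ∉ range z) (hA : (√(A ^ 2) : ℂ) * Complex.I ∉ range z)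
    (hA1 : windingNumber z (√(A ^ 2) * Complex.I) = 1) (hA0 : A ≠ 0) {w : ℝ → ℝ → ℝ}
    (hw : IsSolution D L A B C w) {x t : ℝ} (hx : x ∈ Icc 0 L) (ht : 0 ≤ t) :
    (w x t : ℂ) = complexSolution D L A B C z x t := by
  have h1 := hw.unique (hz.isSolution_apply_complexSolution hD hL hCL hκ hA hA1 hA0
    Complex.reCLM (by simp)) hD hL hx ht
  have h2 := hw.unique (hz.isSolution_apply_complexSolution hD hL hCL hκ hA hA1 hA0
    (Complex.reCLM + Complex.imCLM) (by simp)) hD hL hx ht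
  simp only [_root_.add_apply, Complex.reCLM_apply, Complex.imCLM_apply] at h1 h2
  apply Complex.ext
  · simpa using h1
  · rw [Complex.ofReal_im]
    linarith

end IsContour

/-! ### The explicit form of the residue -/

lemma dirichletMode_mul_I (C L x γ : ℝ) :
    dirichletMode C L x (γ * Complex.I)
      = (((γ * Real.cosh (γ * (L - x)) + C * Real.sinh (γ * (L - x)))
        / (γ * Real.cosh (γ * L) + C * Real.sinh (γ * L)) : ℝ) : ℂ) := by
  have key : ∀ y : ℝ, Delta C (γ * Complex.I) (-y)
      = Complex.I * ((γ * Real.cosh (γ * y) + C * Real.sinh (γ * y) : ℝ) : ℂ) := fun y => by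
    have e : (γ * Complex.I : ℂ) = -Complex.I * -γ := by ring
    have e' : -(γ : ℂ) * (-y : ℝ) = γ * y := by push_cast; ring
    rw [e, Delta_neg_I_mul, e']
    push_cast
    ring
  rw [dirichletMode, key, ← neg_sub L x, key, mul_div_mul_left _ _ Complex.I_ne_zero,
    ← Complex.ofReal_div]

end Infiltration

theorem mainTheorem1 (a b D L θ₀ θL q A B C γ : ℝ)
    (ha : 0 < a) (hD : 0 < D) (hL : 0 < L)
    (hA : A = a / D * (θ₀ + b)) (hB : B = a / D * q) (hC : C = a / D * (θL + b))
    (hγ : γ = Real.sqrt (B / D))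
    (hCL : -1 ≤ C * L)
    (z : ℝ → ℂ) (hz : Infiltration.IsContour z)
    (hzA : (|A| : ℝ) * Complex.I ∈ Infiltration.inside z)
    (hzγ : 0 < q → (γ : ℂ) * Complex.I ∉ Set.range z) :
    (∃ w : ℝ → ℝ → ℝ, Infiltration.IsSolution D L A B C w) ∧
    (∀ w : ℝ → ℝ → ℝ, Infiltration.IsSolution D L A B C w →
      ∀ x ∈ Set.Ioc 0 L, ∀ t, 0 < t →
        Infiltration.ContourIntegrable z (Infiltration.V₁ D L A B C x t) ∧
        Infiltration.ContourIntegrable z (Infiltration.V₂ D L B C x t) ∧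
        (w x t : ℂ) = Infiltration.w₁ D L A B C z x t + Infiltration.w₂ D L B C z x t) ∧
    (0 < q → (γ : ℂ) * Complex.I ∈ Infiltration.inside z →
      ∀ x ∈ Set.Ioc 0 L, ∀ t, 0 < t →
        Infiltration.w₂ D L B C z x t =
          ((Real.exp (B * t) *
            ((Real.sqrt (a * q) * Real.cosh (γ * (L - x))
                + a * (θL + b) * Real.sinh (γ * (L - x))) /
              (Real.sqrt (a * q) * Real.cosh (γ * L)
                + a * (θL + b) * Real.sinh (γ * L))) : ℝ) : ℂ)) ∧
    (0 < q → (γ : ℂ) * Complex.I ∈ Infiltration.outside z →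
      ∀ x ∈ Set.Ioc 0 L, ∀ t, 0 < t → Infiltration.w₂ D L B C z x t = 0) ∧
    (q ≤ 0 → ∀ x ∈ Set.Ioc 0 L, ∀ t, 0 < t → Infiltration.w₂ D L B C z x t = 0) := by
  have hκ : (√(B / D) : ℂ) * Complex.I ∉ Set.range z := by
    rcases le_or_gt q 0 with hq | hq
    · refine hz.notMem_range_of_im_nonpos ?_
      have hBD : B / D ≤ 0 := by
        rw [hB]
        exact div_nonpos_of_nonpos_of_nonneg
          (mul_nonpos_of_nonneg_of_nonpos (div_pos ha hD).le hq) hD.le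
      rw [Real.sqrt_eq_zero_of_nonpos hBD]
      simp
    · rw [← hγ]
      exact hzγ hq
  have hzA' : (√(A ^ 2) : ℂ) * Complex.I ∈ Infiltration.inside z := by
    rwa [Real.sqrt_sq_eq_abs]
  have hA := Infiltration.notMem_range_of_mem_inside hzA'
  have hA1 := hz.windingNumber_of_mem_inside hzA'
  -- The real axis is outside the contour, so `i |A|` can be inside only if `A ≠ 0`.
  have hA0 : A ≠ 0 := by
    rintro rfl
    simpa using hz.im_pos_of_mem_inside hzA
  have hw₂ := fun {x : ℝ} (hx : x ∈ Set.Ioc 0 L) (t : ℝ) => hz.w₂_eq hL hCL hD hκ hx t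
  refine ⟨⟨_, hz.isSolution_apply_complexSolution hD hL hCL hκ hA hA1 hA0 Complex.reCLM (by simp)⟩,
    fun w hw x hx t ht => ⟨?_, ?_, ?_⟩, fun hq hin x hx t _ => ?_,
    fun hq hout x hx t _ => ?_, fun hq x hx t _ => ?_⟩
  · exact hz.contourIntegrable_V₁ hD hL hCL hκ hA (Set.Ioc_subset_Icc_self hx) ht.le
  · exact hz.contourIntegrable_V₂ hL hCL hD hκ hx t
  · rw [← hz.complexSolution_eq hD hL hCL hκ hA hx t,
      hz.ofReal_eq_complexSolution hD hL hCL hκ hA hA1 hA0 hw (Set.Ioc_subset_Icc_self hx) ht.le]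
  · rw [hw₂ hx, ← hγ, hz.windingNumber_of_mem_inside hin, one_mul,
      Infiltration.dirichletMode_mul_I]
    have hBD : 0 ≤ B / D := by rw [hB]; positivity
    have h1 : √(a * q) = D * γ := by
      rw [hγ, ← Real.sqrt_sq hD.le, ← Real.sqrt_mul (sq_nonneg D), Real.sqrt_sq hD.le, hB]
      congr 1
      field_simp
    have h2 : a * (θL + b) = D * C := by rw [hC]; field_simp
    rw [h1, h2, mul_assoc D γ, mul_assoc D C, ← mul_add, mul_assoc D γ, mul_assoc D C, ← mul_add,
      mul_div_mul_left _ _ hD.ne']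
    push_cast
    ring
  · rw [hw₂ hx, ← hγ, hz.windingNumber_of_mem_outside hout, zero_mul, mul_zero]
  · have hBD : B / D ≤ 0 := by
      rw [hB]
      exact div_nonpos_of_nonpos_of_nonneg
        (mul_nonpos_of_nonneg_of_nonpos (div_pos ha hD).le hq) hD.le
    rw [hw₂ hx, Real.sqrt_eq_zero_of_nonpos hBD, hz.windingNumber_of_im_nonpos (by simp), zero_mul,
      mul_zero]
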